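/- Let $\mathcal M$ be a strict 2-category (the mode theory). Cubical MTT over $\mathcal M$ is the multimodal type theory in which every object $m$ of $\mathcal M$ (a mode) carries a copy of De Morgan cubical type theory (interval $\mathbb I$, face lattice $\mathbb F$, systems, path types, composition, glue types, dependent sums, booleans, a universe $\mathsf U$ with decoding $\mathsf{El}$, and modal dependent products), every 1-cell $\mu : n \to m$ (a modality) induces a lock $\Gamma \mapsto \Gamma.\{\mu\}$ from contexts at mode $m$ to contexts at mode $n$ (2-functorially, contravariantly on 1-cells and on 2-cells), context extensions $\Gamma.(\mu \mid A)$ and modal types $\langle \mu \mid A\rangle$ with introduction $\mathsf{mod}_\mu$ and their dependent elimination (modal induction), and in which locks commute with the cubical structure: there are exchange operations $r \mapsto r^{\mu}$ on interval terms and $\varphi \mapsto \varphi^{\mu}$ on faces, compatible with the algebraic operations, with substitution and with the 2-categorical structure, such that the induced substitutions $\Gamma.\mathbb I.\{\mu\} \to \Gamma.\{\mu\}.\mathbb I$ and $\Gamma.\varphi.\{\mu\} \to \Gamma.\{\mu\}.\varphi^{\mu}$ are invertible. Composition in $\langle \mu \mid A\rangle$ commutes with $\mathsf{mod}_\mu$.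 **Theorem (modal extensionality).** Let $\mu : n \to m$ be a modality, $\Gamma$ a context at mode $m$, $\Gamma.\{\mu\} \vdash t : \mathsf U$ at mode $n$, $A = \mathsf{El}(t)$, and let $\Gamma.\{\mu\} \vdash a, b : A$ at mode $n$. Then there is a derivable term, at mode $m$ in context $\Gamma$, $$\Gamma \vdash e \;:\; \langle \mu \mid \mathsf{Path}_A(a,b)\rangle \;\simeq\; \mathsf{Path}_{\langle \mu \mid A\rangle}(\mathsf{mod}_\mu\, a,\ \mathsf{mod}_\mu\, b).$$ Here $X \simeq Y$ is the type of equivalences, i.e. of functions $f : X \to Y$ together with $g : Y \to X$ and a family of paths from $g(f\,x)$ to $x$, and $h : Y \to X$ and a family of paths from $f(h\,y)$ to $y$. The same holds in every extension of the theory by further judgemental equalities between interval terms, faces, types or terms (for instance the usual computation rules of composition at the remaining type formers). -/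

import Mathlib

open CategoryTheory

namespace CubicalMTT

universe w v u

/-! # Raw syntax

The mode theory is a strict 2-category `M`: objects are modes, a 1-cell `μ : n ⟶ m` is a modality
from mode `n` to mode `m`, and the composite `μ ∘ ν` of `ν : o ⟶ n` and `μ : n ⟶ m` is `ν ≫ μ`.
Every syntactic class is indexed by its mode. Variables are nameless and substitutions explicit. -/

section RawSyntax

variable (M : Type u) [Bicategory.{w, v} M]

mutual

/-- Raw contexts. -/
inductive Cx : M → Type (max u v w)
  /-- the empty context -/
  | emp {m : M} : Cx m
  /-- the locked context `Γ.{μ}` -/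
  | lock {m n : M} (μ : n ⟶ m) (Γ : Cx m) : Cx n
  /-- `Γ.(μ ∣ A)`: extension by a variable of type `A` annotated with `μ` -/
  | ext {m n : M} (Γ : Cx m) (μ : n ⟶ m) (A : Ty n) : Cx m
  /-- `Γ.𝕀`: extension by a dimension variable -/
  | extI {m : M} (Γ : Cx m) : Cx m
  /-- `Γ.φ`: restriction by a face -/
  | res {m : M} (Γ : Cx m) (φ : Face m) : Cx m

/-- Raw substitutions. -/
inductive Sb : M → Type (max u v w)
  /-- identity -/
  | id {m : M} : Sb m
  /-- `ξ ∘ δ` (first `δ`) -/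
  | comp {m : M} (ξ δ : Sb m) : Sb m
  /-- the substitution into the empty context -/
  | emp {m : M} : Sb m
  /-- weakening `Γ.(μ ∣ A) → Γ` -/
  | wk {m : M} : Sb m
  /-- weakening `Γ.𝕀 → Γ` -/
  | wkI {m : M} : Sb m
  /-- weakening `Γ.φ → Γ` -/
  | wkF {m : M} (φ : Face m) : Sb m
  /-- functorial action of a lock -/
  | lock {m n : M} (μ : n ⟶ m) (δ : Sb m) : Sb n
  /-- the key `Γ.{μ} → Γ.{ν}` of a 2-cell `α : ν ⟶ μ` -/
  | key {m n : M} {μ ν : n ⟶ m} (α : ν ⟶ μ) (Γ : Cx m) : Sb n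
  /-- `(δ, a) : Γ → Δ.(μ ∣ A)` -/
  | ext {m n : M} (δ : Sb m) (a : Tm n) : Sb m
  /-- `(δ, r) : Γ → Δ.𝕀` -/
  | extI {m : M} (δ : Sb m) (r : Dim m) : Sb m
  /-- `δ.φ : Γ → Δ.φ`, when `φ[δ] = ⊤` -/
  | res {m : M} (δ : Sb m) (φ : Face m) : Sb m
  /-- inverse interval exchange `Γ.{μ}.𝕀 → Γ.𝕀.{μ}` -/
  | excIinv {m n : M} (μ : n ⟶ m) : Sb n
  /-- inverse face exchange `Γ.{μ}.(φ^μ) → Γ.φ.{μ}` -/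
  | excFinv {m n : M} (μ : n ⟶ m) (φ : Face m) : Sb n

/-- Raw interval terms. -/
inductive Dim : M → Type (max u v w)
  | var {m : M} : Dim m
  | sub {m : M} (r : Dim m) (δ : Sb m) : Dim m
  | zero {m : M} : Dim m
  | one {m : M} : Dim m
  /-- `1 - r` -/
  | inv {m : M} (r : Dim m) : Dim m
  | join {m : M} (r s : Dim m) : Dim m
  | meet {m : M} (r s : Dim m) : Dim m
  /-- the exchange `r^μ`, an interval term in the locked context -/
  | exc {m n : M} (μ : n ⟶ m) (r : Dim m) : Dim n

/-- Raw faces. The face `(r = 1)` is `(1 - r = 0)`. -/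
inductive Face : M → Type (max u v w)
  /-- `(r = 0)` -/
  | eq0 {m : M} (r : Dim m) : Face m
  | bot {m : M} : Face m
  | top {m : M} : Face m
  | join {m : M} (φ ψ : Face m) : Face m
  | meet {m : M} (φ ψ : Face m) : Face m
  | sub {m : M} (φ : Face m) (δ : Sb m) : Face m
  /-- the exchange `φ^μ`, a face in the locked context -/
  | exc {m n : M} (μ : n ⟶ m) (φ : Face m) : Face n

/-- Raw types. -/
inductive Ty : M → Type (max u v w)
  | sub {m : M} (A : Ty m) (δ : Sb m) : Ty m
  /-- dependent product `(μ ∣ A) → B` -/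
  | pi {m n : M} (μ : n ⟶ m) (A : Ty n) (B : Ty m) : Ty m
  | sigma {m : M} (A B : Ty m) : Ty m
  | bool {m : M} : Ty m
  /-- dependent path type, `A` lives in `Γ.𝕀` -/
  | path {m : M} (A : Ty m) (a b : Tm m) : Ty m
  /-- modal type `⟨μ ∣ A⟩` -/
  | mod {m n : M} (μ : n ⟶ m) (A : Ty n) : Ty m
  /-- the system `[φ A, ψ B]` -/
  | sys {m : M} (φ : Face m) (A : Ty m) (ψ : Face m) (B : Ty m) : Ty m
  /-- the universe of small types -/
  | U {m : M} : Ty m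
  /-- the type of elements of a term of the universe -/
  | el {m : M} (t : Tm m) : Ty m
  /-- `Glue [φ ↦ (T, f)] A` -/
  | glue {m : M} (φ : Face m) (T : Ty m) (f : Tm m) (A : Ty m) : Ty m

/-- Raw terms. -/
inductive Tm : M → Type (max u v w)
  | sub {m : M} (a : Tm m) (δ : Sb m) : Tm m
  /-- the last variable of `Γ.(μ ∣ A)`, available in `Γ.(μ ∣ A).{μ}` -/
  | var {n : M} : Tm n
  | lam {m : M} (b : Tm m) : Tm m
  | app {m n : M} (f : Tm m) (a : Tm n) : Tm m
  | pair {m : M} (a b : Tm m) : Tm m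
  | fst {m : M} (p : Tm m) : Tm m
  | snd {m : M} (p : Tm m) : Tm m
  | tt {m : M} : Tm m
  | ff {m : M} : Tm m
  /-- elimination of `b` into the motive `B` -/
  | boolElim {m : M} (B : Ty m) (t f b : Tm m) : Tm m
  /-- path abstraction -/
  | plam {m : M} (a : Tm m) : Tm m
  /-- path application -/
  | papp {m : M} (p : Tm m) (r : Dim m) : Tm m
  /-- `mod_μ a` -/
  | mod {m n : M} (μ : n ⟶ m) (a : Tm n) : Tm m
  /-- `let_μ mod_ν y ← a in b` with motive `B` -/
  | letmod {m n o : M} (μ : n ⟶ m) (ν : o ⟶ n) (B : Ty m) (a : Tm n) (b : Tm m) : Tm m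
  /-- the binary system `[φ a, ψ b]` -/
  | sys {m : M} (φ : Face m) (a : Tm m) (ψ : Face m) (b : Tm m) : Tm m
  /-- the empty system -/
  | sysNull {m : M} : Tm m
  /-- `comp A [φ ↦ u] u₀`; the line `A` lives in `Γ.𝕀` and `u` in `Γ.φ.𝕀` -/
  | comp {m : M} (A : Ty m) (φ : Face m) (u u₀ : Tm m) : Tm m
  /-- the code of a small type -/
  | code {m : M} (A : Ty m) : Tm m
  /-- `glue [φ ↦ t] a` -/
  | glue {m : M} (φ : Face m) (t a : Tm m) : Tm m
  /-- `unglue b`, for `b` in `Glue [φ ↦ (T, f)] A` -/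
  | unglue {m : M} (φ : Face m) (f b : Tm m) : Tm m

end

end RawSyntax

/-- Types come in two sizes; small types are classified by the universe, and they are large too. -/
inductive Size
  | small
  | large

section Derived

variable {M : Type u} [Bicategory.{w, v} M] {m n : M}

/-! # Derived operations -/

/-- `(id, a) : Γ → Γ.(μ ∣ A)` -/
abbrev Sb.inst (a : Tm M n) : Sb M m := .ext .id a

/-- `(id, r) : Γ → Γ.𝕀` -/
abbrev Sb.instI (r : Dim M m) : Sb M m := .extI .id r

/-- `δ⁺ : Γ.(μ ∣ A[δ]) → Δ.(μ ∣ A)`, where `n` is the mode of `A` -/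
abbrev Sb.up (n : M) (δ : Sb M m) : Sb M m := .ext (δ.comp .wk) (Tm.var (n := n))

/-- `δ.𝕀 : Γ.𝕀 → Δ.𝕀` -/
abbrev Sb.upI (δ : Sb M m) : Sb M m := .extI (δ.comp .wkI) .var

/-- `Γ.φ[δ] → Δ.φ` -/
abbrev Sb.upF (δ : Sb M m) (φ : Face M m) : Sb M m := .res (δ.comp (.wkF (φ.sub δ))) φ

/-- interval exchange `Γ.𝕀.{μ} → Γ.{μ}.𝕀` -/
abbrev Sb.excI (μ : n ⟶ m) : Sb M n := .extI (.lock μ .wkI) (.exc μ .var)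

/-- face exchange `Γ.φ.{μ} → Γ.{μ}.(φ^μ)` -/
abbrev Sb.excF (μ : n ⟶ m) (φ : Face M m) : Sb M n := .res (.lock μ (.wkF φ)) (.exc μ φ)

/-- reversal `Γ.𝕀 → Γ.𝕀` of the last dimension variable -/
abbrev Sb.rev : Sb M m := .extI .wkI (.inv .var)

/-- For a line `A` of types over `Γ.𝕀` and `a : A(0)`, the term `fill A [] a : A` over `Γ.𝕀`, that
is, the composition of the line `j ↦ A(i ∧ j)` which is constantly `a` where `i = 0`. -/
abbrev Tm.transpFill (A : Ty M m) (a : Tm M m) : Tm M m :=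
  .comp (A.sub (.extI (.comp .wkI .wkI) (.meet (.sub .var .wkI) .var))) (.eq0 .var)
    (a.sub (.comp (.comp .wkI (.wkF (.eq0 .var))) .wkI)) (a.sub .wkI)

/-- the non-dependent function type `A → B` -/
abbrev Ty.arr (A B : Ty M m) : Ty M m := .pi (𝟙 m) A (B.sub .wk)

/-- the product `A × B` -/
abbrev Ty.prod (A B : Ty M m) : Ty M m := .sigma A (B.sub .wk)

/-- `Path A a b` for a type `A` that does not depend on the dimension variable -/
abbrev Ty.cpath (A : Ty M m) (a b : Tm M m) : Ty M m := .path (A.sub .wkI) a b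

/-- left inverses of `f : A → B`: `Σ g : B → A, Π x : A, Path A (g (f x)) x` -/
abbrev Ty.leftInv (A B : Ty M m) (f : Tm M m) : Ty M m :=
  .sigma (.arr B A) (.pi (𝟙 m) (A.sub .wk)
    (.cpath ((A.sub .wk).sub .wk)
      (.app (.sub (Tm.var (n := m)) .wk) (.app ((f.sub .wk).sub .wk) (Tm.var (n := m))))
      .var))

/-- right inverses of `f : A → B`: `Σ h : B → A, Π y : B, Path B (f (h y)) y` -/
abbrev Ty.rightInv (A B : Ty M m) (f : Tm M m) : Ty M m :=
  .sigma (.arr B A) (.pi (𝟙 m) (B.sub .wk)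
    (.cpath ((B.sub .wk).sub .wk)
      (.app ((f.sub .wk).sub .wk) (.app (.sub (Tm.var (n := m)) .wk) (Tm.var (n := m))))
      .var))

/-- The type of equivalences `A ≃ B`: functions with a left inverse and a right inverse. -/
abbrev Ty.equiv (A B : Ty M m) : Ty M m :=
  .sigma (.arr A B)
    (.prod (.leftInv (A.sub .wk) (B.sub .wk) .var) (.rightInv (A.sub .wk) (B.sub .wk) .var))

end Derived

section Judgements

variable (M : Type u) [Bicategory.{w, v} M]

/-- The forms of judgement. -/
inductive Judg : Type (max u v w)
  /-- `Γ` is a context -/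
  | ctx {m : M} (Γ : Cx M m)
  | eqCtx {m : M} (Γ Δ : Cx M m)
  /-- `Γ ⊢ δ : Δ` -/
  | sb {m : M} (Γ Δ : Cx M m) (δ : Sb M m)
  | eqSb {m : M} (Γ Δ : Cx M m) (δ ξ : Sb M m)
  /-- `Γ ⊢ r : 𝕀` -/
  | dim {m : M} (Γ : Cx M m) (r : Dim M m)
  | eqDim {m : M} (Γ : Cx M m) (r s : Dim M m)
  /-- `Γ ⊢ φ : 𝔽` -/
  | face {m : M} (Γ : Cx M m) (φ : Face M m)
  | eqFace {m : M} (Γ : Cx M m) (φ ψ : Face M m)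
  /-- `A` is a type of size `s` in `Γ` -/
  | ty {m : M} (Γ : Cx M m) (s : Size) (A : Ty M m)
  | eqTy {m : M} (Γ : Cx M m) (s : Size) (A B : Ty M m)
  /-- `Γ ⊢ a : A` -/
  | tm {m : M} (Γ : Cx M m) (A : Ty M m) (a : Tm M m)
  | eqTm {m : M} (Γ : Cx M m) (A : Ty M m) (a b : Tm M m)

/-- A collection of further judgemental equalities by which the theory may be extended, such as the
computation rules of composition at the type formers other than `⟨μ ∣ A⟩` and `(μ ∣ A) → B`. -/
structure ExtraEqs where
  dim : ∀ {m : M}, Cx M m → Dim M m → Dim M m → Prop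
  face : ∀ {m : M}, Cx M m → Face M m → Face M m → Prop
  ty : ∀ {m : M}, Cx M m → Size → Ty M m → Ty M m → Prop
  tm : ∀ {m : M}, Cx M m → Ty M m → Tm M m → Tm M m → Prop

/-- The extension by no further equalities. -/
def ExtraEqs.none : ExtraEqs M where
  dim _ _ _ := False
  face _ _ _ := False
  ty _ _ _ _ := False
  tm _ _ _ _ := False

end Judgements

section Rules

variable {M : Type u} [Bicategory.{w, v} M] (E : ExtraEqs M)

/-- Derivability in Cubical MTT over the mode theory `M`, extended by the equalities `E`. -/
inductive Der : Judg M → Prop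
  /- Contexts -/
  | cx_emp {m : M} : Der (.ctx (.emp (m := m)))
  | cx_lock {m n : M} {μ : n ⟶ m} {Γ} : Der (.ctx Γ) → Der (.ctx (Γ.lock μ))
  | cx_ext {m n : M} {μ : n ⟶ m} {Γ A} :
      Der (.ctx Γ) → Der (.ty (Γ.lock μ) .large A) → Der (.ctx (Γ.ext μ A))
  | cx_extI {m : M} {Γ : Cx M m} : Der (.ctx Γ) → Der (.ctx Γ.extI)
  | cx_res {m : M} {Γ : Cx M m} {φ} : Der (.ctx Γ) → Der (.face Γ φ) → Der (.ctx (Γ.res φ))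
  /- Context equality -/
  | eqCx_refl {m : M} {Γ : Cx M m} : Der (.ctx Γ) → Der (.eqCtx Γ Γ)
  | eqCx_symm {m : M} {Γ Δ : Cx M m} : Der (.eqCtx Γ Δ) → Der (.eqCtx Δ Γ)
  | eqCx_trans {m : M} {Γ Δ Ξ : Cx M m} :
      Der (.eqCtx Γ Δ) → Der (.eqCtx Δ Ξ) → Der (.eqCtx Γ Ξ)
  | eqCx_compLock {m n o : M} {μ : n ⟶ m} {ν : o ⟶ n} {Γ} :
      Der (.ctx Γ) → Der (.eqCtx (Γ.lock (ν ≫ μ)) ((Γ.lock μ).lock ν))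
  | eqCx_idLock {m : M} {Γ : Cx M m} : Der (.ctx Γ) → Der (.eqCtx (Γ.lock (𝟙 m)) Γ)
  | eqCx_lock {m n : M} {μ : n ⟶ m} {Γ Δ} :
      Der (.eqCtx Γ Δ) → Der (.eqCtx (Γ.lock μ) (Δ.lock μ))
  | eqCx_ext {m n : M} {μ : n ⟶ m} {Γ Δ A B} :
      Der (.eqCtx Γ Δ) → Der (.eqTy (Γ.lock μ) .large A B) → Der (.eqCtx (Γ.ext μ A) (Δ.ext μ B))
  | eqCx_extI {m : M} {Γ Δ : Cx M m} : Der (.eqCtx Γ Δ) → Der (.eqCtx Γ.extI Δ.extI)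
  | eqCx_res {m : M} {Γ Δ : Cx M m} {φ ψ} :
      Der (.eqCtx Γ Δ) → Der (.eqFace Γ φ ψ) → Der (.eqCtx (Γ.res φ) (Δ.res ψ))
  /- Conversion along equal contexts -/
  | sb_conv {m : M} {Γ Γ' Δ Δ' : Cx M m} {δ} :
      Der (.eqCtx Γ Γ') → Der (.eqCtx Δ Δ') → Der (.sb Γ Δ δ) → Der (.sb Γ' Δ' δ)
  | eqSb_conv {m : M} {Γ Γ' Δ Δ' : Cx M m} {δ ξ} :
      Der (.eqCtx Γ Γ') → Der (.eqCtx Δ Δ') → Der (.eqSb Γ Δ δ ξ) → Der (.eqSb Γ' Δ' δ ξ)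
  | dim_conv {m : M} {Γ Γ' : Cx M m} {r} :
      Der (.eqCtx Γ Γ') → Der (.dim Γ r) → Der (.dim Γ' r)
  | eqDim_conv {m : M} {Γ Γ' : Cx M m} {r s} :
      Der (.eqCtx Γ Γ') → Der (.eqDim Γ r s) → Der (.eqDim Γ' r s)
  | face_conv {m : M} {Γ Γ' : Cx M m} {φ} :
      Der (.eqCtx Γ Γ') → Der (.face Γ φ) → Der (.face Γ' φ)
  | eqFace_conv {m : M} {Γ Γ' : Cx M m} {φ ψ} :
      Der (.eqCtx Γ Γ') → Der (.eqFace Γ φ ψ) → Der (.eqFace Γ' φ ψ)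
  | ty_conv {m : M} {Γ Γ' : Cx M m} {s A} :
      Der (.eqCtx Γ Γ') → Der (.ty Γ s A) → Der (.ty Γ' s A)
  | eqTy_conv {m : M} {Γ Γ' : Cx M m} {s A B} :
      Der (.eqCtx Γ Γ') → Der (.eqTy Γ s A B) → Der (.eqTy Γ' s A B)
  | tm_convCx {m : M} {Γ Γ' : Cx M m} {A a} :
      Der (.eqCtx Γ Γ') → Der (.tm Γ A a) → Der (.tm Γ' A a)
  | eqTm_convCx {m : M} {Γ Γ' : Cx M m} {A a b} :
      Der (.eqCtx Γ Γ') → Der (.eqTm Γ A a b) → Der (.eqTm Γ' A a b)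
  /- Substitutions -/
  | sb_id {m : M} {Γ : Cx M m} : Der (.ctx Γ) → Der (.sb Γ Γ .id)
  | sb_comp {m : M} {Γ Δ Ξ : Cx M m} {δ ξ} :
      Der (.sb Γ Δ δ) → Der (.sb Δ Ξ ξ) → Der (.sb Γ Ξ (ξ.comp δ))
  | sb_emp {m : M} {Γ : Cx M m} : Der (.ctx Γ) → Der (.sb Γ .emp .emp)
  | sb_wk {m n : M} {μ : n ⟶ m} {Γ A} :
      Der (.ctx Γ) → Der (.ty (Γ.lock μ) .large A) → Der (.sb (Γ.ext μ A) Γ .wk)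
  | sb_wkI {m : M} {Γ : Cx M m} : Der (.ctx Γ) → Der (.sb Γ.extI Γ .wkI)
  | sb_wkF {m : M} {Γ : Cx M m} {φ} :
      Der (.ctx Γ) → Der (.face Γ φ) → Der (.sb (Γ.res φ) Γ (.wkF φ))
  | sb_lock {m n : M} {μ : n ⟶ m} {Γ Δ δ} :
      Der (.sb Γ Δ δ) → Der (.sb (Γ.lock μ) (Δ.lock μ) (.lock μ δ))
  | sb_key {m n : M} {μ ν : n ⟶ m} {α : ν ⟶ μ} {Γ} :
      Der (.ctx Γ) → Der (.sb (Γ.lock μ) (Γ.lock ν) (.key α Γ))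
  | sb_ext {m n : M} {μ : n ⟶ m} {Γ Δ δ A a} :
      Der (.sb Γ Δ δ) → Der (.ty (Δ.lock μ) .large A) →
      Der (.tm (Γ.lock μ) (A.sub (.lock μ δ)) a) → Der (.sb Γ (Δ.ext μ A) (.ext δ a))
  | sb_extI {m : M} {Γ Δ : Cx M m} {δ r} :
      Der (.sb Γ Δ δ) → Der (.dim Γ r) → Der (.sb Γ Δ.extI (.extI δ r))
  | sb_res {m : M} {Γ Δ : Cx M m} {δ φ} :
      Der (.sb Γ Δ δ) → Der (.face Δ φ) → Der (.eqFace Γ (φ.sub δ) .top) →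
      Der (.sb Γ (Δ.res φ) (.res δ φ))
  | sb_excIinv {m n : M} {μ : n ⟶ m} {Γ} :
      Der (.ctx Γ) → Der (.sb (Γ.lock μ).extI (Γ.extI.lock μ) (.excIinv μ))
  | sb_excFinv {m n : M} {μ : n ⟶ m} {Γ φ} :
      Der (.ctx Γ) → Der (.face Γ φ) →
      Der (.sb ((Γ.lock μ).res (.exc μ φ)) ((Γ.res φ).lock μ) (.excFinv μ φ))
  /- Substitution equality: equivalence relation and congruence -/
  | eqSb_refl {m : M} {Γ Δ : Cx M m} {δ} : Der (.sb Γ Δ δ) → Der (.eqSb Γ Δ δ δ)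
  | eqSb_symm {m : M} {Γ Δ : Cx M m} {δ ξ} : Der (.eqSb Γ Δ δ ξ) → Der (.eqSb Γ Δ ξ δ)
  | eqSb_trans {m : M} {Γ Δ : Cx M m} {δ ξ ζ} :
      Der (.eqSb Γ Δ δ ξ) → Der (.eqSb Γ Δ ξ ζ) → Der (.eqSb Γ Δ δ ζ)
  | eqSb_comp {m : M} {Γ Δ Ξ : Cx M m} {δ δ' ξ ξ'} :
      Der (.eqSb Γ Δ δ δ') → Der (.eqSb Δ Ξ ξ ξ') → Der (.eqSb Γ Ξ (ξ.comp δ) (ξ'.comp δ'))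
  | eqSb_wkF {m : M} {Γ : Cx M m} {φ ψ} :
      Der (.ctx Γ) → Der (.eqFace Γ φ ψ) → Der (.eqSb (Γ.res φ) Γ (.wkF φ) (.wkF ψ))
  | eqSb_lock {m n : M} {μ : n ⟶ m} {Γ Δ δ δ'} :
      Der (.eqSb Γ Δ δ δ') → Der (.eqSb (Γ.lock μ) (Δ.lock μ) (.lock μ δ) (.lock μ δ'))
  | eqSb_key {m n : M} {μ ν : n ⟶ m} {α : ν ⟶ μ} {Γ Γ'} :
      Der (.eqCtx Γ Γ') → Der (.eqSb (Γ.lock μ) (Γ.lock ν) (.key α Γ) (.key α Γ'))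
  | eqSb_ext {m n : M} {μ : n ⟶ m} {Γ Δ δ δ' A a a'} :
      Der (.eqSb Γ Δ δ δ') → Der (.ty (Δ.lock μ) .large A) →
      Der (.eqTm (Γ.lock μ) (A.sub (.lock μ δ)) a a') →
      Der (.eqSb Γ (Δ.ext μ A) (.ext δ a) (.ext δ' a'))
  | eqSb_extI {m : M} {Γ Δ : Cx M m} {δ δ' r r'} :
      Der (.eqSb Γ Δ δ δ') → Der (.eqDim Γ r r') →
      Der (.eqSb Γ Δ.extI (.extI δ r) (.extI δ' r'))
  | eqSb_res {m : M} {Γ Δ : Cx M m} {δ δ' φ φ'} :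
      Der (.eqSb Γ Δ δ δ') → Der (.eqFace Δ φ φ') → Der (.eqFace Γ (φ.sub δ) .top) →
      Der (.eqSb Γ (Δ.res φ) (.res δ φ) (.res δ' φ'))
  | eqSb_excFinv {m n : M} {μ : n ⟶ m} {Γ φ φ'} :
      Der (.ctx Γ) → Der (.eqFace Γ φ φ') →
      Der (.eqSb ((Γ.lock μ).res (.exc μ φ)) ((Γ.res φ).lock μ) (.excFinv μ φ) (.excFinv μ φ'))
  /- Substitution equality: laws -/
  | eqSb_idComp {m : M} {Γ Δ : Cx M m} {δ} :
      Der (.sb Γ Δ δ) → Der (.eqSb Γ Δ (.comp .id δ) δ)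
  | eqSb_compId {m : M} {Γ Δ : Cx M m} {δ} :
      Der (.sb Γ Δ δ) → Der (.eqSb Γ Δ (.comp δ .id) δ)
  | eqSb_assoc {m : M} {Γ Δ Ξ Θ : Cx M m} {δ ξ ζ} :
      Der (.sb Γ Δ δ) → Der (.sb Δ Ξ ξ) → Der (.sb Ξ Θ ζ) →
      Der (.eqSb Γ Θ ((ζ.comp ξ).comp δ) (ζ.comp (ξ.comp δ)))
  | eqSb_emp {m : M} {Γ : Cx M m} {δ} : Der (.sb Γ .emp δ) → Der (.eqSb Γ .emp δ .emp)
  | eqSb_compLock {m n o : M} {μ : n ⟶ m} {ν : o ⟶ n} {Γ Δ δ} :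
      Der (.sb Γ Δ δ) →
      Der (.eqSb (Γ.lock (ν ≫ μ)) (Δ.lock (ν ≫ μ)) (.lock (ν ≫ μ) δ) (.lock ν (.lock μ δ)))
  | eqSb_idLock {m : M} {Γ Δ : Cx M m} {δ} :
      Der (.sb Γ Δ δ) → Der (.eqSb Γ Δ (.lock (𝟙 m) δ) δ)
  | eqSb_lockComp {m n : M} {μ : n ⟶ m} {Γ Δ Ξ δ ξ} :
      Der (.sb Γ Δ δ) → Der (.sb Δ Ξ ξ) →
      Der (.eqSb (Γ.lock μ) (Ξ.lock μ) (.lock μ (ξ.comp δ)) (.comp (.lock μ ξ) (.lock μ δ)))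
  | eqSb_lockId {m n : M} {μ : n ⟶ m} {Γ} :
      Der (.ctx Γ) → Der (.eqSb (Γ.lock μ) (Γ.lock μ) (.lock μ .id) .id)
  | eqSb_keyId {m n : M} {μ : n ⟶ m} {Γ} :
      Der (.ctx Γ) → Der (.eqSb (Γ.lock μ) (Γ.lock μ) (.key (𝟙 μ) Γ) .id)
  | eqSb_keyNat {m n : M} {μ ν : n ⟶ m} {α : ν ⟶ μ} {Γ Δ δ} :
      Der (.ctx Γ) → Der (.ctx Δ) → Der (.sb Γ Δ δ) →
      Der (.eqSb (Γ.lock μ) (Δ.lock ν)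
        (.comp (.key α Δ) (.lock μ δ)) (.comp (.lock ν δ) (.key α Γ)))
  | eqSb_keyComp {m n : M} {μ ν ρ : n ⟶ m} {α : ν ⟶ μ} {β : ρ ⟶ ν} {Γ} :
      Der (.ctx Γ) →
      Der (.eqSb (Γ.lock μ) (Γ.lock ρ) (.key (β ≫ α) Γ) (.comp (.key β Γ) (.key α Γ)))
  | eqSb_keyWhisk {m n o : M} {μ₀ μ₁ : n ⟶ m} {ν₀ ν₁ : o ⟶ n} {α : μ₁ ⟶ μ₀} {β : ν₁ ⟶ ν₀} {Γ} :
      Der (.ctx Γ) →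
      Der (.eqSb (Γ.lock (ν₀ ≫ μ₀)) (Γ.lock (ν₁ ≫ μ₁))
        (.key (Bicategory.whiskerRight β μ₁ ≫ Bicategory.whiskerLeft ν₀ α) Γ)
        (.comp (.lock ν₁ (.key α Γ)) (.key β (Γ.lock μ₀))))
  | eqSb_extBeta {m n : M} {μ : n ⟶ m} {Γ Δ δ A a} :
      Der (.sb Γ Δ δ) → Der (.ty (Δ.lock μ) .large A) →
      Der (.tm (Γ.lock μ) (A.sub (.lock μ δ)) a) → Der (.eqSb Γ Δ (.comp .wk (.ext δ a)) δ)
  | eqSb_extEta {m n : M} {μ : n ⟶ m} {Γ Δ δ A} :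
      Der (.ctx Δ) → Der (.ty (Δ.lock μ) .large A) → Der (.sb Γ (Δ.ext μ A) δ) →
      Der (.eqSb Γ (Δ.ext μ A) δ (.ext (.comp .wk δ) (.sub .var (.lock μ δ))))
  | eqSb_extIBeta {m : M} {Γ Δ : Cx M m} {δ r} :
      Der (.sb Γ Δ δ) → Der (.dim Γ r) → Der (.eqSb Γ Δ (.comp .wkI (.extI δ r)) δ)
  | eqSb_extIEta {m : M} {Γ Δ : Cx M m} {δ} :
      Der (.ctx Δ) → Der (.sb Γ Δ.extI δ) →
      Der (.eqSb Γ Δ.extI δ (.extI (.comp .wkI δ) (.sub .var δ)))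
  | eqSb_excILeft {m n : M} {μ : n ⟶ m} {Γ} :
      Der (.ctx Γ) →
      Der (.eqSb (Γ.extI.lock μ) (Γ.extI.lock μ) (.comp (.excIinv μ) (.excI μ)) .id)
  | eqSb_excIRight {m n : M} {μ : n ⟶ m} {Γ} :
      Der (.ctx Γ) →
      Der (.eqSb (Γ.lock μ).extI (Γ.lock μ).extI (.comp (.excI μ) (.excIinv μ)) .id)
  | eqSb_excFLeft {m n : M} {μ : n ⟶ m} {Γ φ} :
      Der (.ctx Γ) → Der (.face Γ φ) →
      Der (.eqSb ((Γ.res φ).lock μ) ((Γ.res φ).lock μ)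
        (.comp (.excFinv μ φ) (.excF μ φ)) .id)
  | eqSb_excFRight {m n : M} {μ : n ⟶ m} {Γ φ} :
      Der (.ctx Γ) → Der (.face Γ φ) →
      Der (.eqSb ((Γ.lock μ).res (.exc μ φ)) ((Γ.lock μ).res (.exc μ φ))
        (.comp (.excF μ φ) (.excFinv μ φ)) .id)
  | eqSb_resBeta {m : M} {Γ Δ : Cx M m} {δ φ} :
      Der (.sb Γ Δ δ) → Der (.face Δ φ) → Der (.eqFace Γ (φ.sub δ) .top) →
      Der (.eqSb Γ Δ (.comp (.wkF φ) (.res δ φ)) δ)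
  | eqSb_resEta {m : M} {Γ Δ : Cx M m} {δ φ} :
      Der (.ctx Δ) → Der (.face Δ φ) → Der (.sb Γ (Δ.res φ) δ) →
      Der (.eqSb Γ (Δ.res φ) δ (.res (.comp (.wkF φ) δ) φ))
  | eqSb_faceBin {m : M} {Γ Δ : Cx M m} {δ ξ φ ψ} :
      Der (.sb Γ Δ δ) → Der (.sb Γ Δ ξ) → Der (.face Γ φ) → Der (.face Γ ψ) →
      Der (.eqFace Γ (φ.join ψ) .top) →
      Der (.eqSb (Γ.res φ) Δ (δ.comp (.wkF φ)) (ξ.comp (.wkF φ))) →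
      Der (.eqSb (Γ.res ψ) Δ (δ.comp (.wkF ψ)) (ξ.comp (.wkF ψ))) →
      Der (.eqSb Γ Δ δ ξ)
  | eqSb_faceNull {m : M} {Γ Δ : Cx M m} {δ ξ} :
      Der (.sb Γ Δ δ) → Der (.sb Γ Δ ξ) → Der (.eqFace Γ .bot .top) → Der (.eqSb Γ Δ δ ξ)
  /- Interval terms -/
  | dim_var {m : M} {Γ : Cx M m} : Der (.ctx Γ) → Der (.dim Γ.extI .var)
  | dim_sub {m : M} {Γ Δ : Cx M m} {δ r} :
      Der (.sb Γ Δ δ) → Der (.dim Δ r) → Der (.dim Γ (r.sub δ))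
  | dim_zero {m : M} {Γ : Cx M m} : Der (.ctx Γ) → Der (.dim Γ .zero)
  | dim_one {m : M} {Γ : Cx M m} : Der (.ctx Γ) → Der (.dim Γ .one)
  | dim_inv {m : M} {Γ : Cx M m} {r} : Der (.dim Γ r) → Der (.dim Γ r.inv)
  | dim_join {m : M} {Γ : Cx M m} {r s} :
      Der (.dim Γ r) → Der (.dim Γ s) → Der (.dim Γ (r.join s))
  | dim_meet {m : M} {Γ : Cx M m} {r s} :
      Der (.dim Γ r) → Der (.dim Γ s) → Der (.dim Γ (r.meet s))
  | dim_exc {m n : M} {μ : n ⟶ m} {Γ r} :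
      Der (.ctx Γ) → Der (.dim Γ r) → Der (.dim (Γ.lock μ) (.exc μ r))
  /- Interval equality: equivalence relation and congruence -/
  | eqDim_refl {m : M} {Γ : Cx M m} {r} : Der (.dim Γ r) → Der (.eqDim Γ r r)
  | eqDim_symm {m : M} {Γ : Cx M m} {r s} : Der (.eqDim Γ r s) → Der (.eqDim Γ s r)
  | eqDim_trans {m : M} {Γ : Cx M m} {r s t} :
      Der (.eqDim Γ r s) → Der (.eqDim Γ s t) → Der (.eqDim Γ r t)
  | eqDim_sub {m : M} {Γ Δ : Cx M m} {δ δ' r r'} :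
      Der (.eqSb Γ Δ δ δ') → Der (.eqDim Δ r r') → Der (.eqDim Γ (r.sub δ) (r'.sub δ'))
  | eqDim_inv {m : M} {Γ : Cx M m} {r r'} :
      Der (.eqDim Γ r r') → Der (.eqDim Γ r.inv r'.inv)
  | eqDim_join {m : M} {Γ : Cx M m} {r r' s s'} :
      Der (.eqDim Γ r r') → Der (.eqDim Γ s s') → Der (.eqDim Γ (r.join s) (r'.join s'))
  | eqDim_meet {m : M} {Γ : Cx M m} {r r' s s'} :
      Der (.eqDim Γ r r') → Der (.eqDim Γ s s') → Der (.eqDim Γ (r.meet s) (r'.meet s'))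
  | eqDim_exc {m n : M} {μ : n ⟶ m} {Γ r r'} :
      Der (.ctx Γ) → Der (.eqDim Γ r r') → Der (.eqDim (Γ.lock μ) (.exc μ r) (.exc μ r'))
  /- Interval equality: De Morgan algebra -/
  | eqDim_joinComm {m : M} {Γ : Cx M m} {r s} :
      Der (.dim Γ r) → Der (.dim Γ s) → Der (.eqDim Γ (r.join s) (s.join r))
  | eqDim_meetComm {m : M} {Γ : Cx M m} {r s} :
      Der (.dim Γ r) → Der (.dim Γ s) → Der (.eqDim Γ (r.meet s) (s.meet r))
  | eqDim_joinAssoc {m : M} {Γ : Cx M m} {r s t} :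
      Der (.dim Γ r) → Der (.dim Γ s) → Der (.dim Γ t) →
      Der (.eqDim Γ ((r.join s).join t) (r.join (s.join t)))
  | eqDim_meetAssoc {m : M} {Γ : Cx M m} {r s t} :
      Der (.dim Γ r) → Der (.dim Γ s) → Der (.dim Γ t) →
      Der (.eqDim Γ ((r.meet s).meet t) (r.meet (s.meet t)))
  | eqDim_joinMeet {m : M} {Γ : Cx M m} {r s} :
      Der (.dim Γ r) → Der (.dim Γ s) → Der (.eqDim Γ (r.join (r.meet s)) r)
  | eqDim_meetJoin {m : M} {Γ : Cx M m} {r s} :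
      Der (.dim Γ r) → Der (.dim Γ s) → Der (.eqDim Γ (r.meet (r.join s)) r)
  | eqDim_distrib {m : M} {Γ : Cx M m} {r s t} :
      Der (.dim Γ r) → Der (.dim Γ s) → Der (.dim Γ t) →
      Der (.eqDim Γ (r.meet (s.join t)) ((r.meet s).join (r.meet t)))
  | eqDim_joinZero {m : M} {Γ : Cx M m} {r} : Der (.dim Γ r) → Der (.eqDim Γ (r.join .zero) r)
  | eqDim_meetOne {m : M} {Γ : Cx M m} {r} : Der (.dim Γ r) → Der (.eqDim Γ (r.meet .one) r)
  | eqDim_invInv {m : M} {Γ : Cx M m} {r} : Der (.dim Γ r) → Der (.eqDim Γ r.inv.inv r)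
  | eqDim_invJoin {m : M} {Γ : Cx M m} {r s} :
      Der (.dim Γ r) → Der (.dim Γ s) → Der (.eqDim Γ (r.join s).inv (r.inv.meet s.inv))
  /- Interval equality: exchange -/
  | eqDim_excZero {m n : M} {μ : n ⟶ m} {Γ} :
      Der (.ctx Γ) → Der (.eqDim (Γ.lock μ) (.exc μ .zero) .zero)
  | eqDim_excOne {m n : M} {μ : n ⟶ m} {Γ} :
      Der (.ctx Γ) → Der (.eqDim (Γ.lock μ) (.exc μ .one) .one)
  | eqDim_excInv {m n : M} {μ : n ⟶ m} {Γ r} :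
      Der (.ctx Γ) → Der (.dim Γ r) → Der (.eqDim (Γ.lock μ) (.exc μ r.inv) (.inv (.exc μ r)))
  | eqDim_excJoin {m n : M} {μ : n ⟶ m} {Γ r s} :
      Der (.ctx Γ) → Der (.dim Γ r) → Der (.dim Γ s) →
      Der (.eqDim (Γ.lock μ) (.exc μ (r.join s)) (.join (.exc μ r) (.exc μ s)))
  | eqDim_excMeet {m n : M} {μ : n ⟶ m} {Γ r s} :
      Der (.ctx Γ) → Der (.dim Γ r) → Der (.dim Γ s) →
      Der (.eqDim (Γ.lock μ) (.exc μ (r.meet s)) (.meet (.exc μ r) (.exc μ s)))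
  | eqDim_excComp {m n o : M} {μ : n ⟶ m} {ν : o ⟶ n} {Γ r} :
      Der (.ctx Γ) → Der (.dim Γ r) →
      Der (.eqDim ((Γ.lock μ).lock ν) (.exc (ν ≫ μ) r) (.exc ν (.exc μ r)))
  | eqDim_excId {m : M} {Γ : Cx M m} {r} :
      Der (.ctx Γ) → Der (.dim Γ r) → Der (.eqDim Γ (.exc (𝟙 m) r) r)
  | eqDim_excKey {m n : M} {μ ν : n ⟶ m} {α : ν ⟶ μ} {Γ r} :
      Der (.ctx Γ) → Der (.dim Γ r) →
      Der (.eqDim (Γ.lock μ) (.sub (.exc ν r) (.key α Γ)) (.exc μ r))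
  | eqDim_excSub {m n : M} {μ : n ⟶ m} {Γ Δ δ r} :
      Der (.ctx Δ) → Der (.sb Γ Δ δ) → Der (.dim Δ r) →
      Der (.eqDim (Γ.lock μ) (.sub (.exc μ r) (.lock μ δ)) (.exc μ (r.sub δ)))
  /- Interval equality: further laws -/
  | eqDim_extIBeta {m : M} {Γ Δ : Cx M m} {δ r} :
      Der (.sb Γ Δ δ) → Der (.dim Γ r) → Der (.eqDim Γ (.sub .var (.extI δ r)) r)
  | eqDim_resEq {m : M} {Γ : Cx M m} {r} :
      Der (.ctx Γ) → Der (.dim Γ r) →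
      Der (.eqDim (Γ.res (.eq0 r)) (r.sub (.wkF (.eq0 r))) .zero)
  | eqDim_faceBin {m : M} {Γ : Cx M m} {r s φ ψ} :
      Der (.dim Γ r) → Der (.dim Γ s) → Der (.face Γ φ) → Der (.face Γ ψ) →
      Der (.eqFace Γ (φ.join ψ) .top) →
      Der (.eqDim (Γ.res φ) (r.sub (.wkF φ)) (s.sub (.wkF φ))) →
      Der (.eqDim (Γ.res ψ) (r.sub (.wkF ψ)) (s.sub (.wkF ψ))) → Der (.eqDim Γ r s)
  | eqDim_faceNull {m : M} {Γ : Cx M m} {r s} :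
      Der (.dim Γ r) → Der (.dim Γ s) → Der (.eqFace Γ .bot .top) → Der (.eqDim Γ r s)
  | eqDim_subId {m : M} {Γ : Cx M m} {r} : Der (.dim Γ r) → Der (.eqDim Γ (r.sub .id) r)
  | eqDim_subComp {m : M} {Γ Δ Ξ : Cx M m} {δ ξ r} :
      Der (.sb Γ Δ δ) → Der (.sb Δ Ξ ξ) → Der (.dim Ξ r) →
      Der (.eqDim Γ (r.sub (ξ.comp δ)) ((r.sub ξ).sub δ))
  | eqDim_subZero {m : M} {Γ Δ : Cx M m} {δ} :
      Der (.sb Γ Δ δ) → Der (.eqDim Γ (.sub .zero δ) .zero)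
  | eqDim_subOne {m : M} {Γ Δ : Cx M m} {δ} :
      Der (.sb Γ Δ δ) → Der (.eqDim Γ (.sub .one δ) .one)
  | eqDim_subInv {m : M} {Γ Δ : Cx M m} {δ r} :
      Der (.sb Γ Δ δ) → Der (.dim Δ r) → Der (.eqDim Γ (r.inv.sub δ) (r.sub δ).inv)
  | eqDim_subJoin {m : M} {Γ Δ : Cx M m} {δ r s} :
      Der (.sb Γ Δ δ) → Der (.dim Δ r) → Der (.dim Δ s) →
      Der (.eqDim Γ ((r.join s).sub δ) ((r.sub δ).join (s.sub δ)))
  | eqDim_subMeet {m : M} {Γ Δ : Cx M m} {δ r s} :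
      Der (.sb Γ Δ δ) → Der (.dim Δ r) → Der (.dim Δ s) →
      Der (.eqDim Γ ((r.meet s).sub δ) ((r.sub δ).meet (s.sub δ)))
  | eqDim_extra {m : M} {Γ : Cx M m} {r s} :
      Der (.dim Γ r) → Der (.dim Γ s) → E.dim Γ r s → Der (.eqDim Γ r s)
  /- Faces -/
  | face_eq0 {m : M} {Γ : Cx M m} {r} : Der (.dim Γ r) → Der (.face Γ (.eq0 r))
  | face_bot {m : M} {Γ : Cx M m} : Der (.ctx Γ) → Der (.face Γ .bot)
  | face_top {m : M} {Γ : Cx M m} : Der (.ctx Γ) → Der (.face Γ .top)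
  | face_join {m : M} {Γ : Cx M m} {φ ψ} :
      Der (.face Γ φ) → Der (.face Γ ψ) → Der (.face Γ (φ.join ψ))
  | face_meet {m : M} {Γ : Cx M m} {φ ψ} :
      Der (.face Γ φ) → Der (.face Γ ψ) → Der (.face Γ (φ.meet ψ))
  | face_sub {m : M} {Γ Δ : Cx M m} {δ φ} :
      Der (.sb Γ Δ δ) → Der (.face Δ φ) → Der (.face Γ (φ.sub δ))
  | face_exc {m n : M} {μ : n ⟶ m} {Γ φ} :
      Der (.ctx Γ) → Der (.face Γ φ) → Der (.face (Γ.lock μ) (.exc μ φ))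
  /- Face equality: equivalence relation and congruence -/
  | eqFace_refl {m : M} {Γ : Cx M m} {φ} : Der (.face Γ φ) → Der (.eqFace Γ φ φ)
  | eqFace_symm {m : M} {Γ : Cx M m} {φ ψ} : Der (.eqFace Γ φ ψ) → Der (.eqFace Γ ψ φ)
  | eqFace_trans {m : M} {Γ : Cx M m} {φ ψ χ} :
      Der (.eqFace Γ φ ψ) → Der (.eqFace Γ ψ χ) → Der (.eqFace Γ φ χ)
  | eqFace_eq0 {m : M} {Γ : Cx M m} {r r'} :
      Der (.eqDim Γ r r') → Der (.eqFace Γ (.eq0 r) (.eq0 r'))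
  | eqFace_join {m : M} {Γ : Cx M m} {φ φ' ψ ψ'} :
      Der (.eqFace Γ φ φ') → Der (.eqFace Γ ψ ψ') → Der (.eqFace Γ (φ.join ψ) (φ'.join ψ'))
  | eqFace_meet {m : M} {Γ : Cx M m} {φ φ' ψ ψ'} :
      Der (.eqFace Γ φ φ') → Der (.eqFace Γ ψ ψ') → Der (.eqFace Γ (φ.meet ψ) (φ'.meet ψ'))
  | eqFace_sub {m : M} {Γ Δ : Cx M m} {δ δ' φ φ'} :
      Der (.eqSb Γ Δ δ δ') → Der (.eqFace Δ φ φ') → Der (.eqFace Γ (φ.sub δ) (φ'.sub δ'))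
  | eqFace_exc {m n : M} {μ : n ⟶ m} {Γ φ φ'} :
      Der (.ctx Γ) → Der (.eqFace Γ φ φ') → Der (.eqFace (Γ.lock μ) (.exc μ φ) (.exc μ φ'))
  /- Face equality: bounded distributive lattice -/
  | eqFace_joinComm {m : M} {Γ : Cx M m} {φ ψ} :
      Der (.face Γ φ) → Der (.face Γ ψ) → Der (.eqFace Γ (φ.join ψ) (ψ.join φ))
  | eqFace_meetComm {m : M} {Γ : Cx M m} {φ ψ} :
      Der (.face Γ φ) → Der (.face Γ ψ) → Der (.eqFace Γ (φ.meet ψ) (ψ.meet φ))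
  | eqFace_joinAssoc {m : M} {Γ : Cx M m} {φ ψ χ} :
      Der (.face Γ φ) → Der (.face Γ ψ) → Der (.face Γ χ) →
      Der (.eqFace Γ ((φ.join ψ).join χ) (φ.join (ψ.join χ)))
  | eqFace_meetAssoc {m : M} {Γ : Cx M m} {φ ψ χ} :
      Der (.face Γ φ) → Der (.face Γ ψ) → Der (.face Γ χ) →
      Der (.eqFace Γ ((φ.meet ψ).meet χ) (φ.meet (ψ.meet χ)))
  | eqFace_joinMeet {m : M} {Γ : Cx M m} {φ ψ} :
      Der (.face Γ φ) → Der (.face Γ ψ) → Der (.eqFace Γ (φ.join (φ.meet ψ)) φ)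
  | eqFace_meetJoin {m : M} {Γ : Cx M m} {φ ψ} :
      Der (.face Γ φ) → Der (.face Γ ψ) → Der (.eqFace Γ (φ.meet (φ.join ψ)) φ)
  | eqFace_distrib {m : M} {Γ : Cx M m} {φ ψ χ} :
      Der (.face Γ φ) → Der (.face Γ ψ) → Der (.face Γ χ) →
      Der (.eqFace Γ (φ.meet (ψ.join χ)) ((φ.meet ψ).join (φ.meet χ)))
  | eqFace_joinBot {m : M} {Γ : Cx M m} {φ} : Der (.face Γ φ) → Der (.eqFace Γ (φ.join .bot) φ)
  | eqFace_meetTop {m : M} {Γ : Cx M m} {φ} : Der (.face Γ φ) → Der (.eqFace Γ (φ.meet .top) φ)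
  /- Face equality: exchange -/
  | eqFace_excBot {m n : M} {μ : n ⟶ m} {Γ} :
      Der (.ctx Γ) → Der (.eqFace (Γ.lock μ) (.exc μ .bot) .bot)
  | eqFace_excTop {m n : M} {μ : n ⟶ m} {Γ} :
      Der (.ctx Γ) → Der (.eqFace (Γ.lock μ) (.exc μ .top) .top)
  | eqFace_excJoin {m n : M} {μ : n ⟶ m} {Γ φ ψ} :
      Der (.ctx Γ) → Der (.face Γ φ) → Der (.face Γ ψ) →
      Der (.eqFace (Γ.lock μ) (.exc μ (φ.join ψ)) (.join (.exc μ φ) (.exc μ ψ)))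
  | eqFace_excMeet {m n : M} {μ : n ⟶ m} {Γ φ ψ} :
      Der (.ctx Γ) → Der (.face Γ φ) → Der (.face Γ ψ) →
      Der (.eqFace (Γ.lock μ) (.exc μ (φ.meet ψ)) (.meet (.exc μ φ) (.exc μ ψ)))
  | eqFace_excEq {m n : M} {μ : n ⟶ m} {Γ r} :
      Der (.ctx Γ) → Der (.dim Γ r) →
      Der (.eqFace (Γ.lock μ) (.exc μ (.eq0 r)) (.eq0 (.exc μ r)))
  | eqFace_excComp {m n o : M} {μ : n ⟶ m} {ν : o ⟶ n} {Γ φ} :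
      Der (.ctx Γ) → Der (.face Γ φ) →
      Der (.eqFace ((Γ.lock μ).lock ν) (.exc (ν ≫ μ) φ) (.exc ν (.exc μ φ)))
  | eqFace_excId {m : M} {Γ : Cx M m} {φ} :
      Der (.ctx Γ) → Der (.face Γ φ) → Der (.eqFace Γ (.exc (𝟙 m) φ) φ)
  | eqFace_excKey {m n : M} {μ ν : n ⟶ m} {α : ν ⟶ μ} {Γ φ} :
      Der (.ctx Γ) → Der (.face Γ φ) →
      Der (.eqFace (Γ.lock μ) (.sub (.exc ν φ) (.key α Γ)) (.exc μ φ))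
  | eqFace_excSub {m n : M} {μ : n ⟶ m} {Γ Δ δ φ} :
      Der (.ctx Δ) → Der (.sb Γ Δ δ) → Der (.face Δ φ) →
      Der (.eqFace (Γ.lock μ) (.sub (.exc μ φ) (.lock μ δ)) (.exc μ (φ.sub δ)))
  /- Face equality: further laws -/
  | eqFace_nonContr {m : M} {Γ : Cx M m} {r} :
      Der (.dim Γ r) → Der (.eqFace Γ (.meet (.eq0 r) (.eq0 r.inv)) .bot)
  | eqFace_eqZero {m : M} {Γ : Cx M m} : Der (.ctx Γ) → Der (.eqFace Γ (.eq0 .zero) .top)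
  | eqFace_resTop {m : M} {Γ : Cx M m} {φ} :
      Der (.ctx Γ) → Der (.face Γ φ) → Der (.eqFace (Γ.res φ) (φ.sub (.wkF φ)) .top)
  | eqFace_faceBin {m : M} {Γ : Cx M m} {χ₀ χ₁ φ ψ} :
      Der (.face Γ χ₀) → Der (.face Γ χ₁) → Der (.face Γ φ) → Der (.face Γ ψ) →
      Der (.eqFace Γ (φ.join ψ) .top) →
      Der (.eqFace (Γ.res φ) (χ₀.sub (.wkF φ)) (χ₁.sub (.wkF φ))) →
      Der (.eqFace (Γ.res ψ) (χ₀.sub (.wkF ψ)) (χ₁.sub (.wkF ψ))) → Der (.eqFace Γ χ₀ χ₁)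
  | eqFace_faceNull {m : M} {Γ : Cx M m} {χ₀ χ₁} :
      Der (.face Γ χ₀) → Der (.face Γ χ₁) → Der (.eqFace Γ .bot .top) → Der (.eqFace Γ χ₀ χ₁)
  | eqFace_subId {m : M} {Γ : Cx M m} {φ} : Der (.face Γ φ) → Der (.eqFace Γ (φ.sub .id) φ)
  | eqFace_subComp {m : M} {Γ Δ Ξ : Cx M m} {δ ξ φ} :
      Der (.sb Γ Δ δ) → Der (.sb Δ Ξ ξ) → Der (.face Ξ φ) →
      Der (.eqFace Γ (φ.sub (ξ.comp δ)) ((φ.sub ξ).sub δ))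
  | eqFace_subEq0 {m : M} {Γ Δ : Cx M m} {δ r} :
      Der (.sb Γ Δ δ) → Der (.dim Δ r) → Der (.eqFace Γ (.sub (.eq0 r) δ) (.eq0 (r.sub δ)))
  | eqFace_subBot {m : M} {Γ Δ : Cx M m} {δ} :
      Der (.sb Γ Δ δ) → Der (.eqFace Γ (.sub .bot δ) .bot)
  | eqFace_subTop {m : M} {Γ Δ : Cx M m} {δ} :
      Der (.sb Γ Δ δ) → Der (.eqFace Γ (.sub .top δ) .top)
  | eqFace_subJoin {m : M} {Γ Δ : Cx M m} {δ φ ψ} :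
      Der (.sb Γ Δ δ) → Der (.face Δ φ) → Der (.face Δ ψ) →
      Der (.eqFace Γ ((φ.join ψ).sub δ) ((φ.sub δ).join (ψ.sub δ)))
  | eqFace_subMeet {m : M} {Γ Δ : Cx M m} {δ φ ψ} :
      Der (.sb Γ Δ δ) → Der (.face Δ φ) → Der (.face Δ ψ) →
      Der (.eqFace Γ ((φ.meet ψ).sub δ) ((φ.sub δ).meet (ψ.sub δ)))
  | eqFace_extra {m : M} {Γ : Cx M m} {φ ψ} :
      Der (.face Γ φ) → Der (.face Γ ψ) → E.face Γ φ ψ → Der (.eqFace Γ φ ψ)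
  /- Types -/
  | ty_lift {m : M} {Γ : Cx M m} {A} : Der (.ty Γ .small A) → Der (.ty Γ .large A)
  | ty_sub {m : M} {Γ Δ : Cx M m} {δ s A} :
      Der (.sb Γ Δ δ) → Der (.ty Δ s A) → Der (.ty Γ s (A.sub δ))
  | ty_pi {m n : M} {μ : n ⟶ m} {Γ s A B} :
      Der (.ty (Γ.lock μ) s A) → Der (.ty (Γ.ext μ A) s B) → Der (.ty Γ s (.pi μ A B))
  | ty_sigma {m : M} {Γ : Cx M m} {s A B} :
      Der (.ty Γ s A) → Der (.ty (Γ.ext (𝟙 m) A) s B) → Der (.ty Γ s (.sigma A B))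
  | ty_bool {m : M} {Γ : Cx M m} : Der (.ctx Γ) → Der (.ty Γ .small .bool)
  | ty_path {m : M} {Γ : Cx M m} {s A a b} :
      Der (.ctx Γ) → Der (.ty Γ.extI s A) → Der (.tm Γ (A.sub (.instI .zero)) a) →
      Der (.tm Γ (A.sub (.instI .one)) b) → Der (.ty Γ s (.path A a b))
  | ty_mod {m n : M} {μ : n ⟶ m} {Γ s A} :
      Der (.ctx Γ) → Der (.ty (Γ.lock μ) s A) → Der (.ty Γ s (.mod μ A))
  | ty_sys {m : M} {Γ : Cx M m} {s φ ψ A B} :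
      Der (.face Γ φ) → Der (.face Γ ψ) → Der (.eqFace Γ (φ.join ψ) .top) →
      Der (.ty (Γ.res φ) s A) → Der (.ty (Γ.res ψ) s B) →
      Der (.eqTy (Γ.res (φ.meet ψ)) s
        (A.sub (.res (.wkF (φ.meet ψ)) φ)) (B.sub (.res (.wkF (φ.meet ψ)) ψ))) →
      Der (.ty Γ s (.sys φ A ψ B))
  | ty_U {m : M} {Γ : Cx M m} : Der (.ctx Γ) → Der (.ty Γ .large .U)
  | ty_el {m : M} {Γ : Cx M m} {t} : Der (.tm Γ .U t) → Der (.ty Γ .small (.el t))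
  | ty_glue {m : M} {Γ : Cx M m} {s φ T f A} :
      Der (.ty Γ s A) → Der (.face Γ φ) → Der (.ty (Γ.res φ) s T) →
      Der (.tm (Γ.res φ) (.equiv T (A.sub (.wkF φ))) f) → Der (.ty Γ s (.glue φ T f A))
  /- Type equality: equivalence relation and congruence -/
  | eqTy_refl {m : M} {Γ : Cx M m} {s A} : Der (.ty Γ s A) → Der (.eqTy Γ s A A)
  | eqTy_symm {m : M} {Γ : Cx M m} {s A B} : Der (.eqTy Γ s A B) → Der (.eqTy Γ s B A)
  | eqTy_trans {m : M} {Γ : Cx M m} {s A B C} :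
      Der (.eqTy Γ s A B) → Der (.eqTy Γ s B C) → Der (.eqTy Γ s A C)
  | eqTy_lift {m : M} {Γ : Cx M m} {A B} :
      Der (.eqTy Γ .small A B) → Der (.eqTy Γ .large A B)
  | eqTy_sub {m : M} {Γ Δ : Cx M m} {δ δ' s A A'} :
      Der (.eqSb Γ Δ δ δ') → Der (.eqTy Δ s A A') → Der (.eqTy Γ s (A.sub δ) (A'.sub δ'))
  | eqTy_pi {m n : M} {μ : n ⟶ m} {Γ s A A' B B'} :
      Der (.eqTy (Γ.lock μ) s A A') → Der (.eqTy (Γ.ext μ A) s B B') →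
      Der (.eqTy Γ s (.pi μ A B) (.pi μ A' B'))
  | eqTy_sigma {m : M} {Γ : Cx M m} {s A A' B B'} :
      Der (.eqTy Γ s A A') → Der (.eqTy (Γ.ext (𝟙 m) A) s B B') →
      Der (.eqTy Γ s (.sigma A B) (.sigma A' B'))
  | eqTy_path {m : M} {Γ : Cx M m} {s A A' a a' b b'} :
      Der (.ctx Γ) → Der (.eqTy Γ.extI s A A') → Der (.eqTm Γ (A.sub (.instI .zero)) a a') →
      Der (.eqTm Γ (A.sub (.instI .one)) b b') → Der (.eqTy Γ s (.path A a b) (.path A' a' b'))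
  | eqTy_mod {m n : M} {μ : n ⟶ m} {Γ s A A'} :
      Der (.ctx Γ) → Der (.eqTy (Γ.lock μ) s A A') → Der (.eqTy Γ s (.mod μ A) (.mod μ A'))
  | eqTy_sys {m : M} {Γ : Cx M m} {s φ φ' ψ ψ' A A' B B'} :
      Der (.eqFace Γ φ φ') → Der (.eqFace Γ ψ ψ') → Der (.eqFace Γ (φ.join ψ) .top) →
      Der (.eqTy (Γ.res φ) s A A') → Der (.eqTy (Γ.res ψ) s B B') →
      Der (.eqTy (Γ.res (φ.meet ψ)) s
        (A.sub (.res (.wkF (φ.meet ψ)) φ)) (B.sub (.res (.wkF (φ.meet ψ)) ψ))) →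
      Der (.eqTy Γ s (.sys φ A ψ B) (.sys φ' A' ψ' B'))
  | eqTy_el {m : M} {Γ : Cx M m} {t t'} :
      Der (.eqTm Γ .U t t') → Der (.eqTy Γ .small (.el t) (.el t'))
  | eqTy_glue {m : M} {Γ : Cx M m} {s φ φ' T T' f f' A A'} :
      Der (.eqTy Γ s A A') → Der (.eqFace Γ φ φ') → Der (.eqTy (Γ.res φ) s T T') →
      Der (.eqTm (Γ.res φ) (.equiv T (A.sub (.wkF φ))) f f') →
      Der (.eqTy Γ s (.glue φ T f A) (.glue φ' T' f' A'))
  /- Type equality: substitution -/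
  | eqTy_subId {m : M} {Γ : Cx M m} {s A} : Der (.ty Γ s A) → Der (.eqTy Γ s (A.sub .id) A)
  | eqTy_subComp {m : M} {Γ Δ Ξ : Cx M m} {δ ξ s A} :
      Der (.sb Γ Δ δ) → Der (.sb Δ Ξ ξ) → Der (.ty Ξ s A) →
      Der (.eqTy Γ s (A.sub (ξ.comp δ)) ((A.sub ξ).sub δ))
  | eqTy_subPi {m n : M} {μ : n ⟶ m} {Γ Δ δ s A B} :
      Der (.sb Γ Δ δ) → Der (.ty (Δ.lock μ) s A) → Der (.ty (Δ.ext μ A) s B) →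
      Der (.eqTy Γ s (.sub (.pi μ A B) δ) (.pi μ (A.sub (.lock μ δ)) (B.sub (.up n δ))))
  | eqTy_subSigma {m : M} {Γ Δ : Cx M m} {δ s A B} :
      Der (.sb Γ Δ δ) → Der (.ty Δ s A) → Der (.ty (Δ.ext (𝟙 m) A) s B) →
      Der (.eqTy Γ s (.sub (.sigma A B) δ) (.sigma (A.sub δ) (B.sub (.up m δ))))
  | eqTy_subBool {m : M} {Γ Δ : Cx M m} {δ} :
      Der (.sb Γ Δ δ) → Der (.eqTy Γ .small (.sub .bool δ) .bool)
  | eqTy_subPath {m : M} {Γ Δ : Cx M m} {δ s A a b} :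
      Der (.sb Γ Δ δ) → Der (.ty Δ.extI s A) → Der (.tm Δ (A.sub (.instI .zero)) a) →
      Der (.tm Δ (A.sub (.instI .one)) b) →
      Der (.eqTy Γ s (.sub (.path A a b) δ) (.path (A.sub (.upI δ)) (a.sub δ) (b.sub δ)))
  | eqTy_subMod {m n : M} {μ : n ⟶ m} {Γ Δ δ s A} :
      Der (.sb Γ Δ δ) → Der (.ty (Δ.lock μ) s A) →
      Der (.eqTy Γ s (.sub (.mod μ A) δ) (.mod μ (A.sub (.lock μ δ))))
  | eqTy_subSys {m : M} {Γ Δ : Cx M m} {δ s φ ψ A B} :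
      Der (.sb Γ Δ δ) → Der (.ty (Δ.res φ) s A) → Der (.ty (Δ.res ψ) s B) →
      Der (.ty Δ s (.sys φ A ψ B)) →
      Der (.eqTy Γ s (.sub (.sys φ A ψ B) δ)
        (.sys (φ.sub δ) (A.sub (.upF δ φ)) (ψ.sub δ) (B.sub (.upF δ ψ))))
  | eqTy_subU {m : M} {Γ Δ : Cx M m} {δ} :
      Der (.sb Γ Δ δ) → Der (.eqTy Γ .large (.sub .U δ) .U)
  | eqTy_subEl {m : M} {Γ Δ : Cx M m} {δ t} :
      Der (.sb Γ Δ δ) → Der (.tm Δ .U t) → Der (.eqTy Γ .small (.sub (.el t) δ) (.el (t.sub δ)))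
  | eqTy_subGlue {m : M} {Γ Δ : Cx M m} {δ s φ T f A} :
      Der (.sb Γ Δ δ) → Der (.ty Δ s A) → Der (.face Δ φ) → Der (.ty (Δ.res φ) s T) →
      Der (.tm (Δ.res φ) (.equiv T (A.sub (.wkF φ))) f) →
      Der (.eqTy Γ s (.sub (.glue φ T f A) δ)
        (.glue (φ.sub δ) (T.sub (.upF δ φ)) (f.sub (.upF δ φ)) (A.sub δ)))
  /- Type equality: further laws -/
  | eqTy_elCode {m : M} {Γ : Cx M m} {A} :
      Der (.ty Γ .small A) → Der (.eqTy Γ .small (.el (.code A)) A)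
  | eqTy_sysLeft {m : M} {Γ : Cx M m} {s φ ψ A B} :
      Der (.ty (Γ.res φ) s A) → Der (.ty (Γ.res ψ) s B) → Der (.ty Γ s (.sys φ A ψ B)) →
      Der (.eqTy (Γ.res φ) s (.sub (.sys φ A ψ B) (.wkF φ)) A)
  | eqTy_sysRight {m : M} {Γ : Cx M m} {s φ ψ A B} :
      Der (.ty (Γ.res φ) s A) → Der (.ty (Γ.res ψ) s B) → Der (.ty Γ s (.sys φ A ψ B)) →
      Der (.eqTy (Γ.res ψ) s (.sub (.sys φ A ψ B) (.wkF ψ)) B)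
  | eqTy_faceBin {m : M} {Γ : Cx M m} {s A B φ ψ} :
      Der (.ty Γ s A) → Der (.ty Γ s B) → Der (.face Γ φ) → Der (.face Γ ψ) →
      Der (.eqFace Γ (φ.join ψ) .top) →
      Der (.eqTy (Γ.res φ) s (A.sub (.wkF φ)) (B.sub (.wkF φ))) →
      Der (.eqTy (Γ.res ψ) s (A.sub (.wkF ψ)) (B.sub (.wkF ψ))) → Der (.eqTy Γ s A B)
  | eqTy_faceNull {m : M} {Γ : Cx M m} {s A B} :
      Der (.ty Γ s A) → Der (.ty Γ s B) → Der (.eqFace Γ .bot .top) → Der (.eqTy Γ s A B)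
  | eqTy_glueTop {m : M} {Γ : Cx M m} {s φ T f A} :
      Der (.ty Γ s A) → Der (.face Γ φ) → Der (.ty (Γ.res φ) s T) →
      Der (.tm (Γ.res φ) (.equiv T (A.sub (.wkF φ))) f) →
      Der (.eqTy (Γ.res φ) s (.sub (.glue φ T f A) (.wkF φ)) T)
  | eqTy_extra {m : M} {Γ : Cx M m} {s A B} :
      Der (.ty Γ s A) → Der (.ty Γ s B) → E.ty Γ s A B → Der (.eqTy Γ s A B)
  /- Terms -/
  | tm_conv {m : M} {Γ : Cx M m} {A B a} :
      Der (.eqTy Γ .large A B) → Der (.tm Γ A a) → Der (.tm Γ B a)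
  | tm_sub {m : M} {Γ Δ : Cx M m} {δ A a} :
      Der (.sb Γ Δ δ) → Der (.tm Δ A a) → Der (.tm Γ (A.sub δ) (a.sub δ))
  | tm_var {m n : M} {μ : n ⟶ m} {Γ A} :
      Der (.ctx Γ) → Der (.ty (Γ.lock μ) .large A) →
      Der (.tm ((Γ.ext μ A).lock μ) (A.sub (.lock μ .wk)) .var)
  | tm_lam {m n : M} {μ : n ⟶ m} {Γ A B b} :
      Der (.ty (Γ.lock μ) .large A) → Der (.ty (Γ.ext μ A) .large B) →
      Der (.tm (Γ.ext μ A) B b) → Der (.tm Γ (.pi μ A B) (.lam b))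
  | tm_app {m n : M} {μ : n ⟶ m} {Γ A B f a} :
      Der (.ty (Γ.lock μ) .large A) → Der (.ty (Γ.ext μ A) .large B) →
      Der (.tm Γ (.pi μ A B) f) → Der (.tm (Γ.lock μ) A a) →
      Der (.tm Γ (B.sub (.inst a)) (.app f a))
  | tm_pair {m : M} {Γ : Cx M m} {A B a b} :
      Der (.ty Γ .large A) → Der (.ty (Γ.ext (𝟙 m) A) .large B) →
      Der (.tm Γ A a) → Der (.tm Γ (B.sub (.inst a)) b) → Der (.tm Γ (.sigma A B) (.pair a b))
  | tm_fst {m : M} {Γ : Cx M m} {A B p} :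
      Der (.ty Γ .large A) → Der (.ty (Γ.ext (𝟙 m) A) .large B) →
      Der (.tm Γ (.sigma A B) p) → Der (.tm Γ A (.fst p))
  | tm_snd {m : M} {Γ : Cx M m} {A B p} :
      Der (.ty Γ .large A) → Der (.ty (Γ.ext (𝟙 m) A) .large B) →
      Der (.tm Γ (.sigma A B) p) → Der (.tm Γ (B.sub (.inst (.fst p))) (.snd p))
  | tm_tt {m : M} {Γ : Cx M m} : Der (.ctx Γ) → Der (.tm Γ .bool .tt)
  | tm_ff {m : M} {Γ : Cx M m} : Der (.ctx Γ) → Der (.tm Γ .bool .ff)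
  | tm_boolElim {m : M} {Γ : Cx M m} {B t f b} :
      Der (.ty (Γ.ext (𝟙 m) .bool) .large B) →
      Der (.tm Γ (B.sub (.inst (.tt (m := m)))) t) →
      Der (.tm Γ (B.sub (.inst (.ff (m := m)))) f) →
      Der (.tm Γ .bool b) → Der (.tm Γ (B.sub (.inst b)) (.boolElim B t f b))
  | tm_plam {m : M} {Γ : Cx M m} {A a} :
      Der (.ctx Γ) → Der (.ty Γ.extI .large A) → Der (.tm Γ.extI A a) →
      Der (.tm Γ (.path A (a.sub (.instI .zero)) (a.sub (.instI .one))) (.plam a))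
  | tm_papp {m : M} {Γ : Cx M m} {A a b p r} :
      Der (.ty Γ.extI .large A) → Der (.tm Γ (A.sub (.instI .zero)) a) →
      Der (.tm Γ (A.sub (.instI .one)) b) → Der (.tm Γ (.path A a b) p) → Der (.dim Γ r) →
      Der (.tm Γ (A.sub (.instI r)) (.papp p r))
  | tm_mod {m n : M} {μ : n ⟶ m} {Γ A a} :
      Der (.ctx Γ) → Der (.ty (Γ.lock μ) .large A) → Der (.tm (Γ.lock μ) A a) →
      Der (.tm Γ (.mod μ A) (.mod μ a))
  | tm_letmod {m n o : M} {μ : n ⟶ m} {ν : o ⟶ n} {Γ A B a b} :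
      Der (.ctx Γ) → Der (.ty ((Γ.lock μ).lock ν) .large A) →
      Der (.tm (Γ.lock μ) (.mod ν A) a) → Der (.ty (Γ.ext μ (.mod ν A)) .large B) →
      Der (.tm (Γ.ext (ν ≫ μ) A) (B.sub (.ext .wk (Tm.mod ν .var))) b) →
      Der (.tm Γ (B.sub (.inst a)) (.letmod μ ν B a b))
  | tm_sys {m : M} {Γ : Cx M m} {A φ ψ a b} :
      Der (.ty Γ .large A) → Der (.face Γ φ) → Der (.face Γ ψ) →
      Der (.eqFace Γ (φ.join ψ) .top) →
      Der (.tm (Γ.res φ) (A.sub (.wkF φ)) a) → Der (.tm (Γ.res ψ) (A.sub (.wkF ψ)) b) →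
      Der (.eqTm (Γ.res (φ.meet ψ)) (A.sub (.wkF (φ.meet ψ)))
        (a.sub (.res (.wkF (φ.meet ψ)) φ)) (b.sub (.res (.wkF (φ.meet ψ)) ψ))) →
      Der (.tm Γ A (.sys φ a ψ b))
  | tm_sysNull {m : M} {Γ : Cx M m} {A} :
      Der (.ty Γ .large A) → Der (.eqFace Γ .bot .top) → Der (.tm Γ A .sysNull)
  | tm_comp {m : M} {Γ : Cx M m} {A φ u u₀} :
      Der (.ty Γ.extI .large A) → Der (.face Γ φ) →
      Der (.tm (Γ.res φ).extI (A.sub (.upI (.wkF φ))) u) →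
      Der (.tm Γ (A.sub (.instI .zero)) u₀) →
      Der (.eqTm (Γ.res φ) (A.sub (.extI (.wkF φ) .zero))
        (u.sub (.instI .zero)) (u₀.sub (.wkF φ))) →
      Der (.tm Γ (A.sub (.instI .one)) (.comp A φ u u₀))
  | tm_code {m : M} {Γ : Cx M m} {A} : Der (.ty Γ .small A) → Der (.tm Γ .U (.code A))
  | tm_glue {m : M} {Γ : Cx M m} {φ T f A t a} :
      Der (.ty Γ .large A) → Der (.face Γ φ) → Der (.ty (Γ.res φ) .large T) →
      Der (.tm (Γ.res φ) (.equiv T (A.sub (.wkF φ))) f) →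
      Der (.tm (Γ.res φ) T t) → Der (.tm Γ A a) →
      Der (.eqTm (Γ.res φ) (A.sub (.wkF φ)) (.app (.fst f) t) (a.sub (.wkF φ))) →
      Der (.tm Γ (.glue φ T f A) (.glue φ t a))
  | tm_unglue {m : M} {Γ : Cx M m} {φ T f A b} :
      Der (.ty Γ .large A) → Der (.face Γ φ) → Der (.ty (Γ.res φ) .large T) →
      Der (.tm (Γ.res φ) (.equiv T (A.sub (.wkF φ))) f) →
      Der (.tm Γ (.glue φ T f A) b) → Der (.tm Γ A (.unglue φ f b))
  /- Term equality: equivalence relation, conversion and congruence -/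
  | eqTm_refl {m : M} {Γ : Cx M m} {A a} : Der (.tm Γ A a) → Der (.eqTm Γ A a a)
  | eqTm_symm {m : M} {Γ : Cx M m} {A a b} : Der (.eqTm Γ A a b) → Der (.eqTm Γ A b a)
  | eqTm_trans {m : M} {Γ : Cx M m} {A a b c} :
      Der (.eqTm Γ A a b) → Der (.eqTm Γ A b c) → Der (.eqTm Γ A a c)
  | eqTm_conv {m : M} {Γ : Cx M m} {A B a b} :
      Der (.eqTy Γ .large A B) → Der (.eqTm Γ A a b) → Der (.eqTm Γ B a b)
  | eqTm_sub {m : M} {Γ Δ : Cx M m} {δ δ' A a a'} :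
      Der (.eqSb Γ Δ δ δ') → Der (.eqTm Δ A a a') →
      Der (.eqTm Γ (A.sub δ) (a.sub δ) (a'.sub δ'))
  | eqTm_lam {m n : M} {μ : n ⟶ m} {Γ A B b b'} :
      Der (.ty (Γ.lock μ) .large A) → Der (.ty (Γ.ext μ A) .large B) →
      Der (.eqTm (Γ.ext μ A) B b b') → Der (.eqTm Γ (.pi μ A B) (.lam b) (.lam b'))
  | eqTm_app {m n : M} {μ : n ⟶ m} {Γ A B f f' a a'} :
      Der (.ty (Γ.lock μ) .large A) → Der (.ty (Γ.ext μ A) .large B) →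
      Der (.eqTm Γ (.pi μ A B) f f') → Der (.eqTm (Γ.lock μ) A a a') →
      Der (.eqTm Γ (B.sub (.inst a)) (.app f a) (.app f' a'))
  | eqTm_pair {m : M} {Γ : Cx M m} {A B a a' b b'} :
      Der (.ty Γ .large A) → Der (.ty (Γ.ext (𝟙 m) A) .large B) →
      Der (.eqTm Γ A a a') → Der (.eqTm Γ (B.sub (.inst a)) b b') →
      Der (.eqTm Γ (.sigma A B) (.pair a b) (.pair a' b'))
  | eqTm_fst {m : M} {Γ : Cx M m} {A B p p'} :
      Der (.ty Γ .large A) → Der (.ty (Γ.ext (𝟙 m) A) .large B) →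
      Der (.eqTm Γ (.sigma A B) p p') → Der (.eqTm Γ A (.fst p) (.fst p'))
  | eqTm_snd {m : M} {Γ : Cx M m} {A B p p'} :
      Der (.ty Γ .large A) → Der (.ty (Γ.ext (𝟙 m) A) .large B) →
      Der (.eqTm Γ (.sigma A B) p p') →
      Der (.eqTm Γ (B.sub (.inst (.fst p))) (.snd p) (.snd p'))
  | eqTm_boolElim {m : M} {Γ : Cx M m} {B B' t t' f f' b b'} :
      Der (.eqTy (Γ.ext (𝟙 m) .bool) .large B B') →
      Der (.eqTm Γ (B.sub (.inst (.tt (m := m)))) t t') →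
      Der (.eqTm Γ (B.sub (.inst (.ff (m := m)))) f f') → Der (.eqTm Γ .bool b b') →
      Der (.eqTm Γ (B.sub (.inst b)) (.boolElim B t f b) (.boolElim B' t' f' b'))
  | eqTm_plam {m : M} {Γ : Cx M m} {A a a'} :
      Der (.ctx Γ) → Der (.ty Γ.extI .large A) → Der (.eqTm Γ.extI A a a') →
      Der (.eqTm Γ (.path A (a.sub (.instI .zero)) (a.sub (.instI .one))) (.plam a) (.plam a'))
  | eqTm_papp {m : M} {Γ : Cx M m} {A a b p p' r r'} :
      Der (.ty Γ.extI .large A) → Der (.tm Γ (A.sub (.instI .zero)) a) →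
      Der (.tm Γ (A.sub (.instI .one)) b) → Der (.eqTm Γ (.path A a b) p p') →
      Der (.eqDim Γ r r') → Der (.eqTm Γ (A.sub (.instI r)) (.papp p r) (.papp p' r'))
  | eqTm_mod {m n : M} {μ : n ⟶ m} {Γ A a a'} :
      Der (.ctx Γ) → Der (.ty (Γ.lock μ) .large A) → Der (.eqTm (Γ.lock μ) A a a') →
      Der (.eqTm Γ (.mod μ A) (.mod μ a) (.mod μ a'))
  | eqTm_letmod {m n o : M} {μ : n ⟶ m} {ν : o ⟶ n} {Γ A B B' a a' b b'} :
      Der (.ctx Γ) → Der (.ty ((Γ.lock μ).lock ν) .large A) →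
      Der (.eqTm (Γ.lock μ) (.mod ν A) a a') → Der (.eqTy (Γ.ext μ (.mod ν A)) .large B B') →
      Der (.eqTm (Γ.ext (ν ≫ μ) A) (B.sub (.ext .wk (Tm.mod ν .var))) b b') →
      Der (.eqTm Γ (B.sub (.inst a)) (.letmod μ ν B a b) (.letmod μ ν B' a' b'))
  | eqTm_sys {m : M} {Γ : Cx M m} {A φ φ' ψ ψ' a a' b b'} :
      Der (.ty Γ .large A) → Der (.eqFace Γ φ φ') → Der (.eqFace Γ ψ ψ') →
      Der (.eqFace Γ (φ.join ψ) .top) →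
      Der (.eqTm (Γ.res φ) (A.sub (.wkF φ)) a a') →
      Der (.eqTm (Γ.res ψ) (A.sub (.wkF ψ)) b b') →
      Der (.eqTm (Γ.res (φ.meet ψ)) (A.sub (.wkF (φ.meet ψ)))
        (a.sub (.res (.wkF (φ.meet ψ)) φ)) (b.sub (.res (.wkF (φ.meet ψ)) ψ))) →
      Der (.eqTm Γ A (.sys φ a ψ b) (.sys φ' a' ψ' b'))
  | eqTm_comp {m : M} {Γ : Cx M m} {A A' φ φ' u u' u₀ u₀'} :
      Der (.eqTy Γ.extI .large A A') → Der (.eqFace Γ φ φ') →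
      Der (.eqTm (Γ.res φ).extI (A.sub (.upI (.wkF φ))) u u') →
      Der (.eqTm Γ (A.sub (.instI .zero)) u₀ u₀') →
      Der (.eqTm (Γ.res φ) (A.sub (.extI (.wkF φ) .zero))
        (u.sub (.instI .zero)) (u₀.sub (.wkF φ))) →
      Der (.eqTm Γ (A.sub (.instI .one)) (.comp A φ u u₀) (.comp A' φ' u' u₀'))
  | eqTm_code {m : M} {Γ : Cx M m} {A A'} :
      Der (.eqTy Γ .small A A') → Der (.eqTm Γ .U (.code A) (.code A'))
  | eqTm_glue {m : M} {Γ : Cx M m} {φ φ' T f A t t' a a'} :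
      Der (.ty Γ .large A) → Der (.eqFace Γ φ φ') → Der (.ty (Γ.res φ) .large T) →
      Der (.tm (Γ.res φ) (.equiv T (A.sub (.wkF φ))) f) →
      Der (.eqTm (Γ.res φ) T t t') → Der (.eqTm Γ A a a') →
      Der (.eqTm (Γ.res φ) (A.sub (.wkF φ)) (.app (.fst f) t) (a.sub (.wkF φ))) →
      Der (.eqTm Γ (.glue φ T f A) (.glue φ t a) (.glue φ' t' a'))
  | eqTm_unglue {m : M} {Γ : Cx M m} {φ φ' T f f' A b b'} :
      Der (.ty Γ .large A) → Der (.eqFace Γ φ φ') → Der (.ty (Γ.res φ) .large T) →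
      Der (.eqTm (Γ.res φ) (.equiv T (A.sub (.wkF φ))) f f') →
      Der (.eqTm Γ (.glue φ T f A) b b') →
      Der (.eqTm Γ A (.unglue φ f b) (.unglue φ' f' b'))
  /- Term equality: substitution -/
  | eqTm_subId {m : M} {Γ : Cx M m} {A a} : Der (.tm Γ A a) → Der (.eqTm Γ A (a.sub .id) a)
  | eqTm_subComp {m : M} {Γ Δ Ξ : Cx M m} {δ ξ A a} :
      Der (.sb Γ Δ δ) → Der (.sb Δ Ξ ξ) → Der (.tm Ξ A a) →
      Der (.eqTm Γ (A.sub (ξ.comp δ)) (a.sub (ξ.comp δ)) ((a.sub ξ).sub δ))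
  | eqTm_subLam {m n : M} {μ : n ⟶ m} {Γ Δ δ A B b} :
      Der (.sb Γ Δ δ) → Der (.ty (Δ.lock μ) .large A) → Der (.ty (Δ.ext μ A) .large B) →
      Der (.tm (Δ.ext μ A) B b) →
      Der (.eqTm Γ (.sub (.pi μ A B) δ) (.sub (.lam b) δ) (.lam (b.sub (.up n δ))))
  | eqTm_subApp {m n : M} {μ : n ⟶ m} {Γ Δ δ A B f a} :
      Der (.sb Γ Δ δ) → Der (.ty (Δ.lock μ) .large A) → Der (.ty (Δ.ext μ A) .large B) →
      Der (.tm Δ (.pi μ A B) f) → Der (.tm (Δ.lock μ) A a) →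
      Der (.eqTm Γ ((B.sub (.inst a)).sub δ) (.sub (.app f a) δ)
        (.app (f.sub δ) (a.sub (.lock μ δ))))
  | eqTm_subPair {m : M} {Γ Δ : Cx M m} {δ A B a b} :
      Der (.sb Γ Δ δ) → Der (.ty Δ .large A) → Der (.ty (Δ.ext (𝟙 m) A) .large B) →
      Der (.tm Δ A a) → Der (.tm Δ (B.sub (.inst a)) b) →
      Der (.eqTm Γ (.sub (.sigma A B) δ) (.sub (.pair a b) δ) (.pair (a.sub δ) (b.sub δ)))
  | eqTm_subFst {m : M} {Γ Δ : Cx M m} {δ A B p} :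
      Der (.sb Γ Δ δ) → Der (.ty Δ .large A) → Der (.ty (Δ.ext (𝟙 m) A) .large B) →
      Der (.tm Δ (.sigma A B) p) →
      Der (.eqTm Γ (A.sub δ) (.sub (.fst p) δ) (.fst (p.sub δ)))
  | eqTm_subSnd {m : M} {Γ Δ : Cx M m} {δ A B p} :
      Der (.sb Γ Δ δ) → Der (.ty Δ .large A) → Der (.ty (Δ.ext (𝟙 m) A) .large B) →
      Der (.tm Δ (.sigma A B) p) →
      Der (.eqTm Γ ((B.sub (.inst (.fst p))).sub δ) (.sub (.snd p) δ) (.snd (p.sub δ)))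
  | eqTm_subTt {m : M} {Γ Δ : Cx M m} {δ} :
      Der (.sb Γ Δ δ) → Der (.eqTm Γ .bool (.sub .tt δ) .tt)
  | eqTm_subFf {m : M} {Γ Δ : Cx M m} {δ} :
      Der (.sb Γ Δ δ) → Der (.eqTm Γ .bool (.sub .ff δ) .ff)
  | eqTm_subBoolElim {m : M} {Γ Δ : Cx M m} {δ B t f b} :
      Der (.sb Γ Δ δ) → Der (.ty (Δ.ext (𝟙 m) .bool) .large B) →
      Der (.tm Δ (B.sub (.inst (.tt (m := m)))) t) →
      Der (.tm Δ (B.sub (.inst (.ff (m := m)))) f) → Der (.tm Δ .bool b) →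
      Der (.eqTm Γ ((B.sub (.inst b)).sub δ) (.sub (.boolElim B t f b) δ)
        (.boolElim (B.sub (.up m δ)) (t.sub δ) (f.sub δ) (b.sub δ)))
  | eqTm_subPlam {m : M} {Γ Δ : Cx M m} {δ A a} :
      Der (.ctx Δ) → Der (.sb Γ Δ δ) → Der (.ty Δ.extI .large A) → Der (.tm Δ.extI A a) →
      Der (.eqTm Γ (.sub (.path A (a.sub (.instI .zero)) (a.sub (.instI .one))) δ)
        (.sub (.plam a) δ) (.plam (a.sub (.upI δ))))
  | eqTm_subPapp {m : M} {Γ Δ : Cx M m} {δ A a b p r} :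
      Der (.sb Γ Δ δ) → Der (.ty Δ.extI .large A) → Der (.tm Δ (A.sub (.instI .zero)) a) →
      Der (.tm Δ (A.sub (.instI .one)) b) → Der (.tm Δ (.path A a b) p) → Der (.dim Δ r) →
      Der (.eqTm Γ ((A.sub (.instI r)).sub δ) (.sub (.papp p r) δ) (.papp (p.sub δ) (r.sub δ)))
  | eqTm_subMod {m n : M} {μ : n ⟶ m} {Γ Δ δ A a} :
      Der (.ctx Δ) → Der (.sb Γ Δ δ) → Der (.ty (Δ.lock μ) .large A) →
      Der (.tm (Δ.lock μ) A a) →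
      Der (.eqTm Γ (.sub (.mod μ A) δ) (.sub (.mod μ a) δ) (.mod μ (a.sub (.lock μ δ))))
  | eqTm_subLetmod {m n o : M} {μ : n ⟶ m} {ν : o ⟶ n} {Γ Δ δ A B a b} :
      Der (.ctx Δ) → Der (.sb Γ Δ δ) → Der (.ty ((Δ.lock μ).lock ν) .large A) →
      Der (.tm (Δ.lock μ) (.mod ν A) a) → Der (.ty (Δ.ext μ (.mod ν A)) .large B) →
      Der (.tm (Δ.ext (ν ≫ μ) A) (B.sub (.ext .wk (Tm.mod ν .var))) b) →
      Der (.eqTm Γ ((B.sub (.inst a)).sub δ) (.sub (.letmod μ ν B a b) δ)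
        (.letmod μ ν (B.sub (.up n δ)) (a.sub (.lock μ δ)) (b.sub (.up o δ))))
  | eqTm_subSys {m : M} {Γ Δ : Cx M m} {δ A φ ψ a b} :
      Der (.sb Γ Δ δ) → Der (.ty Δ .large A) → Der (.tm (Δ.res φ) (A.sub (.wkF φ)) a) →
      Der (.tm (Δ.res ψ) (A.sub (.wkF ψ)) b) → Der (.tm Δ A (.sys φ a ψ b)) →
      Der (.eqTm Γ (A.sub δ) (.sub (.sys φ a ψ b) δ)
        (.sys (φ.sub δ) (a.sub (.upF δ φ)) (ψ.sub δ) (b.sub (.upF δ ψ))))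
  | eqTm_subKan {m : M} {Γ Δ : Cx M m} {δ A φ u u₀} :
      Der (.sb Γ Δ δ) → Der (.ty Δ.extI .large A) → Der (.face Δ φ) →
      Der (.tm (Δ.res φ).extI (A.sub (.upI (.wkF φ))) u) →
      Der (.tm Δ (A.sub (.instI .zero)) u₀) →
      Der (.eqTm (Δ.res φ) (A.sub (.extI (.wkF φ) .zero))
        (u.sub (.instI .zero)) (u₀.sub (.wkF φ))) →
      Der (.eqTm Γ ((A.sub (.instI .one)).sub δ) (.sub (.comp A φ u u₀) δ)
        (.comp (A.sub (.upI δ)) (φ.sub δ) (u.sub (.upI (.upF δ φ))) (u₀.sub δ)))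
  | eqTm_subCode {m : M} {Γ Δ : Cx M m} {δ A} :
      Der (.sb Γ Δ δ) → Der (.ty Δ .small A) →
      Der (.eqTm Γ .U (.sub (.code A) δ) (.code (A.sub δ)))
  | eqTm_subGlue {m : M} {Γ Δ : Cx M m} {δ φ T f A t a} :
      Der (.sb Γ Δ δ) → Der (.ty Δ .large A) → Der (.face Δ φ) → Der (.ty (Δ.res φ) .large T) →
      Der (.tm (Δ.res φ) (.equiv T (A.sub (.wkF φ))) f) →
      Der (.tm (Δ.res φ) T t) → Der (.tm Δ A a) →
      Der (.eqTm (Δ.res φ) (A.sub (.wkF φ)) (.app (.fst f) t) (a.sub (.wkF φ))) →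
      Der (.eqTm Γ (.sub (.glue φ T f A) δ) (.sub (.glue φ t a) δ)
        (.glue (φ.sub δ) (t.sub (.upF δ φ)) (a.sub δ)))
  | eqTm_subUnglue {m : M} {Γ Δ : Cx M m} {δ φ T f A b} :
      Der (.sb Γ Δ δ) → Der (.ty Δ .large A) → Der (.face Δ φ) → Der (.ty (Δ.res φ) .large T) →
      Der (.tm (Δ.res φ) (.equiv T (A.sub (.wkF φ))) f) → Der (.tm Δ (.glue φ T f A) b) →
      Der (.eqTm Γ (A.sub δ) (.sub (.unglue φ f b) δ)
        (.unglue (φ.sub δ) (f.sub (.upF δ φ)) (b.sub δ)))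
  /- Term equality: computation and uniqueness -/
  | eqTm_extBeta {m n : M} {μ : n ⟶ m} {Γ Δ δ A a} :
      Der (.sb Γ Δ δ) → Der (.ty (Δ.lock μ) .large A) →
      Der (.tm (Γ.lock μ) (A.sub (.lock μ δ)) a) →
      Der (.eqTm (Γ.lock μ) (A.sub (.lock μ δ)) (.sub .var (.lock μ (.ext δ a))) a)
  | eqTm_piBeta {m n : M} {μ : n ⟶ m} {Γ A B a b} :
      Der (.ty (Γ.lock μ) .large A) → Der (.ty (Γ.ext μ A) .large B) →
      Der (.tm (Γ.lock μ) A a) → Der (.tm (Γ.ext μ A) B b) →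
      Der (.eqTm Γ (B.sub (.inst a)) (.app (.lam b) a) (b.sub (.inst a)))
  | eqTm_piEta {m n : M} {μ : n ⟶ m} {Γ A B f} :
      Der (.ty (Γ.lock μ) .large A) → Der (.ty (Γ.ext μ A) .large B) →
      Der (.tm Γ (.pi μ A B) f) →
      Der (.eqTm Γ (.pi μ A B) f (.lam (.app (f.sub .wk) (Tm.var (n := n)))))
  | eqTm_fstBeta {m : M} {Γ : Cx M m} {A B a b} :
      Der (.ty Γ .large A) → Der (.ty (Γ.ext (𝟙 m) A) .large B) →
      Der (.tm Γ A a) → Der (.tm Γ (B.sub (.inst a)) b) →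
      Der (.eqTm Γ A (.fst (.pair a b)) a)
  | eqTm_sndBeta {m : M} {Γ : Cx M m} {A B a b} :
      Der (.ty Γ .large A) → Der (.ty (Γ.ext (𝟙 m) A) .large B) →
      Der (.tm Γ A a) → Der (.tm Γ (B.sub (.inst a)) b) →
      Der (.eqTm Γ (B.sub (.inst a)) (.snd (.pair a b)) b)
  | eqTm_sigmaEta {m : M} {Γ : Cx M m} {A B p} :
      Der (.ty Γ .large A) → Der (.ty (Γ.ext (𝟙 m) A) .large B) →
      Der (.tm Γ (.sigma A B) p) → Der (.eqTm Γ (.sigma A B) p (.pair (.fst p) (.snd p)))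
  | eqTm_boolTt {m : M} {Γ : Cx M m} {B t f} :
      Der (.ty (Γ.ext (𝟙 m) .bool) .large B) →
      Der (.tm Γ (B.sub (.inst (.tt (m := m)))) t) →
      Der (.tm Γ (B.sub (.inst (.ff (m := m)))) f) →
      Der (.eqTm Γ (B.sub (.inst (.tt (m := m)))) (.boolElim B t f .tt) t)
  | eqTm_boolFf {m : M} {Γ : Cx M m} {B t f} :
      Der (.ty (Γ.ext (𝟙 m) .bool) .large B) →
      Der (.tm Γ (B.sub (.inst (.tt (m := m)))) t) →
      Der (.tm Γ (B.sub (.inst (.ff (m := m)))) f) →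
      Der (.eqTm Γ (B.sub (.inst (.ff (m := m)))) (.boolElim B t f .ff) f)
  | eqTm_pathBeta {m : M} {Γ : Cx M m} {A a r} :
      Der (.ctx Γ) → Der (.ty Γ.extI .large A) → Der (.tm Γ.extI A a) → Der (.dim Γ r) →
      Der (.eqTm Γ (A.sub (.instI r)) (.papp (.plam a) r) (a.sub (.instI r)))
  | eqTm_pathEta {m : M} {Γ : Cx M m} {A a b p} :
      Der (.ctx Γ) → Der (.ty Γ.extI .large A) → Der (.tm Γ (A.sub (.instI .zero)) a) →
      Der (.tm Γ (A.sub (.instI .one)) b) → Der (.tm Γ (.path A a b) p) →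
      Der (.eqTm Γ (.path A a b) p (.plam (.papp (p.sub .wkI) .var)))
  | eqTm_pathZero {m : M} {Γ : Cx M m} {A a b p} :
      Der (.ty Γ.extI .large A) → Der (.tm Γ (A.sub (.instI .zero)) a) →
      Der (.tm Γ (A.sub (.instI .one)) b) → Der (.tm Γ (.path A a b) p) →
      Der (.eqTm Γ (A.sub (.instI .zero)) (.papp p .zero) a)
  | eqTm_pathOne {m : M} {Γ : Cx M m} {A a b p} :
      Der (.ty Γ.extI .large A) → Der (.tm Γ (A.sub (.instI .zero)) a) →
      Der (.tm Γ (A.sub (.instI .one)) b) → Der (.tm Γ (.path A a b) p) →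
      Der (.eqTm Γ (A.sub (.instI .one)) (.papp p .one) b)
  | eqTm_modBeta {m n o : M} {μ : n ⟶ m} {ν : o ⟶ n} {Γ A B a b} :
      Der (.ctx Γ) → Der (.ty ((Γ.lock μ).lock ν) .large A) →
      Der (.ty (Γ.ext μ (.mod ν A)) .large B) → Der (.tm ((Γ.lock μ).lock ν) A a) →
      Der (.tm (Γ.ext (ν ≫ μ) A) (B.sub (.ext .wk (Tm.mod ν .var))) b) →
      Der (.eqTm Γ (B.sub (.inst (Tm.mod ν a))) (.letmod μ ν B (.mod ν a) b) (b.sub (.inst a)))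
  | eqTm_sysLeft {m : M} {Γ : Cx M m} {A φ ψ a b} :
      Der (.ty Γ .large A) → Der (.tm (Γ.res φ) (A.sub (.wkF φ)) a) →
      Der (.tm (Γ.res ψ) (A.sub (.wkF ψ)) b) → Der (.tm Γ A (.sys φ a ψ b)) →
      Der (.eqTm (Γ.res φ) (A.sub (.wkF φ)) (.sub (.sys φ a ψ b) (.wkF φ)) a)
  | eqTm_sysRight {m : M} {Γ : Cx M m} {A φ ψ a b} :
      Der (.ty Γ .large A) → Der (.tm (Γ.res φ) (A.sub (.wkF φ)) a) →
      Der (.tm (Γ.res ψ) (A.sub (.wkF ψ)) b) → Der (.tm Γ A (.sys φ a ψ b)) →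
      Der (.eqTm (Γ.res ψ) (A.sub (.wkF ψ)) (.sub (.sys φ a ψ b) (.wkF ψ)) b)
  | eqTm_faceBin {m : M} {Γ : Cx M m} {A a b φ ψ} :
      Der (.tm Γ A a) → Der (.tm Γ A b) → Der (.face Γ φ) → Der (.face Γ ψ) →
      Der (.eqFace Γ (φ.join ψ) .top) →
      Der (.eqTm (Γ.res φ) (A.sub (.wkF φ)) (a.sub (.wkF φ)) (b.sub (.wkF φ))) →
      Der (.eqTm (Γ.res ψ) (A.sub (.wkF ψ)) (a.sub (.wkF ψ)) (b.sub (.wkF ψ))) →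
      Der (.eqTm Γ A a b)
  | eqTm_faceNull {m : M} {Γ : Cx M m} {A a b} :
      Der (.tm Γ A a) → Der (.tm Γ A b) → Der (.eqFace Γ .bot .top) → Der (.eqTm Γ A a b)
  | eqTm_codeEl {m : M} {Γ : Cx M m} {t} :
      Der (.tm Γ .U t) → Der (.eqTm Γ .U (.code (.el t)) t)
  | eqTm_glueTop {m : M} {Γ : Cx M m} {φ T f A t a} :
      Der (.ty Γ .large A) → Der (.face Γ φ) → Der (.ty (Γ.res φ) .large T) →
      Der (.tm (Γ.res φ) (.equiv T (A.sub (.wkF φ))) f) →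
      Der (.tm (Γ.res φ) T t) → Der (.tm Γ A a) →
      Der (.eqTm (Γ.res φ) (A.sub (.wkF φ)) (.app (.fst f) t) (a.sub (.wkF φ))) →
      Der (.eqTm (Γ.res φ) T (.sub (.glue φ t a) (.wkF φ)) t)
  | eqTm_unglueTop {m : M} {Γ : Cx M m} {φ T f A b} :
      Der (.ty Γ .large A) → Der (.face Γ φ) → Der (.ty (Γ.res φ) .large T) →
      Der (.tm (Γ.res φ) (.equiv T (A.sub (.wkF φ))) f) → Der (.tm Γ (.glue φ T f A) b) →
      Der (.eqTm (Γ.res φ) (A.sub (.wkF φ)) (.sub (.unglue φ f b) (.wkF φ))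
        (.app (.fst f) (b.sub (.wkF φ))))
  | eqTm_glueBeta {m : M} {Γ : Cx M m} {φ T f A t a} :
      Der (.ty Γ .large A) → Der (.face Γ φ) → Der (.ty (Γ.res φ) .large T) →
      Der (.tm (Γ.res φ) (.equiv T (A.sub (.wkF φ))) f) →
      Der (.tm (Γ.res φ) T t) → Der (.tm Γ A a) →
      Der (.eqTm (Γ.res φ) (A.sub (.wkF φ)) (.app (.fst f) t) (a.sub (.wkF φ))) →
      Der (.eqTm Γ A (.unglue φ f (.glue φ t a)) a)
  | eqTm_glueEta {m : M} {Γ : Cx M m} {φ T f A b} :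
      Der (.ty Γ .large A) → Der (.face Γ φ) → Der (.ty (Γ.res φ) .large T) →
      Der (.tm (Γ.res φ) (.equiv T (A.sub (.wkF φ))) f) → Der (.tm Γ (.glue φ T f A) b) →
      Der (.eqTm Γ (.glue φ T f A) b (.glue φ (b.sub (.wkF φ)) (.unglue φ f b)))
  /- Term equality: composition -/
  | eqTm_compFace {m : M} {Γ : Cx M m} {A φ u u₀} :
      Der (.ty Γ.extI .large A) → Der (.face Γ φ) →
      Der (.tm (Γ.res φ).extI (A.sub (.upI (.wkF φ))) u) →
      Der (.tm Γ (A.sub (.instI .zero)) u₀) →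
      Der (.eqTm (Γ.res φ) (A.sub (.extI (.wkF φ) .zero))
        (u.sub (.instI .zero)) (u₀.sub (.wkF φ))) →
      Der (.eqFace Γ φ .top) →
      Der (.eqTm Γ (A.sub (.instI .one)) (.comp A φ u u₀) (u.sub (.extI (.res .id φ) .one)))
  | eqTm_compMod {m n : M} {μ : n ⟶ m} {Γ A φ u u₀} :
      Der (.ctx Γ) → Der (.ty (Γ.extI.lock μ) .large A) → Der (.face Γ φ) →
      Der (.tm ((Γ.res φ).extI.lock μ) (A.sub (.lock μ (.upI (.wkF φ)))) u) →
      Der (.tm (Γ.lock μ) (A.sub (.lock μ (.instI .zero))) u₀) →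
      Der (.eqTm ((Γ.res φ).lock μ) (A.sub (.lock μ (.extI (.wkF φ) .zero)))
        (u.sub (.lock μ (.instI .zero))) (u₀.sub (.lock μ (.wkF φ)))) →
      Der (.eqTm Γ (.sub (.mod μ A) (.instI .one))
        (.comp (.mod μ A) φ (.mod μ u) (.mod μ u₀))
        (.mod μ (.comp (A.sub (.excIinv μ)) (.exc μ φ)
          (u.sub (.comp (.excIinv μ) (.upI (.excFinv μ φ)))) u₀)))
  | eqTm_compPi {m n : M} {μ : n ⟶ m} {Γ A B φ f f₀ a₁ v} :
      Der (.ctx Γ) → Der (.ty (Γ.extI.lock μ) .large A) →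
      Der (.ty (Γ.extI.ext μ A) .large B) → Der (.face Γ φ) →
      Der (.tm (Γ.res φ).extI (.sub (.pi μ A B) (.upI (.wkF φ))) f) →
      Der (.tm Γ (.sub (.pi μ A B) (.instI .zero)) f₀) →
      Der (.eqTm (Γ.res φ) (.sub (.pi μ A B) (.extI (.wkF φ) .zero))
        (f.sub (.instI .zero)) (f₀.sub (.wkF φ))) →
      Der (.tm (Γ.lock μ) (A.sub (.lock μ (.instI .one))) a₁) →
      v = ((Tm.transpFill ((A.sub (.excIinv μ)).sub .rev) a₁).sub .rev).sub (.excI μ) →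
      Der (.eqTm Γ (B.sub (.ext (.instI .one) a₁))
        (.app (.comp (.pi μ A B) φ f f₀) a₁)
        (.comp (B.sub (.inst v)) φ
          (.app f (v.sub (.lock μ (.upI (.wkF φ)))))
          (.app f₀ (v.sub (.lock μ (.instI .zero))))))
  | eqTm_extra {m : M} {Γ : Cx M m} {A a b} :
      Der (.tm Γ A a) → Der (.tm Γ A b) → E.tm Γ A a b → Der (.eqTm Γ A a b)

end Rules

end CubicalMTT

/-!
The equivalence is built by an encode–decode argument. Write `T` for the type `El t` behind the
lock. Modal induction into the universe gives a family `C` of types over `⟨μ ∣ T⟩` with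
`C (mod_μ y) = ⟨μ ∣ Path a y⟩`: the type on the right is small, hence has a code, and the code can
be chosen for the packed variable `y` first (`exists_code_family`). Two further modal inductions
give `f : C z → Path (mod_μ a) z` which takes `mod_μ p` to the path `i ↦ mod_μ (p (i^μ))`; this is
where the exchange of the interval with the lock enters (`exists_decode`).

* The map from left to right is `F x = f x` at `z = mod_μ b`.
* The inverse `G` sends a path `P` to the value at `1` of a section `g` of the line
  `i ↦ C (P i)` with `g 0 = mod_μ refl`. Such a section is a filler, obtained by composing
  along the connection `i ∧ j` (`exists_filler`).
* Two sections of a line of types which agree at `0` are connected by a path at `1`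
  (`exists_path_of_sections`): transport the constant path along the line of path types. For
  `F (G P) = P`, compare the sections `i ↦ f (g i)` and `i ↦ (j ↦ P (j ∧ i))` of the line
  `i ↦ Path (mod_μ a) (P i)`. For `G (F x) = x`, modal induction reduces to `x = mod_μ q`; here
  compare `g`, for `P = F (mod_μ q)`, with `i ↦ mod_μ (j ↦ q (j ∧ i^μ))`.

To compute with judgemental equality, the derivable syntax is divided by it: contexts form a
category of substitutions modulo equality, and types, terms and interval terms over them become
quotients on which substitution acts strictly. Terms over a context, of whatever type, are
collected in the structure `Elt`, with the type as a field; so a typing condition is an equation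
`x.ty = A`, and the conversion rule is rewriting. Each operation on classes comes with a lemma
`*_rep`, which says that raw representatives may be chosen freely. They serve in the end to read off the
raw derivation from the term of the quotient. Extra judgemental equalities only make the quotients
coarser, so they play no role.
-/

universe w v u

namespace CubicalMTT

open CategoryTheory

/-! ### Judgements up to judgemental equality -/

/-- A form of judgement on raw expressions together with its judgemental equality. -/
structure EqJudg (R : Type u) where
  /-- the well-formed expressions -/
  wf : R → Prop
  /-- judgemental equality -/
  eq : R → R → Prop
  refl : ∀ {a}, wf a → eq a a
  symm : ∀ {a b}, eq a b → eq b a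
  trans : ∀ {a b c}, eq a b → eq b c → eq a c

namespace EqJudg

variable {R : Type u} {J : EqJudg R}

/-- Judgemental equality, as a setoid on the well-formed expressions. -/
def setoid (J : EqJudg R) : Setoid {a // J.wf a} where
  r a b := J.eq a.1 b.1
  iseqv := ⟨fun a => J.refl a.2, J.symm, J.trans⟩

/-- Well-formed expressions up to judgemental equality. -/
def Cls (J : EqJudg R) : Type u := Quotient J.setoid

namespace Cls

/-- The class of a well-formed expression. -/
def mk (a : R) (h : J.wf a) : J.Cls := Quotient.mk J.setoid ⟨a, h⟩

/-- A chosen representative of a class. -/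
noncomputable def raw (x : J.Cls) : R := (Quotient.out x).1

theorem wf (x : J.Cls) : J.wf x.raw := (Quotient.out x).2

/-- The raw expression `a` is judgementally equal to the chosen representative of `x`. -/
def Rep (x : J.Cls) (a : R) : Prop := J.eq x.raw a

theorem rep_raw (x : J.Cls) : x.Rep x.raw := J.refl x.wf

theorem mk_rep {a : R} (h : J.wf a) : (mk a h).Rep a :=
  Quotient.exact (s := J.setoid) (Quotient.out_eq (mk a h))

theorem ext {x y : J.Cls} {a b : R} (hx : x.Rep a) (hy : y.Rep b) (h : J.eq a b) : x = y := by
  rw [← Quotient.out_eq x, ← Quotient.out_eq y]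
  exact Quotient.sound (s := J.setoid) (J.trans hx (J.trans h (J.symm hy)))

end Cls

end EqJudg

variable {M : Type u} [Bicategory.{w, v} M] {E : ExtraEqs M} {m n : M}

/-- Derivable contexts at mode `m`. -/
structure Con (E : ExtraEqs M) (m : M) where
  raw : Cx M m
  wf : Der E (.ctx raw)

/-- Substitutions between two contexts, with their equality. -/
def sbJ (Γ Δ : Con E m) : EqJudg (Sb M m) where
  wf δ := Der E (.sb Γ.raw Δ.raw δ)
  eq δ ξ := Der E (.eqSb Γ.raw Δ.raw δ ξ)
  refl := .eqSb_refl
  symm := .eqSb_symm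
  trans := .eqSb_trans

/-- Large types over a context, with their equality. -/
def tyJ (Γ : Con E m) : EqJudg (Ty M m) where
  wf A := Der E (.ty Γ.raw .large A)
  eq A B := Der E (.eqTy Γ.raw .large A B)
  refl := .eqTy_refl
  symm := .eqTy_symm
  trans := .eqTy_trans

/-- Terms of a raw type over a context, with their equality. -/
def tmJ (Γ : Con E m) (A : Ty M m) : EqJudg (Tm M m) where
  wf a := Der E (.tm Γ.raw A a)
  eq a b := Der E (.eqTm Γ.raw A a b)
  refl := .eqTm_refl
  symm := .eqTm_symm
  trans := .eqTm_trans

/-- Interval terms over a context, with their equality. -/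
def dimJ (Γ : Con E m) : EqJudg (Dim M m) where
  wf r := Der E (.dim Γ.raw r)
  eq r s := Der E (.eqDim Γ.raw r s)
  refl := .eqDim_refl
  symm := .eqDim_symm
  trans := .eqDim_trans

/-- Substitutions up to judgemental equality. -/
abbrev Sbs (Γ Δ : Con E m) := (sbJ Γ Δ).Cls

/-- Types up to judgemental equality. -/
abbrev Typ (Γ : Con E m) := (tyJ Γ).Cls

/-- Interval terms up to judgemental equality. -/
abbrev Itv (Γ : Con E m) := (dimJ Γ).Cls

/-- Terms up to judgemental equality: a type together with a class of terms of this type. Terms of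
all types are collected in one Lean type, so that equal types require no transport. -/
structure Elt (Γ : Con E m) where
  ty : Typ Γ
  cls : (tmJ Γ ty.raw).Cls

namespace Elt

variable {Γ : Con E m}

/-- A representative of the term, of the type `x.ty.raw`. -/
noncomputable def raw (x : Elt Γ) : Tm M m := x.cls.raw

theorem wf (x : Elt Γ) : Der E (.tm Γ.raw x.ty.raw x.raw) := x.cls.wf

/-- The raw term `a` is judgementally equal to the representative of `x`. -/
def Rep (x : Elt Γ) (a : Tm M m) : Prop := Der E (.eqTm Γ.raw x.ty.raw x.raw a)

theorem rep_raw (x : Elt Γ) : x.Rep x.raw := x.cls.rep_raw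

theorem wf_of {x : Elt Γ} {A : Typ Γ} {A' : Ty M m} (h : x.ty = A) (hA : A.Rep A') :
    Der E (.tm Γ.raw A' x.raw) := by
  subst h; exact .tm_conv hA x.wf

theorem rep_of {x : Elt Γ} {A : Typ Γ} {A' : Ty M m} {a : Tm M m} (hx : x.Rep a)
    (h : x.ty = A) (hA : A.Rep A') : Der E (.eqTm Γ.raw A' x.raw a) := by
  subst h; exact .eqTm_conv hA hx

/-- The class of a raw term of a type represented by `A`. -/
noncomputable def mk' (A : Typ Γ) {A' : Ty M m} {a : Tm M m} (hA : A.Rep A')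
    (h : Der E (.tm Γ.raw A' a)) : Elt Γ :=
  ⟨A, .mk a (.tm_conv (.eqTy_symm hA) h)⟩

theorem mk'_rep {A : Typ Γ} {A' : Ty M m} {a : Tm M m} (hA : A.Rep A')
    (h : Der E (.tm Γ.raw A' a)) : (mk' A hA h).Rep a :=
  EqJudg.Cls.mk_rep (J := tmJ Γ A.raw) _

/-- Terms of equal types agree if they have judgementally equal representatives, in any
representative of their type. -/
theorem ext' {x y : Elt Γ} {A : Ty M m} {a b : Tm M m} (ht : x.ty = y.ty) (hx : x.Rep a)
    (hy : y.Rep b) (hA : x.ty.Rep A) (h : Der E (.eqTm Γ.raw A a b)) : x = y := by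
  obtain ⟨T, x⟩ := x
  obtain ⟨T', y⟩ := y
  obtain rfl : T = T' := ht
  congr 1
  exact EqJudg.Cls.ext (J := tmJ Γ T.raw) hx hy (.eqTm_conv (.eqTy_symm hA) h)

end Elt

/-! ### Substitution -/

/-- The category of contexts and substitutions up to judgemental equality. -/
noncomputable instance : Category (Con E m) where
  Hom Γ Δ := Sbs Γ Δ
  id Γ := .mk .id (.sb_id Γ.wf)
  comp δ ξ := .mk (ξ.raw.comp δ.raw) (.sb_comp δ.wf ξ.wf)
  id_comp {Γ Δ} δ := by
    refine EqJudg.Cls.ext (J := sbJ Γ Δ) (.eqSb_trans (EqJudg.Cls.mk_rep (J := sbJ Γ Δ) _)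
      (.eqSb_comp (EqJudg.Cls.mk_rep (J := sbJ Γ Γ) _) (EqJudg.Cls.rep_raw δ)))
      (EqJudg.Cls.rep_raw δ) (.eqSb_compId (EqJudg.Cls.wf δ))
  comp_id {Γ Δ} δ := by
    refine EqJudg.Cls.ext (J := sbJ Γ Δ) (.eqSb_trans (EqJudg.Cls.mk_rep (J := sbJ Γ Δ) _)
      (.eqSb_comp (EqJudg.Cls.rep_raw δ) (EqJudg.Cls.mk_rep (J := sbJ Δ Δ) _)))
      (EqJudg.Cls.rep_raw δ) (.eqSb_idComp (EqJudg.Cls.wf δ))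
  assoc {Γ Δ Ξ Θ} δ ξ ζ := by
    refine EqJudg.Cls.ext (J := sbJ Γ Θ) (.eqSb_trans (EqJudg.Cls.mk_rep (J := sbJ Γ Θ) _)
      (.eqSb_comp (EqJudg.Cls.mk_rep (J := sbJ Γ Ξ) _) (EqJudg.Cls.rep_raw ζ)))
      (.eqSb_trans (EqJudg.Cls.mk_rep (J := sbJ Γ Θ) _)
      (.eqSb_comp (EqJudg.Cls.rep_raw δ) (EqJudg.Cls.mk_rep (J := sbJ Δ Θ) _)))
      (.eqSb_symm (.eqSb_assoc (EqJudg.Cls.wf δ) (EqJudg.Cls.wf ξ) (EqJudg.Cls.wf ζ)))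

section

variable {Γ Δ Ξ : Con E m}

/-- A representative of a substitution. -/
noncomputable def sraw (δ : Γ ⟶ Δ) : Sb M m := EqJudg.Cls.raw (J := sbJ Γ Δ) δ

theorem swf (δ : Γ ⟶ Δ) : Der E (.sb Γ.raw Δ.raw (sraw δ)) := EqJudg.Cls.wf (J := sbJ Γ Δ) δ

/-- The raw substitution `δ'` is judgementally equal to the representative of `δ`. -/
def SRep (δ : Γ ⟶ Δ) (δ' : Sb M m) : Prop := Der E (.eqSb Γ.raw Δ.raw (sraw δ) δ')

/-- The class of a derivable substitution. -/
def smk {δ : Sb M m} (h : Der E (.sb Γ.raw Δ.raw δ)) : Γ ⟶ Δ := EqJudg.Cls.mk (J := sbJ Γ Δ) δ h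

theorem srep_raw (δ : Γ ⟶ Δ) : SRep δ (sraw δ) := .eqSb_refl (swf δ)

theorem smk_rep {δ : Sb M m} (h : Der E (.sb Γ.raw Δ.raw δ)) : SRep (smk h) δ :=
  EqJudg.Cls.mk_rep (J := sbJ Γ Δ) h

/-- Substitutions agree if they have judgementally equal representatives. -/
theorem s_ext {δ ξ : Γ ⟶ Δ} {δ' ξ' : Sb M m} (hδ : SRep δ δ') (hξ : SRep ξ ξ')
    (h : Der E (.eqSb Γ.raw Δ.raw δ' ξ')) : δ = ξ :=
  EqJudg.Cls.ext (J := sbJ Γ Δ) hδ hξ h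

theorem id_rep : SRep (𝟙 Γ) .id := smk_rep (.sb_id Γ.wf)

theorem comp_rep {δ : Γ ⟶ Δ} {ξ : Δ ⟶ Ξ} {δ' ξ' : Sb M m} (hδ : SRep δ δ') (hξ : SRep ξ ξ') :
    SRep (δ ≫ ξ) (ξ'.comp δ') :=
  .eqSb_trans (smk_rep (.sb_comp (swf δ) (swf ξ))) (.eqSb_comp hδ hξ)

/-- Substitution in types. -/
noncomputable def Typ.sub (A : Typ Δ) (δ : Γ ⟶ Δ) : Typ Γ :=
  .mk (A.raw.sub (sraw δ)) (.ty_sub (swf δ) A.wf)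

theorem Typ.sub_rep {A : Typ Δ} {δ : Γ ⟶ Δ} {A' δ'} (hA : A.Rep A') (hδ : SRep δ δ') :
    (A.sub δ).Rep (A'.sub δ') :=
  .eqTy_trans (EqJudg.Cls.mk_rep (J := tyJ Γ) _) (.eqTy_sub hδ hA)

@[simp] theorem Typ.sub_id (A : Typ Γ) : A.sub (𝟙 Γ) = A :=
  EqJudg.Cls.ext (Typ.sub_rep A.rep_raw id_rep) A.rep_raw (.eqTy_subId A.wf)

@[simp] theorem Typ.sub_sub (A : Typ Ξ) (ξ : Δ ⟶ Ξ) (δ : Γ ⟶ Δ) :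
    (A.sub ξ).sub δ = A.sub (δ ≫ ξ) :=
  EqJudg.Cls.ext (Typ.sub_rep (Typ.sub_rep A.rep_raw (srep_raw ξ)) (srep_raw δ))
    (Typ.sub_rep A.rep_raw (comp_rep (srep_raw δ) (srep_raw ξ)))
    (.eqTy_symm (.eqTy_subComp (swf δ) (swf ξ) A.wf))

/-- Substitution in terms. -/
noncomputable def Elt.sub (x : Elt Δ) (δ : Γ ⟶ Δ) : Elt Γ :=
  .mk' (x.ty.sub δ) (Typ.sub_rep x.ty.rep_raw (srep_raw δ)) (.tm_sub (swf δ) x.wf)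

@[simp] theorem Elt.sub_ty (x : Elt Δ) (δ : Γ ⟶ Δ) : (x.sub δ).ty = x.ty.sub δ := (rfl)

theorem Elt.sub_rep {x : Elt Δ} {δ : Γ ⟶ Δ} {x' δ'} (hx : x.Rep x') (hδ : SRep δ δ') :
    (x.sub δ).Rep (x'.sub δ') :=
  .eqTm_trans (Elt.mk'_rep _ _)
    (.eqTm_conv (.eqTy_symm (Typ.sub_rep x.ty.rep_raw (srep_raw δ))) (.eqTm_sub hδ hx))

@[simp] theorem Elt.sub_id (x : Elt Γ) : x.sub (𝟙 Γ) = x :=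
  Elt.ext' (by simp) (Elt.sub_rep x.rep_raw id_rep) x.rep_raw
    (by simpa using x.ty.rep_raw) (.eqTm_subId x.wf)

@[simp] theorem Elt.sub_sub (x : Elt Ξ) (ξ : Δ ⟶ Ξ) (δ : Γ ⟶ Δ) :
    (x.sub ξ).sub δ = x.sub (δ ≫ ξ) :=
  Eq.symm <| Elt.ext' (by simp) (Elt.sub_rep x.rep_raw (comp_rep (srep_raw δ) (srep_raw ξ)))
    (Elt.sub_rep (Elt.sub_rep x.rep_raw (srep_raw ξ)) (srep_raw δ))
    (Typ.sub_rep x.ty.rep_raw (comp_rep (srep_raw δ) (srep_raw ξ)))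
    (.eqTm_subComp (swf δ) (swf ξ) x.wf)

/-- Substitution in interval terms. -/
noncomputable def Itv.sub (r : Itv Δ) (δ : Γ ⟶ Δ) : Itv Γ :=
  .mk (r.raw.sub (sraw δ)) (.dim_sub (swf δ) r.wf)

theorem Itv.sub_rep {r : Itv Δ} {δ : Γ ⟶ Δ} {r' δ'} (hr : r.Rep r') (hδ : SRep δ δ') :
    (r.sub δ).Rep (r'.sub δ') :=
  .eqDim_trans (EqJudg.Cls.mk_rep (J := dimJ Γ) _) (.eqDim_sub hδ hr)

@[simp] theorem Itv.sub_id (r : Itv Γ) : r.sub (𝟙 Γ) = r :=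
  EqJudg.Cls.ext (Itv.sub_rep r.rep_raw id_rep) r.rep_raw (.eqDim_subId r.wf)

@[simp] theorem Itv.sub_sub (r : Itv Ξ) (ξ : Δ ⟶ Ξ) (δ : Γ ⟶ Δ) :
    (r.sub ξ).sub δ = r.sub (δ ≫ ξ) :=
  EqJudg.Cls.ext (Itv.sub_rep (Itv.sub_rep r.rep_raw (srep_raw ξ)) (srep_raw δ))
    (Itv.sub_rep r.rep_raw (comp_rep (srep_raw δ) (srep_raw ξ)))
    (.eqDim_symm (.eqDim_subComp (swf δ) (swf ξ) r.wf))

end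

/-! ### Locks -/

/-- The locked context. -/
def Con.lock (μ : n ⟶ m) (Γ : Con E m) : Con E n := ⟨Γ.raw.lock μ, .cx_lock Γ.wf⟩

section

variable {Γ Δ Ξ : Con E m}

/-- The functorial action of a lock. -/
noncomputable def lk (μ : n ⟶ m) (δ : Γ ⟶ Δ) : Γ.lock μ ⟶ Δ.lock μ :=
  smk (.sb_lock (swf δ))

theorem lk_rep {μ : n ⟶ m} {δ : Γ ⟶ Δ} {δ'} (h : SRep δ δ') : SRep (lk μ δ) (.lock μ δ') :=
  .eqSb_trans (smk_rep _) (.eqSb_lock h)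

@[simp] theorem lk_id (μ : n ⟶ m) : lk μ (𝟙 Γ) = 𝟙 (Γ.lock μ) :=
  s_ext (lk_rep id_rep) id_rep (.eqSb_lockId Γ.wf)

@[simp] theorem lk_comp (μ : n ⟶ m) (δ : Γ ⟶ Δ) (ξ : Δ ⟶ Ξ) :
    lk μ δ ≫ lk μ ξ = lk μ (δ ≫ ξ) :=
  Eq.symm <| s_ext (lk_rep (comp_rep (srep_raw δ) (srep_raw ξ)))
    (comp_rep (lk_rep (srep_raw δ)) (lk_rep (srep_raw ξ))) (.eqSb_lockComp (swf δ) (swf ξ))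

/-! ### Extension by a variable -/

/-- The context `Γ.(μ ∣ A)`. -/
noncomputable def Con.ext {μ : n ⟶ m} (Γ : Con E m) (A : Typ (Γ.lock μ)) : Con E m :=
  ⟨Γ.raw.ext μ A.raw, .cx_ext Γ.wf A.wf⟩

variable {μ : n ⟶ m}

/-- Weakening by a variable. -/
noncomputable def wk (A : Typ (Γ.lock μ)) : Γ.ext A ⟶ Γ := smk (.sb_wk Γ.wf A.wf)

theorem wk_rep (A : Typ (Γ.lock μ)) : SRep (wk A) .wk := smk_rep _

/-- The last variable, behind the lock by its annotation. -/
noncomputable def var (A : Typ (Γ.lock μ)) : Elt ((Γ.ext A).lock μ) :=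
  .mk' (A.sub (lk μ (wk A))) (Typ.sub_rep A.rep_raw (lk_rep (wk_rep A))) (.tm_var Γ.wf A.wf)

@[simp] theorem var_ty (A : Typ (Γ.lock μ)) : (var A).ty = A.sub (lk μ (wk A)) := (rfl)

theorem var_rep (A : Typ (Γ.lock μ)) : (var A).Rep .var := Elt.mk'_rep _ _

/-- The substitution `(δ, a)` into `Δ.(μ ∣ A)`. -/
noncomputable def cons {A : Typ (Δ.lock μ)} (δ : Γ ⟶ Δ) (a : Elt (Γ.lock μ))
    (h : a.ty = A.sub (lk μ δ)) : Γ ⟶ Δ.ext A :=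
  smk (.sb_ext (swf δ) A.wf (Elt.wf_of h (Typ.sub_rep A.rep_raw (lk_rep (srep_raw δ)))))

theorem cons_rep {A : Typ (Δ.lock μ)} {δ : Γ ⟶ Δ} {a : Elt (Γ.lock μ)}
    {h : a.ty = A.sub (lk μ δ)} {δ' a'} (hδ : SRep δ δ') (ha : a.Rep a') :
    SRep (cons δ a h) (.ext δ' a') :=
  .eqSb_trans (smk_rep _) (.eqSb_ext hδ A.wf
    (Elt.rep_of ha h (Typ.sub_rep A.rep_raw (lk_rep (srep_raw δ)))))

section

variable {A : Typ (Δ.lock μ)} (δ : Γ ⟶ Δ) (a : Elt (Γ.lock μ)) (h : a.ty = A.sub (lk μ δ))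

@[simp] theorem cons_wk : cons δ a h ≫ wk A = δ :=
  s_ext (comp_rep (cons_rep (srep_raw δ) a.rep_raw) (wk_rep A)) (srep_raw δ)
    (.eqSb_extBeta (swf δ) A.wf (Elt.wf_of h (Typ.sub_rep A.rep_raw (lk_rep (srep_raw δ)))))

@[simp] theorem cons_wk_assoc {Ξ : Con E m} (ξ : Δ ⟶ Ξ) : cons δ a h ≫ wk A ≫ ξ = δ ≫ ξ := by
  rw [← Category.assoc, cons_wk]

@[simp] theorem var_sub_cons : (var A).sub (lk μ (cons δ a h)) = a :=
  Elt.ext' (by simp [h]) (Elt.sub_rep (var_rep A) (lk_rep (cons_rep (srep_raw δ) a.rep_raw)))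
    a.rep_raw (by simpa using Typ.sub_rep A.rep_raw (lk_rep (srep_raw δ)))
    (.eqTm_extBeta (swf δ) A.wf (Elt.wf_of h (Typ.sub_rep A.rep_raw (lk_rep (srep_raw δ)))))

end

theorem cons_eta {A : Typ (Δ.lock μ)} (δ : Γ ⟶ Δ.ext A) :
    δ = cons (δ ≫ wk A) ((var A).sub (lk μ δ)) (by simp) :=
  s_ext (srep_raw δ) (cons_rep (comp_rep (srep_raw δ) (wk_rep A))
    (Elt.sub_rep (var_rep A) (lk_rep (srep_raw δ)))) (.eqSb_extEta Δ.wf A.wf (swf δ))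

theorem cons_hom_ext {A : Typ (Δ.lock μ)} {δ ξ : Γ ⟶ Δ.ext A} (h : δ ≫ wk A = ξ ≫ wk A)
    (h' : (var A).sub (lk μ δ) = (var A).sub (lk μ ξ)) : δ = ξ := by
  rw [cons_eta δ, cons_eta ξ]; simp only [h, h']

@[simp] theorem comp_cons {A : Typ (Ξ.lock μ)} (δ : Γ ⟶ Δ) (ξ : Δ ⟶ Ξ) (a : Elt (Δ.lock μ))
    (h : a.ty = A.sub (lk μ ξ)) :
    δ ≫ cons ξ a h = cons (δ ≫ ξ) (a.sub (lk μ δ)) (by simp [h]) := by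
  apply cons_hom_ext
  · simp
  · rw [var_sub_cons, ← lk_comp, ← Elt.sub_sub, var_sub_cons]

/-! ### The trivial lock and unannotated variables -/

/-- The lock by the identity is trivial only up to equality of contexts, so that types and terms
have to be moved across it. -/
theorem eqCx_unlock (Γ : Con E m) : Der E (.eqCtx (Γ.lock (𝟙 m)).raw Γ.raw) := .eqCx_idLock Γ.wf

/-- A type, seen behind the trivial lock. -/
noncomputable def Typ.up (A : Typ Γ) : Typ (Γ.lock (𝟙 m)) :=
  .mk A.raw (.ty_conv (.eqCx_symm (eqCx_unlock Γ)) A.wf)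

/-- A type behind the trivial lock, seen in the unlocked context. -/
noncomputable def Typ.down (A : Typ (Γ.lock (𝟙 m))) : Typ Γ :=
  .mk A.raw (.ty_conv (eqCx_unlock Γ) A.wf)

theorem Typ.up_rep {A : Typ Γ} {A'} (h : A.Rep A') : A.up.Rep A' :=
  .eqTy_trans (EqJudg.Cls.mk_rep (J := tyJ _) _) (.eqTy_conv (.eqCx_symm (eqCx_unlock Γ)) h)

theorem Typ.down_rep {A : Typ (Γ.lock (𝟙 m))} {A'} (h : A.Rep A') : A.down.Rep A' :=
  .eqTy_trans (EqJudg.Cls.mk_rep (J := tyJ _) _) (.eqTy_conv (eqCx_unlock Γ) h)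

@[simp] theorem Typ.up_down (A : Typ (Γ.lock (𝟙 m))) : A.down.up = A :=
  EqJudg.Cls.ext (Typ.up_rep (Typ.down_rep A.rep_raw)) A.rep_raw (.eqTy_refl A.wf)

@[simp] theorem Typ.down_up (A : Typ Γ) : A.up.down = A :=
  EqJudg.Cls.ext (Typ.down_rep (Typ.up_rep A.rep_raw)) A.rep_raw (.eqTy_refl A.wf)

theorem eqSb_unlock (δ : Γ ⟶ Δ) :
    Der E (.eqSb (Γ.lock (𝟙 m)).raw (Δ.lock (𝟙 m)).raw (.lock (𝟙 m) (sraw δ)) (sraw δ)) :=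
  .eqSb_conv (.eqCx_symm (eqCx_unlock Γ)) (.eqCx_symm (eqCx_unlock Δ)) (.eqSb_idLock (swf δ))

@[simp] theorem Typ.up_sub (A : Typ Δ) (δ : Γ ⟶ Δ) : A.up.sub (lk (𝟙 m) δ) = (A.sub δ).up :=
  EqJudg.Cls.ext (Typ.sub_rep (Typ.up_rep A.rep_raw) (lk_rep (srep_raw δ)))
    (Typ.up_rep (Typ.sub_rep A.rep_raw (srep_raw δ)))
    (.eqTy_sub (eqSb_unlock δ) (.eqTy_refl (.ty_conv (.eqCx_symm (eqCx_unlock Δ)) A.wf)))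

/-- A term, seen behind the trivial lock. -/
noncomputable def Elt.up (x : Elt Γ) : Elt (Γ.lock (𝟙 m)) :=
  .mk' x.ty.up (Typ.up_rep x.ty.rep_raw) (.tm_convCx (.eqCx_symm (eqCx_unlock Γ)) x.wf)

/-- A term behind the trivial lock, seen in the unlocked context. -/
noncomputable def Elt.down (x : Elt (Γ.lock (𝟙 m))) : Elt Γ :=
  .mk' x.ty.down (Typ.down_rep x.ty.rep_raw) (.tm_convCx (eqCx_unlock Γ) x.wf)

@[simp] theorem Elt.up_ty (x : Elt Γ) : x.up.ty = x.ty.up := (rfl)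

@[simp] theorem Elt.down_ty (x : Elt (Γ.lock (𝟙 m))) : x.down.ty = x.ty.down := (rfl)

theorem Elt.up_rep {x : Elt Γ} {x'} (h : x.Rep x') : x.up.Rep x' :=
  .eqTm_trans (Elt.mk'_rep _ _) (.eqTm_conv (.eqTy_symm (Typ.up_rep x.ty.rep_raw))
    (.eqTm_convCx (.eqCx_symm (eqCx_unlock Γ)) h))

theorem Elt.down_rep {x : Elt (Γ.lock (𝟙 m))} {x'} (h : x.Rep x') : x.down.Rep x' :=
  .eqTm_trans (Elt.mk'_rep _ _) (.eqTm_conv (.eqTy_symm (Typ.down_rep x.ty.rep_raw))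
    (.eqTm_convCx (eqCx_unlock Γ) h))

@[simp] theorem Elt.up_down (x : Elt (Γ.lock (𝟙 m))) : x.down.up = x :=
  Elt.ext' (by simp) (Elt.up_rep (Elt.down_rep x.rep_raw)) x.rep_raw
    (by simpa using x.ty.rep_raw) (.eqTm_refl x.wf)

@[simp] theorem Elt.down_up (x : Elt Γ) : x.up.down = x :=
  Elt.ext' (by simp) (Elt.down_rep (Elt.up_rep x.rep_raw)) x.rep_raw
    (by simpa using x.ty.rep_raw) (.eqTm_refl x.wf)

@[simp] theorem Elt.up_sub (x : Elt Δ) (δ : Γ ⟶ Δ) : x.up.sub (lk (𝟙 m) δ) = (x.sub δ).up :=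
  Elt.ext' (by simp) (Elt.sub_rep (Elt.up_rep x.rep_raw) (lk_rep (srep_raw δ)))
    (Elt.up_rep (Elt.sub_rep x.rep_raw (srep_raw δ)))
    (Typ.sub_rep (Typ.up_rep x.ty.rep_raw) (lk_rep (srep_raw δ)))
    (.eqTm_sub (eqSb_unlock δ) (.eqTm_refl (.tm_convCx (.eqCx_symm (eqCx_unlock Δ)) x.wf)))

@[simp] theorem Elt.down_sub (x : Elt (Δ.lock (𝟙 m))) (δ : Γ ⟶ Δ) :
    x.down.sub δ = (x.sub (lk (𝟙 m) δ)).down := by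
  rw [← Elt.down_up (x.down.sub δ), ← Elt.up_sub, Elt.up_down]

/-- The context `Γ.(𝟙 ∣ A)`, for a type `A` over `Γ` itself. -/
noncomputable def Con.ext1 (Γ : Con E m) (A : Typ Γ) : Con E m := Γ.ext A.up

/-- Weakening by an unannotated variable. -/
noncomputable def wk1 (A : Typ Γ) : Γ.ext1 A ⟶ Γ := wk A.up

/-- The last, unannotated variable. -/
noncomputable def var1 (A : Typ Γ) : Elt (Γ.ext1 A) := (var A.up).down

theorem wk1_rep (A : Typ Γ) : SRep (wk1 A) .wk := wk_rep _

theorem var1_rep (A : Typ Γ) : (var1 A).Rep .var := Elt.down_rep (var_rep _)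

@[simp] theorem var1_ty (A : Typ Γ) : (var1 A).ty = A.sub (wk1 A) := by
  simp [var1, wk1, Con.ext1]

/-- The substitution `(δ, a)` into `Δ.(𝟙 ∣ A)`. -/
noncomputable def cons1 {A : Typ Δ} (δ : Γ ⟶ Δ) (a : Elt Γ) (h : a.ty = A.sub δ) :
    Γ ⟶ Δ.ext1 A :=
  cons δ a.up (by simp [h])

theorem cons1_rep {A : Typ Δ} {δ : Γ ⟶ Δ} {a : Elt Γ} {h : a.ty = A.sub δ} {δ' a'}
    (hδ : SRep δ δ') (ha : a.Rep a') : SRep (cons1 δ a h) (.ext δ' a') :=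
  cons_rep hδ (Elt.up_rep ha)

section

variable {A : Typ Δ} (δ : Γ ⟶ Δ) (a : Elt Γ) (h : a.ty = A.sub δ)

@[simp] theorem cons1_wk1 : cons1 δ a h ≫ wk1 A = δ := cons_wk _ _ _

@[simp] theorem cons1_wk1_assoc (ξ : Δ ⟶ Ξ) : cons1 δ a h ≫ wk1 A ≫ ξ = δ ≫ ξ :=
  cons_wk_assoc _ _ _ _

@[simp] theorem var1_sub_cons1 : (var1 A).sub (cons1 δ a h) = a := by
  exact (Elt.down_sub _ _).trans
    ((congrArg Elt.down (var_sub_cons δ a.up (by simp [h]))).trans (Elt.down_up a))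

end

theorem cons1_hom_ext {A : Typ Δ} {δ ξ : Γ ⟶ Δ.ext1 A} (h : δ ≫ wk1 A = ξ ≫ wk1 A)
    (h' : (var1 A).sub δ = (var1 A).sub ξ) : δ = ξ := by
  apply cons_hom_ext h
  have h2 : ∀ ζ : Γ ⟶ Δ.ext1 A, ((var1 A).sub ζ).up = (var A.up).sub (lk (𝟙 m) ζ) := by
    intro ζ
    rw [← Elt.up_sub, var1]
    exact congrArg (fun x => Elt.sub x (lk (𝟙 m) ζ)) (Elt.up_down _)
  rw [← h2, ← h2, h']

@[simp] theorem comp_cons1 {A : Typ Ξ} (δ : Γ ⟶ Δ) (ξ : Δ ⟶ Ξ) (a : Elt Δ)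
    (h : a.ty = A.sub ξ) : δ ≫ cons1 ξ a h = cons1 (δ ≫ ξ) (a.sub δ) (by simp [h]) := by
  apply cons1_hom_ext
  · simp
  · rw [← Elt.sub_sub, var1_sub_cons1, var1_sub_cons1]

@[simp] theorem cons1_wk1_var1 (A : Typ Γ) (h) : cons1 (wk1 A) (var1 A) h = 𝟙 (Γ.ext1 A) := by
  apply cons1_hom_ext <;> simp

/-- The lift of a substitution to extended contexts. -/
noncomputable def up1 {A : Typ Δ} {A' : Typ Γ} (δ : Γ ⟶ Δ) (h : A.sub δ = A') :
    Γ.ext1 A' ⟶ Δ.ext1 A :=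
  cons1 (wk1 A' ≫ δ) (var1 A') (by simp [← h])

/-- The lift of a substitution to extended contexts. -/
noncomputable def upv {A : Typ (Δ.lock μ)} {A' : Typ (Γ.lock μ)} (δ : Γ ⟶ Δ)
    (h : A.sub (lk μ δ) = A') : Γ.ext A' ⟶ Δ.ext A :=
  cons (wk A' ≫ δ) (var A') (by simp [← h])

/-! ### The interval -/

/-- The context `Γ.𝕀`. -/
def Con.I (Γ : Con E m) : Con E m := ⟨Γ.raw.extI, .cx_extI Γ.wf⟩

/-- Weakening by a dimension. -/
noncomputable def wkI (Γ : Con E m) : Γ.I ⟶ Γ := smk (.sb_wkI Γ.wf)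

theorem wkI_rep : SRep (wkI Γ) .wkI := smk_rep _

/-- The last dimension variable. -/
noncomputable def ivar (Γ : Con E m) : Itv Γ.I := .mk .var (.dim_var Γ.wf)

theorem ivar_rep : (ivar Γ).Rep .var := EqJudg.Cls.mk_rep (J := dimJ _) _

/-- The endpoint `0`. -/
noncomputable def i0 : Itv Γ := .mk .zero (.dim_zero Γ.wf)

theorem i0_rep : (i0 : Itv Γ).Rep .zero := EqJudg.Cls.mk_rep (J := dimJ _) _

/-- The endpoint `1`. -/
noncomputable def i1 : Itv Γ := .mk .one (.dim_one Γ.wf)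

theorem i1_rep : (i1 : Itv Γ).Rep .one := EqJudg.Cls.mk_rep (J := dimJ _) _

/-- The minimum of two interval terms. -/
noncomputable def meet (r s : Itv Γ) : Itv Γ := .mk (r.raw.meet s.raw) (.dim_meet r.wf s.wf)

theorem meet_rep {r s : Itv Γ} {r' s'} (hr : r.Rep r') (hs : s.Rep s') :
    (meet r s).Rep (r'.meet s') :=
  .eqDim_trans (EqJudg.Cls.mk_rep (J := dimJ _) _) (.eqDim_meet hr hs)

@[simp] theorem i0_sub (δ : Γ ⟶ Δ) : (i0 : Itv Δ).sub δ = i0 :=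
  EqJudg.Cls.ext (Itv.sub_rep i0_rep (srep_raw δ)) i0_rep (.eqDim_subZero (swf δ))

@[simp] theorem i1_sub (δ : Γ ⟶ Δ) : (i1 : Itv Δ).sub δ = i1 :=
  EqJudg.Cls.ext (Itv.sub_rep i1_rep (srep_raw δ)) i1_rep (.eqDim_subOne (swf δ))

@[simp] theorem meet_sub (r s : Itv Δ) (δ : Γ ⟶ Δ) :
    (meet r s).sub δ = meet (r.sub δ) (s.sub δ) :=
  EqJudg.Cls.ext (Itv.sub_rep (meet_rep r.rep_raw s.rep_raw) (srep_raw δ))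
    (meet_rep (Itv.sub_rep r.rep_raw (srep_raw δ)) (Itv.sub_rep s.rep_raw (srep_raw δ)))
    (.eqDim_subMeet (swf δ) r.wf s.wf)

theorem meet_comm (r s : Itv Γ) : meet r s = meet s r :=
  EqJudg.Cls.ext (meet_rep r.rep_raw s.rep_raw) (meet_rep s.rep_raw r.rep_raw)
    (.eqDim_meetComm r.wf s.wf)

@[simp] theorem meet_i1 (r : Itv Γ) : meet r i1 = r :=
  EqJudg.Cls.ext (meet_rep r.rep_raw i1_rep) r.rep_raw (.eqDim_meetOne r.wf)

@[simp] theorem i0_meet (r : Itv Γ) : meet i0 r = i0 := by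
  have h0 := Der.dim_zero (E := E) Γ.wf
  -- absorption `0 ∧ (0 ∨ r) = 0`, where `0 ∨ r = r ∨ 0 = r`
  exact EqJudg.Cls.ext (meet_rep i0_rep r.rep_raw) i0_rep
    (.eqDim_trans (.eqDim_meet (.eqDim_refl h0) (.eqDim_symm
      (.eqDim_trans (.eqDim_joinComm h0 r.wf) (.eqDim_joinZero r.wf)))) (.eqDim_meetJoin h0 r.wf))

@[simp] theorem meet_i0 (r : Itv Γ) : meet r i0 = i0 := by rw [meet_comm, i0_meet]

@[simp] theorem i1_meet (r : Itv Γ) : meet i1 r = r := by rw [meet_comm, meet_i1]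

/-- The substitution `(δ, r)` into `Δ.𝕀`. -/
noncomputable def consI (δ : Γ ⟶ Δ) (r : Itv Γ) : Γ ⟶ Δ.I := smk (.sb_extI (swf δ) r.wf)

theorem consI_rep {δ : Γ ⟶ Δ} {r : Itv Γ} {δ' r'} (hδ : SRep δ δ') (hr : r.Rep r') :
    SRep (consI δ r) (.extI δ' r') :=
  .eqSb_trans (smk_rep _) (.eqSb_extI hδ hr)

@[simp] theorem consI_wkI (δ : Γ ⟶ Δ) (r : Itv Γ) : consI δ r ≫ wkI Δ = δ :=
  s_ext (comp_rep (consI_rep (srep_raw δ) r.rep_raw) wkI_rep) (srep_raw δ)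
    (.eqSb_extIBeta (swf δ) r.wf)

@[simp] theorem consI_wkI_assoc (δ : Γ ⟶ Δ) (r : Itv Γ) (ξ : Δ ⟶ Ξ) :
    consI δ r ≫ wkI Δ ≫ ξ = δ ≫ ξ := by
  rw [← Category.assoc, consI_wkI]

@[simp] theorem ivar_sub_consI (δ : Γ ⟶ Δ) (r : Itv Γ) : (ivar Δ).sub (consI δ r) = r :=
  EqJudg.Cls.ext (Itv.sub_rep ivar_rep (consI_rep (srep_raw δ) r.rep_raw)) r.rep_raw
    (.eqDim_extIBeta (swf δ) r.wf)

theorem consI_eta (δ : Γ ⟶ Δ.I) : δ = consI (δ ≫ wkI Δ) ((ivar Δ).sub δ) :=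
  s_ext (srep_raw δ) (consI_rep (comp_rep (srep_raw δ) wkI_rep)
    (Itv.sub_rep ivar_rep (srep_raw δ))) (.eqSb_extIEta Δ.wf (swf δ))

theorem consI_hom_ext {δ ξ : Γ ⟶ Δ.I} (h : δ ≫ wkI Δ = ξ ≫ wkI Δ)
    (h' : (ivar Δ).sub δ = (ivar Δ).sub ξ) : δ = ξ := by
  rw [consI_eta δ, consI_eta ξ, h, h']

@[simp] theorem comp_consI (δ : Γ ⟶ Δ) (ξ : Δ ⟶ Ξ) (r : Itv Δ) :
    δ ≫ consI ξ r = consI (δ ≫ ξ) (r.sub δ) := by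
  apply consI_hom_ext
  · simp
  · rw [← Itv.sub_sub, ivar_sub_consI, ivar_sub_consI]

@[simp] theorem consI_wkI_ivar : consI (wkI Γ) (ivar Γ) = 𝟙 Γ.I := by
  apply consI_hom_ext <;> simp

/-- The lift of a substitution to contexts with a dimension variable. -/
noncomputable abbrev upI (δ : Γ ⟶ Δ) : Γ.I ⟶ Δ.I := consI (wkI Γ ≫ δ) (ivar Γ)

/-- The instance at `r` of the last dimension variable. -/
noncomputable abbrev at_ (r : Itv Γ) : Γ ⟶ Γ.I := consI (𝟙 Γ) r

/-- The exchange `r^μ` of an interval term with a lock. -/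
noncomputable def exc (μ : n ⟶ m) (r : Itv Γ) : Itv (Γ.lock μ) :=
  .mk (.exc μ r.raw) (.dim_exc Γ.wf r.wf)

theorem exc_rep {r : Itv Γ} {r'} (hr : r.Rep r') : (exc μ r).Rep (.exc μ r') :=
  .eqDim_trans (EqJudg.Cls.mk_rep (J := dimJ _) _) (.eqDim_exc Γ.wf hr)

@[simp] theorem exc_i0 : exc μ (i0 : Itv Γ) = i0 :=
  EqJudg.Cls.ext (exc_rep i0_rep) i0_rep (.eqDim_excZero Γ.wf)

@[simp] theorem exc_i1 : exc μ (i1 : Itv Γ) = i1 :=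
  EqJudg.Cls.ext (exc_rep i1_rep) i1_rep (.eqDim_excOne Γ.wf)

@[simp] theorem exc_sub (r : Itv Δ) (δ : Γ ⟶ Δ) :
    (exc μ r).sub (lk μ δ) = exc μ (r.sub δ) :=
  EqJudg.Cls.ext (Itv.sub_rep (exc_rep r.rep_raw) (lk_rep (srep_raw δ)))
    (exc_rep (Itv.sub_rep r.rep_raw (srep_raw δ))) (.eqDim_excSub Δ.wf (swf δ) r.wf)

end

variable {μ : n ⟶ m} {Γ Δ Ξ : Con E m}

/-! ### Modal types -/

/-- The modal type `⟨μ ∣ A⟩`. -/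
noncomputable def Mod (μ : n ⟶ m) (A : Typ (Γ.lock μ)) : Typ Γ :=
  .mk (.mod μ A.raw) (.ty_mod Γ.wf A.wf)

theorem Mod_rep {A : Typ (Γ.lock μ)} {A'} (h : A.Rep A') : (Mod μ A).Rep (.mod μ A') :=
  .eqTy_trans (EqJudg.Cls.mk_rep (J := tyJ _) _) (.eqTy_mod Γ.wf h)

@[simp] theorem Mod_sub (A : Typ (Δ.lock μ)) (δ : Γ ⟶ Δ) :
    (Mod μ A).sub δ = Mod μ (A.sub (lk μ δ)) :=
  EqJudg.Cls.ext (Typ.sub_rep (Mod_rep A.rep_raw) (srep_raw δ))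
    (Mod_rep (Typ.sub_rep A.rep_raw (lk_rep (srep_raw δ)))) (.eqTy_subMod (swf δ) A.wf)

/-- The introduction form `mod_μ a`. -/
noncomputable def mod (μ : n ⟶ m) (a : Elt (Γ.lock μ)) : Elt Γ :=
  .mk' (Mod μ a.ty) (Mod_rep a.ty.rep_raw) (.tm_mod Γ.wf a.ty.wf a.wf)

@[simp] theorem mod_ty (a : Elt (Γ.lock μ)) : (mod μ a).ty = Mod μ a.ty := (rfl)

theorem mod_rep {a : Elt (Γ.lock μ)} {a'} (h : a.Rep a') : (mod μ a).Rep (.mod μ a') :=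
  .eqTm_trans (Elt.mk'_rep _ _) (.eqTm_conv (.eqTy_symm (Mod_rep a.ty.rep_raw))
    (.eqTm_mod Γ.wf a.ty.wf h))

@[simp] theorem mod_sub (a : Elt (Δ.lock μ)) (δ : Γ ⟶ Δ) :
    (mod μ a).sub δ = mod μ (a.sub (lk μ δ)) :=
  Elt.ext' (by simp) (Elt.sub_rep (mod_rep a.rep_raw) (srep_raw δ))
    (mod_rep (Elt.sub_rep a.rep_raw (lk_rep (srep_raw δ))))
    (Typ.sub_rep (Mod_rep a.ty.rep_raw) (srep_raw δ)) (.eqTm_subMod Δ.wf (swf δ) a.ty.wf a.wf)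

/-! ### Path types -/

/-- The raw rules allow paths over a line of types; here the line is constant, and this lemma
provides the representatives of its fibres. -/
theorem Typ.rep_wkI_at {A : Typ Γ} {A'} (h : A.Rep A') {r : Itv Γ} {r'} (hr : r.Rep r') :
    A.Rep ((A'.sub .wkI).sub (.instI r')) := by
  simpa using Typ.sub_rep (Typ.sub_rep h wkI_rep) (consI_rep id_rep hr)

theorem ty_sub_eq {a b : Elt Δ} (h : b.ty = a.ty) (δ : Γ ⟶ Δ) : (b.sub δ).ty = (a.sub δ).ty :=
  congrArg (fun A => Typ.sub A δ) h

/-- The type of paths between `a` and `b`. -/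
noncomputable def Path (a b : Elt Γ) (h : b.ty = a.ty) : Typ Γ :=
  .mk (.cpath a.ty.raw a.raw b.raw) (.ty_path Γ.wf (.ty_sub (.sb_wkI Γ.wf) a.ty.wf)
    (Elt.wf_of rfl (Typ.rep_wkI_at a.ty.rep_raw i0_rep))
    (Elt.wf_of h (Typ.rep_wkI_at a.ty.rep_raw i1_rep)))

theorem Path_rep {a b : Elt Γ} {h : b.ty = a.ty} {A' a' b'} (hA : a.ty.Rep A') (ha : a.Rep a')
    (hb : b.Rep b') : (Path a b h).Rep (.cpath A' a' b') :=
  .eqTy_trans (EqJudg.Cls.mk_rep (J := tyJ _) _) (.eqTy_path Γ.wf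
    (.eqTy_sub (.eqSb_refl (.sb_wkI Γ.wf)) hA)
    (Elt.rep_of ha rfl (Typ.rep_wkI_at a.ty.rep_raw i0_rep))
    (Elt.rep_of hb h (Typ.rep_wkI_at a.ty.rep_raw i1_rep)))

@[simp] theorem Path_sub (a b : Elt Δ) (h : b.ty = a.ty) (δ : Γ ⟶ Δ) :
    (Path a b h).sub δ = Path (a.sub δ) (b.sub δ) (ty_sub_eq h δ) := by
  refine EqJudg.Cls.ext (Typ.sub_rep (Path_rep a.ty.rep_raw a.rep_raw b.rep_raw) (srep_raw δ))
    (Path_rep (Typ.sub_rep a.ty.rep_raw (srep_raw δ)) (Elt.sub_rep a.rep_raw (srep_raw δ))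
      (Elt.sub_rep b.rep_raw (srep_raw δ)))
    (.eqTy_trans (.eqTy_subPath (swf δ) (.ty_sub (.sb_wkI Δ.wf) a.ty.wf)
    (Elt.wf_of rfl (Typ.rep_wkI_at a.ty.rep_raw i0_rep))
    (Elt.wf_of h (Typ.rep_wkI_at a.ty.rep_raw i1_rep))) ?_)
  -- both families of types represent `A[δ][wkI]`
  have h1 : ((a.ty.sub δ).sub (wkI Γ)).Rep (((a.ty.raw.sub .wkI).sub (.upI (sraw δ)))) := by
    have := Typ.sub_rep (Typ.sub_rep a.ty.rep_raw wkI_rep)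
      (consI_rep (comp_rep wkI_rep (srep_raw δ)) ivar_rep)
    simpa using this
  have h2 : ((a.ty.sub δ).sub (wkI Γ)).Rep ((a.ty.raw.sub (sraw δ)).sub .wkI) :=
    Typ.sub_rep (Typ.sub_rep a.ty.rep_raw (srep_raw δ)) wkI_rep
  have h3 (r : Itv Γ) : (a.ty.sub δ).Rep
      (((a.ty.raw.sub .wkI).sub (.upI (sraw δ))).sub (.instI r.raw)) := by
    have := Typ.sub_rep (Typ.sub_rep (Typ.sub_rep a.ty.rep_raw wkI_rep)
      (consI_rep (comp_rep wkI_rep (srep_raw δ)) ivar_rep)) (consI_rep id_rep r.rep_raw)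
    simpa using this
  have h4 {r : Itv Γ} {r'} (hr : r.Rep r') : (a.ty.sub δ).Rep
      (((a.ty.raw.sub .wkI).sub (.upI (sraw δ))).sub (.instI r')) := by
    have := Typ.sub_rep (Typ.sub_rep (Typ.sub_rep a.ty.rep_raw wkI_rep)
      (consI_rep (comp_rep wkI_rep (srep_raw δ)) ivar_rep)) (consI_rep id_rep hr)
    simpa using this
  refine .eqTy_path Γ.wf (.eqTy_trans (.eqTy_symm h1) h2) ?_ ?_
  · exact .eqTm_refl (.tm_conv (.eqTy_trans (.eqTy_symm (Typ.sub_rep a.ty.rep_raw (srep_raw δ)))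
      (h4 i0_rep)) (.tm_sub (swf δ) a.wf))
  · exact .eqTm_refl (.tm_conv (.eqTy_trans (.eqTy_symm (Typ.sub_rep a.ty.rep_raw (srep_raw δ)))
      (h4 i1_rep)) (.tm_sub (swf δ) (Elt.wf_of h a.ty.rep_raw)))

theorem ty_const {a : Elt Γ.I} {A : Typ Γ} (h : a.ty = A.sub (wkI Γ)) :
    a.ty = (a.ty.sub (at_ i0)).sub (wkI Γ) := by
  simp [h]

theorem at_ty {a : Elt Γ.I} (h : a.ty = (a.ty.sub (at_ i0)).sub (wkI Γ)) (r : Itv Γ) :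
    (a.sub (at_ r)).ty = (a.sub (at_ i0)).ty := by
  have := congrArg (fun A => Typ.sub A (at_ r)) h
  simpa using this

/-- Path abstraction. -/
noncomputable def plam (a : Elt Γ.I) (h : a.ty = (a.ty.sub (at_ i0)).sub (wkI Γ)) : Elt Γ :=
  .mk' (Path (a.sub (at_ i0)) (a.sub (at_ i1)) (at_ty h i1))
    (Path_rep (a.ty.sub (at_ i0)).rep_raw
      (Elt.sub_rep a.rep_raw (consI_rep id_rep i0_rep))
      (Elt.sub_rep a.rep_raw (consI_rep id_rep i1_rep)))
    (.tm_plam Γ.wf (.ty_sub (.sb_wkI Γ.wf) (a.ty.sub (at_ i0)).wf)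
      (Elt.wf_of h (Typ.sub_rep (a.ty.sub (at_ i0)).rep_raw wkI_rep)))

@[simp] theorem plam_ty (a : Elt Γ.I) (h : a.ty = (a.ty.sub (at_ i0)).sub (wkI Γ)) :
    (plam a h).ty = Path (a.sub (at_ i0)) (a.sub (at_ i1)) (at_ty h i1) := (rfl)

theorem plam_rep {a : Elt Γ.I} {h : a.ty = (a.ty.sub (at_ i0)).sub (wkI Γ)} {a'} (ha : a.Rep a') :
    (plam a h).Rep (.plam a') :=
  .eqTm_trans (Elt.mk'_rep _ _) (.eqTm_conv
    (.eqTy_symm (Path_rep (h := at_ty h i1) (a.ty.sub (at_ i0)).rep_raw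
      (Elt.sub_rep a.rep_raw (consI_rep id_rep i0_rep))
      (Elt.sub_rep a.rep_raw (consI_rep id_rep i1_rep))))
    (.eqTm_plam Γ.wf (.ty_sub (.sb_wkI Γ.wf) (a.ty.sub (at_ i0)).wf)
      (Elt.rep_of ha h (Typ.sub_rep (a.ty.sub (at_ i0)).rep_raw wkI_rep))))

theorem ty_const_sub {a : Elt Δ.I} (h : a.ty = (a.ty.sub (at_ i0)).sub (wkI Δ)) (δ : Γ ⟶ Δ) :
    (a.sub (upI δ)).ty = ((a.sub (upI δ)).ty.sub (at_ i0)).sub (wkI Γ) := by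
  apply ty_const (A := (a.ty.sub (at_ i0)).sub δ)
  have := congrArg (fun A => Typ.sub A (upI δ)) h
  simpa using this

@[simp] theorem plam_sub (a : Elt Δ.I) (h : a.ty = (a.ty.sub (at_ i0)).sub (wkI Δ)) (δ : Γ ⟶ Δ) :
    (plam a h).sub δ = plam (a.sub (upI δ)) (ty_const_sub h δ) :=
  Elt.ext' (by simp) (Elt.sub_rep (plam_rep a.rep_raw) (srep_raw δ))
    (plam_rep (Elt.sub_rep a.rep_raw (consI_rep (comp_rep wkI_rep (srep_raw δ)) ivar_rep)))
    (Typ.sub_rep (Path_rep (h := at_ty h i1) (a.ty.sub (at_ i0)).rep_raw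
      (Elt.sub_rep a.rep_raw (consI_rep id_rep i0_rep))
      (Elt.sub_rep a.rep_raw (consI_rep id_rep i1_rep))) (srep_raw δ))
    (.eqTm_subPlam Δ.wf (swf δ) (.ty_sub (.sb_wkI Δ.wf) (a.ty.sub (at_ i0)).wf)
      (Elt.wf_of h (Typ.sub_rep (a.ty.sub (at_ i0)).rep_raw wkI_rep)))

section

variable {a b : Elt Γ} {hab : b.ty = a.ty} (p : Elt Γ) (hp : p.ty = Path a b hab)

/-- Path application. -/
noncomputable def papp (r : Itv Γ) : Elt Γ :=
  .mk' a.ty (Typ.rep_wkI_at a.ty.rep_raw r.rep_raw)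
    (.tm_papp (.ty_sub (.sb_wkI Γ.wf) a.ty.wf)
      (Elt.wf_of rfl (Typ.rep_wkI_at a.ty.rep_raw i0_rep))
      (Elt.wf_of hab (Typ.rep_wkI_at a.ty.rep_raw i1_rep))
      (Elt.wf_of hp (Path_rep a.ty.rep_raw a.rep_raw b.rep_raw)) r.wf)

@[simp] theorem papp_ty (r : Itv Γ) : (papp p hp r).ty = a.ty := (rfl)

variable {p} in
theorem papp_rep {r : Itv Γ} {p' r'} (h : p.Rep p') (hr : r.Rep r') :
    (papp p hp r).Rep (.papp p' r') :=
  .eqTm_trans (Elt.mk'_rep _ _) (.eqTm_conv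
    (.eqTy_symm (Typ.rep_wkI_at a.ty.rep_raw r.rep_raw))
    (.eqTm_papp (.ty_sub (.sb_wkI Γ.wf) a.ty.wf)
      (Elt.wf_of rfl (Typ.rep_wkI_at a.ty.rep_raw i0_rep))
      (Elt.wf_of hab (Typ.rep_wkI_at a.ty.rep_raw i1_rep))
      (Elt.rep_of h hp (Path_rep a.ty.rep_raw a.rep_raw b.rep_raw)) hr))

@[simp] theorem papp_i0 : papp p hp i0 = a :=
  Elt.ext' rfl (papp_rep hp p.rep_raw i0_rep) a.rep_raw
    (Typ.rep_wkI_at a.ty.rep_raw i0_rep)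
    (.eqTm_pathZero (.ty_sub (.sb_wkI Γ.wf) a.ty.wf)
      (Elt.wf_of rfl (Typ.rep_wkI_at a.ty.rep_raw i0_rep))
      (Elt.wf_of hab (Typ.rep_wkI_at a.ty.rep_raw i1_rep))
      (Elt.wf_of hp (Path_rep a.ty.rep_raw a.rep_raw b.rep_raw)))

@[simp] theorem papp_i1 : papp p hp i1 = b :=
  Elt.ext' hab.symm (papp_rep hp p.rep_raw i1_rep) b.rep_raw
    (Typ.rep_wkI_at a.ty.rep_raw i1_rep)
    (.eqTm_pathOne (.ty_sub (.sb_wkI Γ.wf) a.ty.wf)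
      (Elt.wf_of rfl (Typ.rep_wkI_at a.ty.rep_raw i0_rep))
      (Elt.wf_of hab (Typ.rep_wkI_at a.ty.rep_raw i1_rep))
      (Elt.wf_of hp (Path_rep a.ty.rep_raw a.rep_raw b.rep_raw)))

end

theorem path_ty_sub {a b : Elt Δ} {hab : b.ty = a.ty} {p : Elt Δ} (hp : p.ty = Path a b hab)
    (δ : Γ ⟶ Δ) : (p.sub δ).ty = Path (a.sub δ) (b.sub δ) (ty_sub_eq hab δ) := by
  simp [hp]

@[simp] theorem papp_sub {a b : Elt Δ} {hab : b.ty = a.ty} (p : Elt Δ) (hp : p.ty = Path a b hab)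
    (r : Itv Δ) (δ : Γ ⟶ Δ) : (papp p hp r).sub δ =
      papp (p.sub δ) (path_ty_sub hp δ) (r.sub δ) :=
  Elt.ext' (by simp) (Elt.sub_rep (papp_rep hp p.rep_raw r.rep_raw) (srep_raw δ))
    (papp_rep _ (Elt.sub_rep p.rep_raw (srep_raw δ)) (Itv.sub_rep r.rep_raw (srep_raw δ)))
    (Typ.sub_rep (Typ.rep_wkI_at a.ty.rep_raw r.rep_raw) (srep_raw δ))
    (.eqTm_subPapp (swf δ) (.ty_sub (.sb_wkI Δ.wf) a.ty.wf)
      (Elt.wf_of rfl (Typ.rep_wkI_at a.ty.rep_raw i0_rep))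
      (Elt.wf_of hab (Typ.rep_wkI_at a.ty.rep_raw i1_rep))
      (Elt.wf_of hp (Path_rep a.ty.rep_raw a.rep_raw b.rep_raw)) r.wf)

/-- The computation rule of paths. The endpoints `a` and `b` need only have the right type, as `hp`
determines them only up to an equality of path types. -/
theorem papp_plam {a b : Elt Γ} {hab : b.ty = a.ty} (c : Elt Γ.I)
    (h : c.ty = (c.ty.sub (at_ i0)).sub (wkI Γ)) (hp : (plam c h).ty = Path a b hab)
    (ha : a.ty = c.ty.sub (at_ i0)) (r : Itv Γ) : papp (plam c h) hp r = c.sub (at_ r) :=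
  Elt.ext' (ha.trans (at_ty h r).symm) (papp_rep hp (plam_rep c.rep_raw) r.rep_raw)
    (Elt.sub_rep c.rep_raw (consI_rep id_rep r.rep_raw))
    (by simpa [ha] using Typ.rep_wkI_at (c.ty.sub (at_ i0)).rep_raw r.rep_raw)
    (.eqTm_pathBeta Γ.wf (.ty_sub (.sb_wkI Γ.wf) (c.ty.sub (at_ i0)).wf)
      (Elt.wf_of h (Typ.sub_rep (c.ty.sub (at_ i0)).rep_raw wkI_rep)) r.wf)

/-- The uniqueness rule of paths. -/
theorem plam_papp {a b : Elt Γ} {hab : b.ty = a.ty} (p : Elt Γ) (hp : p.ty = Path a b hab)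
    {hab' : (b.sub (wkI Γ)).ty = (a.sub (wkI Γ)).ty}
    (hp' : (p.sub (wkI Γ)).ty = Path (a.sub (wkI Γ)) (b.sub (wkI Γ)) hab')
    (h : (papp (p.sub (wkI Γ)) hp' (ivar Γ)).ty =
      ((papp (p.sub (wkI Γ)) hp' (ivar Γ)).ty.sub (at_ i0)).sub (wkI Γ)) :
    plam (papp (p.sub (wkI Γ)) hp' (ivar Γ)) h = p := by
  refine Eq.symm (Elt.ext' (by simp [hp]) p.rep_raw
    (plam_rep (papp_rep _ (Elt.sub_rep p.rep_raw wkI_rep) ivar_rep))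
    (by rw [hp]; exact Path_rep a.ty.rep_raw a.rep_raw b.rep_raw)
    (.eqTm_pathEta Γ.wf (.ty_sub (.sb_wkI Γ.wf) a.ty.wf)
      (Elt.wf_of rfl (Typ.rep_wkI_at a.ty.rep_raw i0_rep))
      (Elt.wf_of hab (Typ.rep_wkI_at a.ty.rep_raw i1_rep))
      (Elt.wf_of hp (Path_rep a.ty.rep_raw a.rep_raw b.rep_raw))))

/-! ### Dependent functions and pairs -/

/-- The substitution `(id, a)`. -/
noncomputable def inst1 {A : Typ Γ} (a : Elt Γ) (h : a.ty = A) : Γ ⟶ Γ.ext1 A :=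
  cons1 (𝟙 Γ) a (by simp [h])

theorem inst1_rep {A : Typ Γ} {a : Elt Γ} {h : a.ty = A} {a'} (ha : a.Rep a') :
    SRep (inst1 a h) (.inst a') :=
  cons1_rep id_rep ha

@[simp] theorem inst1_wk1 {A : Typ Γ} (a : Elt Γ) (h : a.ty = A) : inst1 a h ≫ wk1 A = 𝟙 Γ := by
  simp [inst1]

@[simp] theorem var1_sub_inst1 {A : Typ Γ} (a : Elt Γ) (h : a.ty = A) :
    (var1 A).sub (inst1 a h) = a := by
  simp [inst1]

@[simp] theorem var1_sub_comp_inst1 {A : Typ Γ} (a : Elt Γ) (h : a.ty = A) (δ : Δ ⟶ Γ) :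
    (var1 A).sub (δ ≫ inst1 a h) = a.sub δ := by
  rw [← Elt.sub_sub, var1_sub_inst1]

/-- The type of dependent functions with unannotated argument. -/
noncomputable def Pi (A : Typ Γ) (B : Typ (Γ.ext1 A)) : Typ Γ :=
  .mk (.pi (𝟙 m) A.up.raw B.raw) (.ty_pi A.up.wf B.wf)

theorem Pi_rep {A : Typ Γ} {B : Typ (Γ.ext1 A)} {A' B'} (hA : A.Rep A') (hB : B.Rep B') :
    (Pi A B).Rep (.pi (𝟙 m) A' B') :=
  .eqTy_trans (EqJudg.Cls.mk_rep (J := tyJ _) _) (.eqTy_pi (Typ.up_rep hA) hB)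

/-- The type of dependent pairs. -/
noncomputable def Sigma (A : Typ Γ) (B : Typ (Γ.ext1 A)) : Typ Γ :=
  .mk (.sigma A.up.raw B.raw) (.ty_sigma (.ty_conv (eqCx_unlock Γ) A.up.wf) B.wf)

theorem Typ.rep_up_raw (A : Typ Γ) : A.Rep A.up.raw := by
  simpa using Typ.down_rep A.up.rep_raw

theorem Sigma_rep {A : Typ Γ} {B : Typ (Γ.ext1 A)} {A' B'} (hA : A.Rep A') (hB : B.Rep B') :
    (Sigma A B).Rep (.sigma A' B') :=
  .eqTy_trans (EqJudg.Cls.mk_rep (J := tyJ _) _)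
    (.eqTy_sigma (.eqTy_trans (.eqTy_symm A.rep_up_raw) hA) hB)

theorem up1_rep {A : Typ Δ} {A' : Typ Γ} {δ : Γ ⟶ Δ} {h : A.sub δ = A'} {δ'} (hδ : SRep δ δ') :
    SRep (up1 δ h) (.up m δ') :=
  cons1_rep (comp_rep (wk1_rep _) hδ) (var1_rep _)

section

variable {A : Typ Δ} {B : Typ (Δ.ext1 A)} {A' : Typ Γ} (δ : Γ ⟶ Δ) (h : A.sub δ = A')

theorem Pi_sub : (Pi A B).sub δ = Pi A' (B.sub (up1 δ h)) := by
  refine EqJudg.Cls.ext (Typ.sub_rep (Pi_rep A.rep_up_raw B.rep_raw) (srep_raw δ))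
    (Pi_rep (A' := A.up.raw.sub (.lock (𝟙 m) (sraw δ))) ?_
      (Typ.sub_rep B.rep_raw (up1_rep (srep_raw δ)))) (.eqTy_subPi (swf δ) A.up.wf B.wf)
  have := Typ.down_rep (Typ.sub_rep A.up.rep_raw (lk_rep (μ := 𝟙 m) (srep_raw δ)))
  rw [Typ.up_sub, Typ.down_up, h] at this
  exact this

theorem Sigma_sub : (Sigma A B).sub δ = Sigma A' (B.sub (up1 δ h)) := by
  subst h
  exact EqJudg.Cls.ext (Typ.sub_rep (Sigma_rep A.rep_up_raw B.rep_raw) (srep_raw δ))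
    (Sigma_rep (Typ.sub_rep A.rep_up_raw (srep_raw δ))
      (Typ.sub_rep B.rep_raw (up1_rep (srep_raw δ))))
    (.eqTy_subSigma (swf δ) (.ty_conv (eqCx_unlock Δ) A.up.wf) B.wf)

end

/-- Abstraction. -/
noncomputable def lam {A : Typ Γ} (b : Elt (Γ.ext1 A)) : Elt Γ :=
  .mk' (Pi A b.ty) (Pi_rep A.rep_up_raw b.ty.rep_raw) (.tm_lam A.up.wf b.ty.wf b.wf)

@[simp] theorem lam_ty {A : Typ Γ} (b : Elt (Γ.ext1 A)) : (lam b).ty = Pi A b.ty := (rfl)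

theorem lam_rep {A : Typ Γ} {b : Elt (Γ.ext1 A)} {b'} (hb : b.Rep b') : (lam b).Rep (.lam b') :=
  .eqTm_trans (Elt.mk'_rep _ _) (.eqTm_conv
    (.eqTy_symm (Pi_rep A.rep_up_raw b.ty.rep_raw)) (.eqTm_lam A.up.wf b.ty.wf hb))

theorem lam_sub {A : Typ Δ} (b : Elt (Δ.ext1 A)) {A' : Typ Γ} (δ : Γ ⟶ Δ) (h : A.sub δ = A') :
    (lam b).sub δ = lam (b.sub (up1 δ h)) :=
  Elt.ext' (by simp [Pi_sub δ h]) (Elt.sub_rep (lam_rep b.rep_raw) (srep_raw δ))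
    (lam_rep (Elt.sub_rep b.rep_raw (up1_rep (srep_raw δ))))
    (Typ.sub_rep (Pi_rep A.rep_up_raw b.ty.rep_raw) (srep_raw δ))
    (.eqTm_subLam (swf δ) A.up.wf b.ty.wf b.wf)

theorem Elt.rep_up_raw (x : Elt Γ) : x.Rep x.up.raw := by
  simpa using Elt.down_rep x.up.rep_raw

theorem Elt.wf_up {A : Typ Γ} (x : Elt Γ) (hx : x.ty = A) :
    Der E (.tm (Γ.raw.lock (𝟙 m)) A.up.raw x.up.raw) :=
  Elt.wf_of (congrArg Typ.up hx) A.up.rep_raw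

/-- The type of non-dependent functions. -/
noncomputable def arr (A B : Typ Γ) : Typ Γ := Pi A (B.sub (wk1 A))

theorem arr_rep {A B : Typ Γ} {A' B'} (hA : A.Rep A') (hB : B.Rep B') :
    (arr A B).Rep (.arr A' B') :=
  Pi_rep hA (Typ.sub_rep hB (wk1_rep A))

@[simp] theorem arr_sub (A B : Typ Δ) (δ : Γ ⟶ Δ) : (arr A B).sub δ = arr (A.sub δ) (B.sub δ) := by
  simp [arr, Pi_sub δ rfl, up1]

theorem Typ.rep_inst1 {A B : Typ Γ} {x : Elt Γ} (hx : x.ty = A) {x'} (hx' : x.Rep x') :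
    B.Rep ((B.sub (wk1 A)).raw.sub (.inst x')) := by
  simpa [inst1] using Typ.sub_rep (B.sub (wk1 A)).rep_raw (inst1_rep (h := hx) hx')

section

variable {A B : Typ Γ} (f x : Elt Γ) (hf : f.ty = arr A B) (hx : x.ty = A)

/-- Application of non-dependent functions. -/
noncomputable def ap : Elt Γ :=
  .mk' B (Typ.rep_inst1 hx x.rep_up_raw) (.tm_app A.up.wf (B.sub (wk1 A)).wf
    (Elt.wf_of hf (Pi_rep A.rep_up_raw (B.sub (wk1 A)).rep_raw)) (x.wf_up hx))

@[simp] theorem ap_ty : (ap f x hf hx).ty = B := (rfl)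

variable {f x} in
theorem ap_rep {f' x'} (hf' : f.Rep f') (hx' : x.Rep x') :
    (ap f x hf hx).Rep (.app f' x') :=
  .eqTm_trans (Elt.mk'_rep _ _) (.eqTm_conv (.eqTy_symm (Typ.rep_inst1 hx x.rep_up_raw))
    (.eqTm_app A.up.wf (B.sub (wk1 A)).wf
      (Elt.rep_of hf' hf (Pi_rep A.rep_up_raw (B.sub (wk1 A)).rep_raw))
      (Elt.rep_of (x := x.up) (.eqTm_trans (Elt.rep_raw _) (Elt.up_rep hx'))
        (congrArg Typ.up hx) A.up.rep_raw)))

end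

theorem arr_ty_sub {A B : Typ Δ} {f : Elt Δ} (hf : f.ty = arr A B) (δ : Γ ⟶ Δ) :
    (f.sub δ).ty = arr (A.sub δ) (B.sub δ) := by
  simp [hf]

theorem Elt.ty_sub {A : Typ Δ} {x : Elt Δ} (hx : x.ty = A) (δ : Γ ⟶ Δ) :
    (x.sub δ).ty = A.sub δ := by
  simp [hx]

@[simp] theorem ap_sub {A B : Typ Δ} (f x : Elt Δ) (hf : f.ty = arr A B) (hx : x.ty = A)
    (δ : Γ ⟶ Δ) : (ap f x hf hx).sub δ =
      ap (f.sub δ) (x.sub δ) (arr_ty_sub hf δ) (Elt.ty_sub hx δ) := by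
  refine Elt.ext' (by simp) (Elt.sub_rep (ap_rep hf hx f.rep_raw x.rep_up_raw) (srep_raw δ))
    (ap_rep _ _ (Elt.sub_rep f.rep_raw (srep_raw δ)) ?_)
    (Typ.sub_rep (Typ.rep_inst1 hx x.rep_up_raw) (srep_raw δ))
    (.eqTm_subApp (swf δ) A.up.wf (B.sub (wk1 A)).wf
      (Elt.wf_of hf (Pi_rep A.rep_up_raw (B.sub (wk1 A)).rep_raw)) (x.wf_up hx))
  have := Elt.down_rep (Elt.sub_rep x.up.rep_raw (lk_rep (μ := 𝟙 m) (srep_raw δ)))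
  rw [Elt.up_sub, Elt.down_up] at this
  exact this

theorem ap_congr {A B A' B' : Typ Γ} {f x f' x' : Elt Γ} (hf : f.ty = arr A B) (hx : x.ty = A)
    (hf' : f'.ty = arr A' B') (hx' : x'.ty = A') (h₁ : f = f') (h₂ : x = x') (hB : B = B') :
    ap f x hf hx = ap f' x' hf' hx' := by
  subst h₁ h₂ hB hx hx'
  rfl

/-- The computation rule of functions. The codomain `B` of the arrow need only have the right
value at the argument. -/
theorem ap_lam {A B : Typ Γ} (b : Elt (Γ.ext1 A)) (x : Elt Γ) (hf : (lam b).ty = arr A B)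
    (hx : x.ty = A) (hB : b.ty.sub (inst1 x hx) = B) :
    ap (lam b) x hf hx = b.sub (inst1 x hx) :=
  Elt.ext' (by simp [hB]) (ap_rep hf hx (lam_rep b.rep_raw) x.rep_up_raw)
    (Elt.sub_rep b.rep_raw (inst1_rep x.rep_up_raw))
    (by rw [ap_ty, ← hB]; exact Typ.sub_rep b.ty.rep_raw (inst1_rep x.rep_up_raw))
    (.eqTm_piBeta A.up.wf b.ty.wf (x.wf_up hx) b.wf)

theorem ap_lam_sub {A : Typ Δ} {A' B' : Typ Γ} (b : Elt (Δ.ext1 A)) (δ : Γ ⟶ Δ) (x : Elt Γ)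
    (hf : ((lam b).sub δ).ty = arr A' B') (hx : x.ty = A') (h : x.ty = A.sub δ)
    (hB : (b.sub (cons1 δ x h)).ty = B') :
    ap ((lam b).sub δ) x hf hx = b.sub (cons1 δ x h) := by
  obtain rfl : A' = A.sub δ := hx.symm.trans h
  simp only [lam_sub b δ rfl]
  rw [ap_lam]
  · simp [inst1, up1]
  · simpa [inst1, up1] using hB

/-- Pairing. -/
noncomputable def pair {A : Typ Γ} (B : Typ (Γ.ext1 A)) (x y : Elt Γ) (hx : x.ty = A)
    (hy : y.ty = B.sub (inst1 x hx)) : Elt Γ :=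
  .mk' (Sigma A B) (Sigma_rep A.rep_up_raw B.rep_raw)
    (.tm_pair (.ty_conv (eqCx_unlock Γ) A.up.wf) B.wf (Elt.wf_of hx A.rep_up_raw)
      (Elt.wf_of hy (Typ.sub_rep B.rep_raw (inst1_rep x.rep_raw))))

/-! ### The universe -/

/-- The universe. -/
noncomputable def UU (Γ : Con E m) : Typ Γ := .mk .U (.ty_U Γ.wf)

theorem UU_rep : (UU Γ).Rep .U := EqJudg.Cls.mk_rep (J := tyJ _) _

@[simp] theorem UU_sub (δ : Γ ⟶ Δ) : (UU Δ).sub δ = UU Γ :=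
  EqJudg.Cls.ext (Typ.sub_rep UU_rep (srep_raw δ)) UU_rep (.eqTy_subU (swf δ))

/-- The type of elements of a code. -/
noncomputable def El (c : Elt Γ) (h : c.ty = UU Γ) : Typ Γ :=
  .mk (.el c.raw) (.ty_lift (.ty_el (Elt.wf_of h UU_rep)))

theorem El_rep {c : Elt Γ} (h : c.ty = UU Γ) {c'} (hc : c.Rep c') : (El c h).Rep (.el c') :=
  .eqTy_trans (EqJudg.Cls.mk_rep (J := tyJ _) _)
    (.eqTy_lift (.eqTy_el (Elt.rep_of hc h UU_rep)))

@[simp] theorem El_sub (c : Elt Δ) (h : c.ty = UU Δ) (δ : Γ ⟶ Δ) :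
    (El c h).sub δ = El (c.sub δ) (by simp [h]) :=
  EqJudg.Cls.ext (Typ.sub_rep (El_rep h c.rep_raw) (srep_raw δ))
    (El_rep _ (Elt.sub_rep c.rep_raw (srep_raw δ)))
    (.eqTy_lift (.eqTy_subEl (swf δ) (Elt.wf_of h UU_rep)))

/-- A type is small if it is equal to a small raw type. -/
def Typ.Small (A : Typ Γ) : Prop := ∃ A', A.Rep A' ∧ Der E (.ty Γ.raw .small A')

theorem Typ.Small.sub {A : Typ Δ} (h : A.Small) (δ : Γ ⟶ Δ) : (A.sub δ).Small :=
  let ⟨_, h₁, h₂⟩ := h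
  ⟨_, Typ.sub_rep h₁ (srep_raw δ), .ty_sub (swf δ) h₂⟩

theorem Typ.Small.mod {A : Typ (Γ.lock μ)} (h : A.Small) : (Mod μ A).Small :=
  let ⟨_, h₁, h₂⟩ := h
  ⟨_, Mod_rep h₁, .ty_mod Γ.wf h₂⟩

theorem Typ.Small.path {a b : Elt Γ} (h : b.ty = a.ty) (hA : a.ty.Small) : (Path a b h).Small :=
  let ⟨_, h₁, h₂⟩ := hA
  ⟨_, Path_rep h₁ a.rep_raw b.rep_raw, .ty_path Γ.wf (.ty_sub (.sb_wkI Γ.wf) h₂)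
    (Elt.wf_of rfl (Typ.rep_wkI_at h₁ i0_rep)) (Elt.wf_of h (Typ.rep_wkI_at h₁ i1_rep))⟩

/-- Every small type has a code. -/
theorem Typ.Small.exists_code {A : Typ Γ} (h : A.Small) :
    ∃ (c : Elt Γ) (hc : c.ty = UU Γ), El c hc = A :=
  let ⟨_, h₁, h₂⟩ := h
  ⟨.mk' (UU Γ) UU_rep (.tm_code h₂), rfl,
    EqJudg.Cls.ext (El_rep _ (Elt.mk'_rep _ _)) h₁ (.eqTy_lift (.eqTy_elCode h₂))⟩

/-! ### Composition and fillers -/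

theorem Itv.eq_of {r s : Itv Γ} (h : r = s) {r' s'} (hr : r.Rep r') (hs : s.Rep s') :
    Der E (.eqDim Γ.raw r' s') := by
  subst h; exact .eqDim_trans (.eqDim_symm hr) hs

theorem Elt.eq_of {x y : Elt Γ} (h : x = y) {x' y'} (hx : x.Rep x') (hy : y.Rep y') {A : Typ Γ}
    {A'} (hA : x.ty = A) (hA' : A.Rep A') : Der E (.eqTm Γ.raw A' x' y') := by
  subst h; exact .eqTm_trans (.eqTm_symm (Elt.rep_of hx hA hA')) (Elt.rep_of hy hA hA')

/-- The context `Γ.φ`. -/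
def Con.res (Γ : Con E m) (φ : Face M m) (hφ : Der E (.face Γ.raw φ)) : Con E m :=
  ⟨Γ.raw.res φ, .cx_res Γ.wf hφ⟩

section

variable {φ : Face M m}

/-- Weakening by a face. -/
noncomputable def wkF (hφ : Der E (.face Γ.raw φ)) : Γ.res φ hφ ⟶ Γ := smk (.sb_wkF Γ.wf hφ)

theorem wkF_rep (hφ : Der E (.face Γ.raw φ)) : SRep (wkF hφ) (.wkF φ) := smk_rep _

/-- The substitution `δ.φ` into `Δ.φ`, when `φ[δ] = ⊤`. -/
noncomputable def consF (hφ : Der E (.face Δ.raw φ)) (δ : Γ ⟶ Δ)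
    (h : Der E (.eqFace Γ.raw (φ.sub (sraw δ)) .top)) : Γ ⟶ Δ.res φ hφ :=
  smk (.sb_res (swf δ) hφ h)

theorem face_sub_rep (hφ : Der E (.face Δ.raw φ)) {δ : Γ ⟶ Δ} {δ'} (hδ : SRep δ δ') :
    Der E (.eqFace Γ.raw (φ.sub (sraw δ)) (φ.sub δ')) :=
  .eqFace_sub hδ (.eqFace_refl hφ)

theorem consF_rep {hφ : Der E (.face Δ.raw φ)} {δ : Γ ⟶ Δ}
    (h : Der E (.eqFace Γ.raw (φ.sub (sraw δ)) .top)) {δ'} (hδ : SRep δ δ') :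
    SRep (consF hφ δ h) (.res δ' φ) :=
  .eqSb_trans (smk_rep _) (.eqSb_res hδ (.eqFace_refl hφ) h)

@[simp] theorem consF_wkF (hφ : Der E (.face Δ.raw φ)) (δ : Γ ⟶ Δ)
    (h : Der E (.eqFace Γ.raw (φ.sub (sraw δ)) .top)) : consF hφ δ h ≫ wkF hφ = δ :=
  s_ext (comp_rep (consF_rep h (srep_raw δ)) (wkF_rep hφ)) (srep_raw δ)
    (.eqSb_resBeta (swf δ) hφ h)

@[simp] theorem consF_wkF_assoc (hφ : Der E (.face Δ.raw φ)) (δ : Γ ⟶ Δ)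
    (h : Der E (.eqFace Γ.raw (φ.sub (sraw δ)) .top)) (ξ : Δ ⟶ Ξ) :
    consF hφ δ h ≫ wkF hφ ≫ ξ = δ ≫ ξ := by
  rw [← Category.assoc, consF_wkF]

/-- The face `φ` holds after any substitution into `Δ.φ`. -/
theorem face_sub_wkF (hφ : Der E (.face Δ.raw φ)) (δ : Γ ⟶ Δ.res φ hφ) :
    Der E (.eqFace Γ.raw (φ.sub (sraw (δ ≫ wkF hφ))) .top) :=
  .eqFace_trans (face_sub_rep hφ (comp_rep (srep_raw δ) (wkF_rep hφ)))
    (.eqFace_trans (.eqFace_subComp (swf δ) (.sb_wkF Δ.wf hφ) hφ)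
      (.eqFace_trans (.eqFace_sub (.eqSb_refl (swf δ)) (.eqFace_resTop Δ.wf hφ))
        (.eqFace_subTop (swf δ))))

theorem wkF_hom_ext {hφ : Der E (.face Δ.raw φ)} {δ ξ : Γ ⟶ Δ.res φ hφ}
    (h : δ ≫ wkF hφ = ξ ≫ wkF hφ) : δ = ξ := by
  have key (ζ : Γ ⟶ Δ.res φ hφ) : ζ = consF hφ (ζ ≫ wkF hφ) (face_sub_wkF hφ ζ) :=
    s_ext (srep_raw ζ) (consF_rep _ (comp_rep (srep_raw ζ) (wkF_rep hφ)))
      (.eqSb_resEta Δ.wf hφ (swf ζ))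
  rw [key δ, key ξ]
  simp only [h]

/-- The lift of a substitution to restricted contexts. -/
noncomputable def upF (hφ : Der E (.face Δ.raw φ)) (δ : Γ ⟶ Δ) :
    Γ.res (φ.sub (sraw δ)) (.face_sub (swf δ) hφ) ⟶ Δ.res φ hφ :=
  consF hφ (wkF (.face_sub (swf δ) hφ) ≫ δ)
    (.eqFace_trans (face_sub_rep hφ (comp_rep (wkF_rep _) (srep_raw δ)))
      (.eqFace_trans (.eqFace_subComp (.sb_wkF Γ.wf (.face_sub (swf δ) hφ)) (swf δ) hφ)
        (.eqFace_resTop Γ.wf (.face_sub (swf δ) hφ))))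

theorem upF_rep (hφ : Der E (.face Δ.raw φ)) (δ : Γ ⟶ Δ) :
    SRep (upF hφ δ) (.upF (sraw δ) φ) :=
  consF_rep _ (comp_rep (wkF_rep _) (srep_raw δ))

@[simp] theorem upF_wkF (hφ : Der E (.face Δ.raw φ)) (δ : Γ ⟶ Δ) :
    upF hφ δ ≫ wkF hφ = wkF (.face_sub (swf δ) hφ) ≫ δ :=
  consF_wkF _ _ _

theorem rep_upI_wkF (A : Typ Γ.I) (hφ : Der E (.face Γ.raw φ)) :
    (A.sub (upI (wkF hφ))).Rep (A.raw.sub (.upI (.wkF φ))) :=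
  Typ.sub_rep A.rep_raw (consI_rep (comp_rep wkI_rep (wkF_rep hφ)) ivar_rep)

theorem rep_at (A : Typ Γ.I) {r : Itv Γ} {r'} (hr : r.Rep r') :
    (A.sub (at_ r)).Rep (A.raw.sub (.instI r')) :=
  Typ.sub_rep A.rep_raw (consI_rep id_rep hr)

section

variable (A : Typ Γ.I) (hφ : Der E (.face Γ.raw φ)) (x : Elt (Γ.res φ hφ).I) (x₀ : Elt Γ)
  (hx : x.ty = A.sub (upI (wkF hφ))) (hx₀ : x₀.ty = A.sub (at_ i0))
  (h : x.sub (at_ i0) = x₀.sub (wkF hφ))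

include hx h in
omit hx₀ in
theorem comp_bdry : Der E (.eqTm (Γ.raw.res φ) (A.raw.sub (.extI (.wkF φ) .zero))
    (x.raw.sub (.instI .zero)) (x₀.raw.sub (.wkF φ))) :=
  Elt.eq_of h (Elt.sub_rep x.rep_raw (consI_rep id_rep i0_rep))
    (Elt.sub_rep x₀.rep_raw (wkF_rep hφ)) (A := A.sub (consI (wkF hφ) i0)) (by simp [hx])
    (Typ.sub_rep A.rep_raw (consI_rep (wkF_rep hφ) i0_rep))

/-- The composition of the line `A`, with the partial line `x` on the face `φ` and base `x₀`. -/
noncomputable def compos : Elt Γ :=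
  .mk' (A.sub (at_ i1)) (rep_at A i1_rep)
    (.tm_comp A.wf hφ (Elt.wf_of hx (rep_upI_wkF A hφ)) (Elt.wf_of hx₀ (rep_at A i0_rep))
      (comp_bdry A hφ x x₀ hx h))

@[simp] theorem compos_ty : (compos A hφ x x₀ hx hx₀ h).ty = A.sub (at_ i1) := (rfl)

theorem compos_rep {A' φ' x' x₀'} (hA : A.Rep A') (hφ' : Der E (.eqFace Γ.raw φ φ'))
    (hx' : x.Rep x') (hx₀' : x₀.Rep x₀') :
    (compos A hφ x x₀ hx hx₀ h).Rep (.comp A' φ' x' x₀') :=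
  .eqTm_trans (Elt.mk'_rep _ _) (.eqTm_conv (.eqTy_symm (rep_at A i1_rep))
    (.eqTm_comp hA hφ' (Elt.rep_of hx' hx (rep_upI_wkF A hφ))
      (Elt.rep_of hx₀' hx₀ (rep_at A i0_rep)) (comp_bdry A hφ x x₀ hx h)))

/-- Composition agrees with the partial line where the face holds. -/
theorem compos_top (hφ' : Der E (.eqFace Γ.raw φ .top)) :
    compos A hφ x x₀ hx hx₀ h = x.sub (consI (consF hφ (𝟙 Γ)
      (.eqFace_trans (face_sub_rep hφ id_rep) (.eqFace_trans (.eqFace_subId hφ) hφ'))) i1) :=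
  Elt.ext' (by simp [hx]) (compos_rep A hφ x x₀ hx hx₀ h A.rep_raw (.eqFace_refl hφ) x.rep_raw
      x₀.rep_raw) (Elt.sub_rep x.rep_raw (consI_rep (consF_rep _ id_rep) i1_rep))
    (rep_at A i1_rep) (.eqTm_compFace A.wf hφ (Elt.wf_of hx (rep_upI_wkF A hφ))
      (Elt.wf_of hx₀ (rep_at A i0_rep)) (comp_bdry A hφ x x₀ hx h) hφ')

end

theorem compos_sub (A : Typ Δ.I) (hφ : Der E (.face Δ.raw φ)) (x : Elt (Δ.res φ hφ).I)
    (x₀ : Elt Δ) (hx : x.ty = A.sub (upI (wkF hφ))) (hx₀ : x₀.ty = A.sub (at_ i0))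
    (h : x.sub (at_ i0) = x₀.sub (wkF hφ)) (δ : Γ ⟶ Δ) :
    (compos A hφ x x₀ hx hx₀ h).sub δ = compos (A.sub (upI δ)) (.face_sub (swf δ) hφ)
      (x.sub (upI (upF hφ δ))) (x₀.sub δ) (by simp [hx]) (by simp [hx₀]) (by
        have := congrArg (fun y => Elt.sub y (upF hφ δ)) h
        simpa using this) :=
  Elt.ext' (by simp)
    (Elt.sub_rep (compos_rep A hφ x x₀ hx hx₀ h A.rep_raw (.eqFace_refl hφ) x.rep_raw
      x₀.rep_raw) (srep_raw δ))
    (compos_rep _ _ _ _ _ _ _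
      (Typ.sub_rep A.rep_raw (consI_rep (comp_rep wkI_rep (srep_raw δ)) ivar_rep))
      (.eqFace_refl (.face_sub (swf δ) hφ))
      (Elt.sub_rep x.rep_raw (consI_rep (comp_rep wkI_rep (upF_rep hφ δ)) ivar_rep))
      (Elt.sub_rep x₀.rep_raw (srep_raw δ)))
    (Typ.sub_rep (rep_at A i1_rep) (srep_raw δ))
    (.eqTm_subKan (swf δ) A.wf hφ (Elt.wf_of hx (rep_upI_wkF A hφ))
      (Elt.wf_of hx₀ (rep_at A i0_rep)) (comp_bdry A hφ x x₀ hx h))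

theorem compos_sub_top (A : Typ Δ.I) (hφ : Der E (.face Δ.raw φ)) (x : Elt (Δ.res φ hφ).I)
    (x₀ : Elt Δ) (hx : x.ty = A.sub (upI (wkF hφ))) (hx₀ : x₀.ty = A.sub (at_ i0))
    (h : x.sub (at_ i0) = x₀.sub (wkF hφ)) (δ : Γ ⟶ Δ)
    (hδ : Der E (.eqFace Γ.raw (φ.sub (sraw δ)) .top)) :
    (compos A hφ x x₀ hx hx₀ h).sub δ = x.sub (consI (consF hφ δ hδ) i1) := by
  rw [compos_sub, compos_top _ _ _ _ _ _ _ hδ, Elt.sub_sub]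
  congr 1
  apply consI_hom_ext
  · simp only [comp_consI, consI_wkI]
    apply wkF_hom_ext
    simp
  · simp

end

/-- Every element of the fibre at `0` extends to a section of a line of types. -/
theorem exists_filler (A : Typ Γ.I) (a : Elt Γ) (ha : a.ty = A.sub (at_ i0)) :
    ∃ c : Elt Γ.I, c.ty = A ∧ c.sub (at_ i0) = a := by
  -- over `i`, compose the line `j ↦ A (i ∧ j)`, which is constant on the face `i = 0`
  have hφ : Der E (.face Γ.I.raw (.eq0 .var)) := .face_eq0 (.dim_var Γ.wf)
  have hvar : (ivar Γ).sub (wkF hφ) = i0 :=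
    EqJudg.Cls.ext (Itv.sub_rep ivar_rep (wkF_rep hφ)) i0_rep
      (.eqDim_resEq Γ.I.wf (.dim_var Γ.wf))
  have hvar' {Θ : Con E m} (δ : Θ ⟶ Γ.I.res (.eq0 .var) hφ) :
      (ivar Γ).sub (δ ≫ wkF hφ) = i0 := by
    rw [← Itv.sub_sub, hvar, i0_sub]
  let κ : Γ.I.I ⟶ Γ.I := consI (wkI _ ≫ wkI _) (meet ((ivar Γ).sub (wkI _)) (ivar Γ.I))
  refine ⟨compos (A.sub κ) hφ (a.sub (wkI _ ≫ wkF hφ ≫ wkI _)) (a.sub (wkI _))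
    (by simp [κ, ha, hvar']) (by simp [κ, ha]) (by simp), by simp [κ], ?_⟩
  have htop : Der E (.eqFace Γ.raw (.sub (.eq0 .var) (sraw (at_ (i0 : Itv Γ)))) .top) :=
    .eqFace_trans (.eqFace_subEq0 (swf _) (.dim_var Γ.wf))
      (.eqFace_trans (.eqFace_eq0 (Itv.eq_of (ivar_sub_consI (𝟙 Γ) i0)
        (Itv.sub_rep ivar_rep (srep_raw _)) i0_rep)) (.eqFace_eqZero Γ.wf))
  rw [compos_sub_top _ _ _ _ _ _ _ _ htop]
  simp

/-- Two sections of a line of types which agree at `0` are connected by a path at `1`. -/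
theorem exists_path_of_sections {A : Typ Γ.I} {s t : Elt Γ.I} (hs : s.ty = A) (ht : t.ty = A)
    (h : s.sub (at_ i0) = t.sub (at_ i0)) (h₁ : (t.sub (at_ i1)).ty = (s.sub (at_ i1)).ty) :
    ∃ p : Elt Γ, p.ty = Path (s.sub (at_ i1)) (t.sub (at_ i1)) h₁ := by
  -- transport the constant path along the line of types of paths from `s` to `t`
  obtain ⟨c, hc, -⟩ := exists_filler (Path s t (ht.trans hs.symm))
    (plam ((s.sub (at_ i0)).sub (wkI Γ)) (ty_const (A := A.sub (at_ i0)) (by simp [hs])))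
    (by simp [h])
  exact ⟨c.sub (at_ i1), by simp [hc]⟩

/-! ### Modal induction -/

/-- The substitution `Γ.(μ ∣ A) → Γ.⟨μ ∣ A⟩` which packs the variable. -/
noncomputable def pack (A : Typ (Γ.lock μ)) : Γ.ext A ⟶ Γ.ext1 (Mod μ A) :=
  cons1 (wk A) (mod μ (var A)) (by simp)

theorem pack_rep (A : Typ (Γ.lock μ)) : SRep (pack A) (.ext .wk (Tm.mod μ .var)) :=
  cons1_rep (wk_rep A) (mod_rep (var_rep A))

@[simp] theorem pack_wk1 (A : Typ (Γ.lock μ)) : pack A ≫ wk1 (Mod μ A) = wk A := by simp [pack]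

@[simp] theorem pack_wk1_assoc (A : Typ (Γ.lock μ)) (ξ : Γ ⟶ Δ) :
    pack A ≫ wk1 (Mod μ A) ≫ ξ = wk A ≫ ξ := by
  rw [← Category.assoc, pack_wk1]

@[simp] theorem var1_sub_pack (A : Typ (Γ.lock μ)) :
    (var1 (Mod μ A)).sub (pack A) = mod μ (var A) := by
  simp [pack]

@[simp] theorem cons_wk_var (A : Typ (Γ.lock μ)) (h) : cons (wk A) (var A) h = 𝟙 (Γ.ext A) := by
  apply cons_hom_ext <;> simp

theorem upv_pack {A : Typ (Δ.lock μ)} (δ : Γ ⟶ Δ) :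
    upv δ rfl ≫ pack A = pack (A.sub (lk μ δ)) ≫ up1 δ (Mod_sub A δ) := by
  simp [pack, up1, upv]

theorem eqCx_lock_unlock (Γ : Con E m) (μ : n ⟶ m) :
    Der E (.eqCtx (Γ.lock μ).raw ((Γ.raw.lock (𝟙 m)).lock μ)) :=
  .eqCx_lock (.eqCx_symm (eqCx_unlock Γ))

theorem eqCx_ext_Mod (A : Typ (Γ.lock μ)) :
    Der E (.eqCtx (Γ.ext1 (Mod μ A)).raw (Γ.raw.ext (𝟙 m) (.mod μ A.raw))) :=
  .eqCx_ext (.eqCx_refl Γ.wf) (Typ.up_rep (Mod_rep A.rep_raw))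

section

variable [Bicategory.Strict M]

theorem raw_ext_comp_id (A : Typ (Γ.lock μ)) : Γ.raw.ext (μ ≫ 𝟙 m) A.raw = (Γ.ext A).raw := by
  rw [Bicategory.Strict.comp_id]; rfl

section

variable {A : Typ (Γ.lock μ)} (B : Typ (Γ.ext1 (Mod μ A))) (x : Elt Γ) (hx : x.ty = Mod μ A)
  (b : Elt (Γ.ext A)) (hb : b.ty = B.sub (pack A))

/-- Modal induction on a term of a modal type. -/
noncomputable def letmod : Elt Γ :=
  .mk' (B.sub (inst1 x hx)) (Typ.sub_rep B.rep_raw (inst1_rep x.rep_raw))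
    (.tm_letmod Γ.wf (.ty_conv (eqCx_lock_unlock Γ μ) A.wf)
      (.tm_convCx (.eqCx_symm (eqCx_unlock Γ)) (Elt.wf_of hx (Mod_rep A.rep_raw)))
      (.ty_conv (eqCx_ext_Mod A) B.wf)
      (by rw [raw_ext_comp_id]; exact Elt.wf_of hb (Typ.sub_rep B.rep_raw (pack_rep A))))

@[simp] theorem letmod_ty : (letmod B x hx b hb).ty = B.sub (inst1 x hx) := (rfl)

variable {B x b} in
theorem letmod_rep {B' x' b'} (hB : B.Rep B') (hx' : x.Rep x') (hb' : b.Rep b') :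
    (letmod B x hx b hb).Rep (.letmod (𝟙 m) μ B' x' b') :=
  .eqTm_trans (Elt.mk'_rep _ _) (.eqTm_conv
    (.eqTy_symm (Typ.sub_rep B.rep_raw (inst1_rep x.rep_raw)))
    (.eqTm_letmod Γ.wf (.ty_conv (eqCx_lock_unlock Γ μ) A.wf)
      (.eqTm_convCx (.eqCx_symm (eqCx_unlock Γ)) (Elt.rep_of hx' hx (Mod_rep A.rep_raw)))
      (.eqTy_conv (eqCx_ext_Mod A) hB)
      (by rw [raw_ext_comp_id]; exact Elt.rep_of hb' hb (Typ.sub_rep B.rep_raw (pack_rep A)))))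

theorem letmod_mod (a : Elt (Γ.lock μ)) (ha : a.ty = A) (hx : (mod μ a).ty = Mod μ A) :
    letmod B (mod μ a) hx b hb = b.sub (cons (𝟙 Γ) a (by simp [ha])) :=
  Elt.ext' (by simp [hb, pack, inst1]) (letmod_rep hx hb B.rep_raw (mod_rep a.rep_raw) b.rep_raw)
    (Elt.sub_rep b.rep_raw (cons_rep id_rep a.rep_raw))
    (Typ.sub_rep B.rep_raw (inst1_rep (mod_rep a.rep_raw)))
    (.eqTm_modBeta Γ.wf (.ty_conv (eqCx_lock_unlock Γ μ) A.wf) (.ty_conv (eqCx_ext_Mod A) B.wf)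
      (.tm_convCx (eqCx_lock_unlock Γ μ) (Elt.wf_of ha A.rep_raw))
      (by rw [raw_ext_comp_id]; exact Elt.wf_of hb (Typ.sub_rep B.rep_raw (pack_rep A))))

end

theorem letmod_sub {A : Typ (Δ.lock μ)} (B : Typ (Δ.ext1 (Mod μ A))) (x : Elt Δ)
    (hx : x.ty = Mod μ A) (b : Elt (Δ.ext A)) (hb : b.ty = B.sub (pack A)) (δ : Γ ⟶ Δ) :
    (letmod B x hx b hb).sub δ = letmod (B.sub (up1 δ (Mod_sub A δ))) (x.sub δ) (by simp [hx])
      (b.sub (upv δ rfl)) (by simp only [Elt.sub_ty, hb, Typ.sub_sub, upv_pack]) := by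
  refine Elt.ext' (by simp [inst1, up1]) (Elt.sub_rep (letmod_rep hx hb B.rep_raw x.rep_raw
    b.rep_raw) (srep_raw δ)) (letmod_rep _ _ (Typ.sub_rep B.rep_raw (up1_rep (srep_raw δ)))
      (x' := x.raw.sub (.lock (𝟙 m) (sraw δ))) ?_
      (Elt.sub_rep b.rep_raw (cons_rep (comp_rep (wk_rep _) (srep_raw δ)) (var_rep _))))
    (Typ.sub_rep (Typ.sub_rep B.rep_raw (inst1_rep x.rep_raw)) (srep_raw δ))
    (.eqTm_subLetmod Δ.wf (swf δ) (.ty_conv (eqCx_lock_unlock Δ μ) A.wf)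
      (.tm_convCx (.eqCx_symm (eqCx_unlock Δ)) (Elt.wf_of hx (Mod_rep A.rep_raw)))
      (.ty_conv (eqCx_ext_Mod A) B.wf)
      (by rw [raw_ext_comp_id]; exact Elt.wf_of hb (Typ.sub_rep B.rep_raw (pack_rep A))))
  have := Elt.down_rep (Elt.sub_rep (Elt.up_rep x.rep_raw) (lk_rep (μ := 𝟙 m) (srep_raw δ)))
  rw [Elt.up_sub, Elt.down_up] at this
  exact this

/-- Modal induction: a section over packed variables extends to all of `⟨μ ∣ A⟩`. -/
theorem exists_modElim {A : Typ (Γ.lock μ)} (B : Typ (Γ.ext1 (Mod μ A))) (b : Elt (Γ.ext A))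
    (hb : b.ty = B.sub (pack A)) :
    ∃ c : Elt (Γ.ext1 (Mod μ A)), c.ty = B ∧ c.sub (pack A) = b := by
  refine ⟨letmod (B.sub (up1 (wk1 _) (Mod_sub A _))) (var1 _) (by simp)
    (b.sub (upv (wk1 _) rfl)) (by simp only [Elt.sub_ty, hb, Typ.sub_sub, upv_pack]), ?_, ?_⟩
  · simp [inst1, up1]
  · rw [letmod_sub]
    simp only [var1_sub_pack]
    rw [letmod_mod _ _ _ _ (by simp)]
    simp [upv]

end

/-! ### Operations on paths -/

/-- The constant path. -/
noncomputable def constPath (x : Elt Γ) : Elt Γ :=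
  plam (x.sub (wkI Γ)) (ty_const (A := x.ty) (by simp))

@[simp] theorem constPath_ty (x : Elt Γ) : (constPath x).ty = Path x x rfl := by simp [constPath]

@[simp] theorem constPath_sub (x : Elt Δ) (δ : Γ ⟶ Δ) :
    (constPath x).sub δ = constPath (x.sub δ) := by
  simp [constPath]

theorem papp_constPath {x a b : Elt Γ} {hab : b.ty = a.ty} (hp : (constPath x).ty = Path a b hab)
    (h : a.ty = x.ty) (r : Itv Γ) : papp (constPath x) hp r = x := by
  refine (papp_plam _ _ hp (by simp [h]) r).trans (by simp)

section

variable {a b : Elt Γ} {hab : b.ty = a.ty} (p : Elt Γ) (hp : p.ty = Path a b hab)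

/-- The path `i ↦ p (i ∧ r)` from `p 0` to `p r`. -/
noncomputable def conn (r : Itv Γ) : Elt Γ :=
  plam (papp (p.sub (wkI Γ)) (path_ty_sub hp _) (meet (ivar Γ) (r.sub (wkI Γ))))
    (ty_const (A := a.ty) (by simp))

@[simp] theorem conn_ty (r : Itv Γ) :
    (conn p hp r).ty = Path a (papp p hp r) (papp_ty p hp r) := by
  simp [conn]

@[simp] theorem conn_i0 : conn p hp i0 = constPath a := by
  simp [conn, constPath]

@[simp] theorem conn_i1 : conn p hp i1 = p := by
  simp only [conn, i1_sub, meet_i1]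
  exact plam_papp p hp _ _

end

@[simp] theorem conn_sub {a b : Elt Δ} {hab : b.ty = a.ty} (p : Elt Δ) (hp : p.ty = Path a b hab)
    (r : Itv Δ) (δ : Γ ⟶ Δ) :
    (conn p hp r).sub δ = conn (p.sub δ) (path_ty_sub hp δ) (r.sub δ) := by
  simp [conn]

section

variable {a b : Elt (Γ.lock μ)} {hab : b.ty = a.ty} (p : Elt (Γ.lock μ))
  (hp : p.ty = Path a b hab)

theorem mod_ty_eq {a b : Elt (Γ.lock μ)} (h : b.ty = a.ty) : (mod μ b).ty = (mod μ a).ty := by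
  simp [h]

/-- The path `i ↦ mod_μ (p (i^μ))`, for a path `p` behind the lock. -/
noncomputable def modPath : Elt Γ :=
  plam (mod μ (papp (p.sub (lk μ (wkI Γ))) (path_ty_sub hp _) (exc μ (ivar Γ))))
    (ty_const (A := Mod μ a.ty) (by simp))

@[simp] theorem modPath_ty : (modPath p hp).ty = Path (mod μ a) (mod μ b) (mod_ty_eq hab) := by
  simp [modPath]

/-- The endpoints `x` and `y` need only have the right type, as in `papp_plam`. -/
theorem papp_modPath {q x y : Elt Γ} {hxy : y.ty = x.ty} (hq : q = modPath p hp)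
    (h : q.ty = Path x y hxy) (hx : x.ty = Mod μ a.ty) (r : Itv Γ) :
    papp q h r = mod μ (papp p hp (exc μ r)) := by
  subst hq
  refine (papp_plam _ _ h (by simp [hx]) r).trans (by simp)

end

@[simp] theorem modPath_sub {a b : Elt (Δ.lock μ)} {hab : b.ty = a.ty} (p : Elt (Δ.lock μ))
    (hp : p.ty = Path a b hab) (δ : Γ ⟶ Δ) :
    (modPath p hp).sub δ = modPath (p.sub (lk μ δ)) (path_ty_sub hp _) := by
  simp [modPath]

theorem modPath_constPath {x a b : Elt (Γ.lock μ)} {hab : b.ty = a.ty}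
    (hp : (constPath x).ty = Path a b hab) (h : a.ty = x.ty) :
    modPath (constPath x) hp = constPath (mod μ x) := by
  have h' : (a.sub (lk μ (wkI Γ))).ty = (x.sub (lk μ (wkI Γ))).ty := by simp [h]
  simp [modPath, constPath_sub, papp_constPath _ h']
  simp [constPath]

/-! ### Encoding and decoding -/

theorem cons_pack {T : Typ (Γ.lock μ)} (δ : Δ ⟶ Γ) (y : Elt (Δ.lock μ))
    (h : y.ty = T.sub (lk μ δ)) :
    cons δ y h ≫ pack T = cons1 δ (mod μ y) (by simp [h]) := by
  simp [pack]

theorem ty_eq_sub {T : Typ (Γ.lock μ)} {a : Elt (Γ.lock μ)} (ha : a.ty = T) {δ : Δ ⟶ Γ}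
    {y : Elt (Δ.lock μ)} (hy : y.ty = T.sub (lk μ δ)) : y.ty = (a.sub (lk μ δ)).ty := by
  simp [ha, hy]

theorem mod_ty_sub {T : Typ (Γ.lock μ)} {δ : Δ ⟶ Γ} {y : Elt (Δ.lock μ)}
    (hy : y.ty = T.sub (lk μ δ)) : (mod μ y).ty = (Mod μ T).sub δ := by
  simp [hy]

section

variable [Bicategory.Strict M]

/-- The family of types over `⟨μ ∣ T⟩` whose value at `mod_μ y` is `⟨μ ∣ Path a y⟩`. It is defined
by modal induction into the universe. -/
theorem exists_code_family {T : Typ (Γ.lock μ)} (hT : T.Small) {a : Elt (Γ.lock μ)}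
    (ha : a.ty = T) :
    ∃ C : Typ (Γ.ext1 (Mod μ T)), ∀ {Δ : Con E m} (δ : Δ ⟶ Γ) (y : Elt (Δ.lock μ))
      (hy : y.ty = T.sub (lk μ δ)), C.sub (cons1 δ (mod μ y) (mod_ty_sub hy)) =
        Mod μ (Path (a.sub (lk μ δ)) y (ty_eq_sub ha hy)) := by
  have hs : (Mod μ (Path (a.sub (lk μ (wk T))) (var T) (ty_eq_sub ha (var_ty T)))).Small :=
    .mod (.path _ (by simpa [ha] using hT.sub _))
  obtain ⟨c, hc, h⟩ := hs.exists_code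
  obtain ⟨c', hc', rfl⟩ := exists_modElim (UU _) c (by simp [hc])
  refine ⟨El c' hc', fun δ y hy => ?_⟩
  have := congrArg (fun A => Typ.sub A (cons δ y hy)) h
  simpa [cons_pack] using this

/-- The decoding map, from the family `C` to paths out of `mod_μ a`; it takes `mod_μ p` to the path
`i ↦ mod_μ (p (i^μ))`. The application is stated for all terms equal to the given ones, so that it
rewrites applications whose typing proofs have another form. -/
theorem exists_decode {T : Typ (Γ.lock μ)} {a : Elt (Γ.lock μ)} (ha : a.ty = T)
    {C : Typ (Γ.ext1 (Mod μ T))} (hC : ∀ {Δ : Con E m} (δ : Δ ⟶ Γ) (y : Elt (Δ.lock μ))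
      (hy : y.ty = T.sub (lk μ δ)), C.sub (cons1 δ (mod μ y) (mod_ty_sub hy)) =
        Mod μ (Path (a.sub (lk μ δ)) y (ty_eq_sub ha hy))) :
    ∃ f : Elt (Γ.ext1 (Mod μ T)),
      f.ty = arr C (Path ((mod μ a).sub (wk1 _)) (var1 _) (by simp [ha])) ∧
      ∀ {Δ : Con E m} (δ : Δ ⟶ Γ) (y p : Elt (Δ.lock μ)) (hy : y.ty = T.sub (lk μ δ))
        (hp : p.ty = Path (a.sub (lk μ δ)) y (ty_eq_sub ha hy)) {A B : Typ Δ} {f' x' : Elt Δ}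
        (hf : f'.ty = arr A B) (hA : x'.ty = A),
        f' = f.sub (cons1 δ (mod μ y) (mod_ty_sub hy)) → x' = mod μ p →
        B = (modPath p hp).ty → ap f' x' hf hA = modPath p hp := by
  -- induction first on the point of `⟨μ ∣ T⟩`, and then on the element of the family
  have hay := ty_eq_sub ha (var_ty T)
  let Q := Path (a.sub (lk μ (wk T))) (var T) hay
  have hq : (var Q).ty = Path ((a.sub (lk μ (wk T))).sub (lk μ (wk Q)))
      ((var T).sub (lk μ (wk Q))) (ty_sub_eq hay _) := by simp [Q]
  obtain ⟨k, hk, hkp⟩ := exists_modElim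
    ((Path (mod μ (a.sub (lk μ (wk T)))) (mod μ (var T)) (mod_ty_eq hay)).sub (wk1 (Mod μ Q)))
    (modPath (var Q) hq) (by simp)
  have hCQ : C.sub (pack T) = Mod μ Q := hC (wk T) (var T) (var_ty T)
  obtain ⟨f, hf, hfp⟩ := exists_modElim
    (arr C (Path ((mod μ a).sub (wk1 _)) (var1 _) (by simp [ha]))) (lam k) (by
      rw [arr_sub, hCQ, lam_ty, hk, arr]; simp)
  refine ⟨f, hf, fun {Δ} δ y p hy hp A B f' x' hf' hA hff hx hB => ?_⟩
  subst hff hx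
  have hδ : f.sub (cons1 δ (mod μ y) (mod_ty_sub hy)) = (lam k).sub (cons δ y hy) := by
    rw [← hfp, Elt.sub_sub, cons_pack]
  have hpQ : p.ty = Q.sub (lk μ (cons δ y hy)) := by simp [Q, hp]
  have hkδ : k.sub (cons1 (cons δ y hy) (mod μ p) (mod_ty_sub hpQ)) = modPath p hp := by
    rw [← cons_pack _ _ hpQ, ← Elt.sub_sub, hkp]
    simp
  simp only [hδ]
  rw [ap_lam_sub _ _ _ _ _ (mod_ty_sub hpQ) (by rw [hkδ, hB]), hkδ]

end

/-! ### Equivalences -/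

theorem var1_arr_ty (A B : Typ Γ) :
    (var1 (arr A B)).ty = arr (A.sub (wk1 _)) (B.sub (wk1 _)) := by
  simp

section

variable (A B : Typ Γ) (f : Elt Γ) (hf : f.ty = arr A B)

/-- The type of left inverses of `f : A → B`. -/
noncomputable def leftInv : Typ Γ :=
  Sigma (arr B A) (Pi (A.sub (wk1 _)) (Path
    (ap ((var1 (arr B A)).sub (wk1 _)) (ap ((f.sub (wk1 _)).sub (wk1 _)) (var1 _)
      (arr_ty_sub (arr_ty_sub hf _) _) (var1_ty _)) (arr_ty_sub (var1_arr_ty B A) _) (ap_ty ..))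
    (var1 _) ((var1_ty _).trans (ap_ty ..).symm)))

/-- The type of right inverses of `f : A → B`. -/
noncomputable def rightInv : Typ Γ :=
  Sigma (arr B A) (Pi (B.sub (wk1 _)) (Path
    (ap ((f.sub (wk1 _)).sub (wk1 _)) (ap ((var1 (arr B A)).sub (wk1 _)) (var1 _)
      (arr_ty_sub (var1_arr_ty B A) _) (var1_ty _)) (arr_ty_sub (arr_ty_sub hf _) _) (ap_ty ..))
    (var1 _) ((var1_ty _).trans (ap_ty ..).symm)))

variable {A B f}

theorem leftInv_rep {A' B' f'} (hA : A.Rep A') (hB : B.Rep B') (hf' : f.Rep f') :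
    (leftInv A B f hf).Rep (.leftInv A' B' f') :=
  Sigma_rep (arr_rep hB hA) (Pi_rep (Typ.sub_rep hA (wk1_rep _)) (Path_rep
    (Typ.sub_rep (Typ.sub_rep hA (wk1_rep _)) (wk1_rep _))
    (ap_rep _ _ (Elt.sub_rep (var1_rep _) (wk1_rep _)) (ap_rep _ _
      (Elt.sub_rep (Elt.sub_rep hf' (wk1_rep _)) (wk1_rep _)) (var1_rep _))) (var1_rep _)))

theorem rightInv_rep {A' B' f'} (hA : A.Rep A') (hB : B.Rep B') (hf' : f.Rep f') :
    (rightInv A B f hf).Rep (.rightInv A' B' f') :=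
  Sigma_rep (arr_rep hB hA) (Pi_rep (Typ.sub_rep hB (wk1_rep _)) (Path_rep
    (Typ.sub_rep (Typ.sub_rep hB (wk1_rep _)) (wk1_rep _))
    (ap_rep _ _ (Elt.sub_rep (Elt.sub_rep hf' (wk1_rep _)) (wk1_rep _)) (ap_rep _ _
      (Elt.sub_rep (var1_rep _) (wk1_rep _)) (var1_rep _))) (var1_rep _)))

end

theorem leftInv_sub {A B : Typ Δ} {f : Elt Δ} (hf : f.ty = arr A B) (δ : Γ ⟶ Δ) :
    (leftInv A B f hf).sub δ = leftInv (A.sub δ) (B.sub δ) (f.sub δ) (arr_ty_sub hf δ) := by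
  have h : ((A.sub (wk1 (arr B A))).sub (up1 δ (arr_sub B A δ))) = (A.sub δ).sub (wk1 _) := by
    simp [up1]
  rw [leftInv, Sigma_sub δ (arr_sub B A δ), Pi_sub _ h]
  simp [leftInv, up1]

theorem rightInv_sub {A B : Typ Δ} {f : Elt Δ} (hf : f.ty = arr A B) (δ : Γ ⟶ Δ) :
    (rightInv A B f hf).sub δ = rightInv (A.sub δ) (B.sub δ) (f.sub δ) (arr_ty_sub hf δ) := by
  have h : ((B.sub (wk1 (arr B A))).sub (up1 δ (arr_sub B A δ))) = (B.sub δ).sub (wk1 _) := by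
    simp [up1]
  rw [rightInv, Sigma_sub δ (arr_sub B A δ), Pi_sub _ h]
  simp [rightInv, up1]

/-- The type of equivalences. -/
noncomputable def equiv (A B : Typ Γ) : Typ Γ :=
  Sigma (arr A B) (Sigma (leftInv (A.sub (wk1 _)) (B.sub (wk1 _)) (var1 _) (var1_arr_ty A B))
    ((rightInv (A.sub (wk1 _)) (B.sub (wk1 _)) (var1 _) (var1_arr_ty A B)).sub (wk1 _)))

theorem equiv_rep {A B : Typ Γ} {A' B'} (hA : A.Rep A') (hB : B.Rep B') :
    (equiv A B).Rep (.equiv A' B') :=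
  Sigma_rep (arr_rep hA hB) (Sigma_rep
    (leftInv_rep _ (Typ.sub_rep hA (wk1_rep _)) (Typ.sub_rep hB (wk1_rep _)) (var1_rep _))
    (Typ.sub_rep (rightInv_rep _ (Typ.sub_rep hA (wk1_rep _)) (Typ.sub_rep hB (wk1_rep _))
      (var1_rep _)) (wk1_rep _)))

theorem lam_arr_ty {A B : Typ Γ} {F : Elt (Γ.ext1 A)} (hF : F.ty = B.sub (wk1 A)) :
    (lam F).ty = arr A B := by
  rw [lam_ty, hF, arr]

/-- The computation rule of functions, for terms which are equal to an abstraction and to its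
argument, perhaps with other typing proofs. -/
theorem ap_eq_of_lam {A : Typ Δ} {A' B' : Typ Γ} {f x y : Elt Γ} (hf : f.ty = arr A' B')
    (hx : x.ty = A') (b : Elt (Δ.ext1 A)) (δ : Γ ⟶ Δ) (h₁ : f = (lam b).sub δ) (h₂ : x = y)
    (h : y.ty = A.sub δ) (hB : (b.sub (cons1 δ y h)).ty = B') :
    ap f x hf hx = b.sub (cons1 δ y h) := by
  subst h₁ h₂
  exact ap_lam_sub b δ x hf hx h hB

section

variable {A B : Typ Γ} {F : Elt (Γ.ext1 A)} {G : Elt (Γ.ext1 B)} (hF : F.ty = B.sub (wk1 A))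
  (hG : G.ty = A.sub (wk1 B))

include hG in
theorem exists_leftInv {h : Elt (Γ.ext1 A)} {hh}
    (hp : h.ty = Path (G.sub (cons1 (wk1 A) F hF)) (var1 A) hh) :
    ∃ e : Elt Γ, e.ty = leftInv A B (lam F) (lam_arr_ty hF) := by
  have hA : ((A.sub (wk1 (arr B A))).sub (inst1 (lam G) (lam_arr_ty hG))) = A := by simp
  refine ⟨pair _ (lam G) (lam h) (lam_arr_ty hG) ?_, rfl⟩
  rw [Pi_sub _ hA, lam_ty, hp]
  congr 1
  rw [Path_sub]
  congr 1
  · rw [ap_sub]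
    refine (ap_eq_of_lam _ _ G (wk1 A) (by simp [up1]) ?_ hF (by simp [hG, up1])).symm
    rw [ap_sub]
    exact (ap_eq_of_lam _ _ F (wk1 A) (by simp [up1]) (y := var1 A) (by simp [up1])
      (var1_ty A) (by simp [hF, up1])).trans (by simp)
  · simp [up1]

include hG in
theorem exists_rightInv {h : Elt (Γ.ext1 B)} {hh}
    (hp : h.ty = Path (F.sub (cons1 (wk1 B) G hG)) (var1 B) hh) :
    ∃ e : Elt Γ, e.ty = rightInv A B (lam F) (lam_arr_ty hF) := by
  have hB : ((B.sub (wk1 (arr B A))).sub (inst1 (lam G) (lam_arr_ty hG))) = B := by simp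
  refine ⟨pair _ (lam G) (lam h) (lam_arr_ty hG) ?_, rfl⟩
  rw [Pi_sub _ hB, lam_ty, hp]
  congr 1
  rw [Path_sub]
  congr 1
  · rw [ap_sub]
    refine (ap_eq_of_lam _ _ F (wk1 B) (by simp [up1]) ?_ hG
      (by simp [hF, up1])).symm
    rw [ap_sub]
    exact (ap_eq_of_lam _ _ G (wk1 B) (by simp [up1]) (y := var1 B) (by simp [up1])
      (var1_ty B) (by simp [hG, up1])).trans (by simp)
  · simp [up1]

/-- Mutually inverse functions, given by terms with one free variable, form an equivalence. -/
theorem exists_equiv {h : Elt (Γ.ext1 A)} {hh}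
    (hp : h.ty = Path (G.sub (cons1 (wk1 A) F hF)) (var1 A) hh) {k : Elt (Γ.ext1 B)} {hk}
    (hq : k.ty = Path (F.sub (cons1 (wk1 B) G hG)) (var1 B) hk) :
    ∃ e : Elt Γ, e.ty = equiv A B := by
  obtain ⟨l, hl⟩ := exists_leftInv hF hG hp
  obtain ⟨r, hr⟩ := exists_rightInv hF hG hq
  have hl' : l.ty = (leftInv (A.sub (wk1 _)) (B.sub (wk1 _)) (var1 _) (var1_arr_ty A B)).sub
      (inst1 (lam F) (lam_arr_ty hF)) := by
    simp [hl, leftInv_sub]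
  have hr' : r.ty = (rightInv (A.sub (wk1 _)) (B.sub (wk1 _)) (var1 _) (var1_arr_ty A B)).sub
      (inst1 (lam F) (lam_arr_ty hF)) := by
    simp [hr, rightInv_sub]
  refine ⟨pair _ (lam F) (pair _ l r hl' ?_) (lam_arr_ty hF) (Sigma_sub _ rfl).symm, rfl⟩
  rw [hr', Typ.sub_sub, Typ.sub_sub, up1, Category.assoc, cons1_wk1, ← Category.assoc, inst1_wk1,
    Category.id_comp]

end

/-! ### Modal extensionality -/

variable [Bicategory.Strict M]

/-- Modal extensionality on classes. The two maps are decoding at the endpoint `mod_μ b` and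
transport of the constant path in the family of codes. -/
theorem exists_modal_equiv {T : Typ (Γ.lock μ)} (hT : T.Small) {a b : Elt (Γ.lock μ)}
    (ha : a.ty = T) (hb : b.ty = T) (hab : b.ty = a.ty) :
    ∃ e : Elt Γ, e.ty = equiv (Mod μ (Path a b hab))
      (Path (mod μ a) (mod μ b) (mod_ty_eq hab)) := by
  obtain ⟨C, hC⟩ := exists_code_family hT ha
  obtain ⟨f, hf, hfp⟩ := exists_decode ha hC
  set X := Mod μ (Path a b hab) with hX
  set Y := Path (mod μ a) (mod μ b) (mod_ty_eq hab) with hY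
  have hbΔ {Δ : Con E m} (δ : Δ ⟶ Γ) : (b.sub (lk μ δ)).ty = T.sub (lk μ δ) := by simp [hb]
  have haΔ {Δ : Con E m} (δ : Δ ⟶ Γ) : (a.sub (lk μ δ)).ty = T.sub (lk μ δ) := by simp [ha]
  -- `F x` decodes `x` at the endpoint `mod_μ b`
  have hfb {Δ : Con E m} (δ : Δ ⟶ Γ) :
      (f.sub (cons1 δ (mod μ (b.sub (lk μ δ))) (mod_ty_sub (hbΔ δ)))).ty =
        arr (X.sub δ) (Y.sub δ) := by
    simp [hf, hC δ _ (hbΔ δ), hX, hY]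
  let F : Elt (Γ.ext1 X) := ap _ (var1 X) (hfb (wk1 X)) (var1_ty X)
  have hF : F.ty = Y.sub (wk1 X) := rfl
  -- `g i` transports `mod_μ` of the constant path, in `C (P 0)`, along a path `P` to `C (P i)`
  let P := var1 Y
  have hP : P.ty = Path ((mod μ a).sub (wk1 Y)) ((mod μ b).sub (wk1 Y))
    (ty_sub_eq (mod_ty_eq hab) _) := by simp [P, hY]
  let x := papp (P.sub (wkI _)) (path_ty_sub hP _) (ivar _)
  have hx : x.ty = (Mod μ T).sub (wkI _ ≫ wk1 Y) := by simp [x, ha]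
  obtain ⟨g, hg, hg0⟩ := exists_filler (C.sub (cons1 _ x hx))
    (mod μ (constPath (a.sub (lk μ (wk1 Y))))) (by
      have := hC _ _ (haΔ (wk1 Y))
      simpa [x] using this.symm)
  let G := g.sub (at_ i1)
  have hG : G.ty = X.sub (wk1 Y) := by
    have := hC _ _ (hbΔ (wk1 Y))
    simpa [x, G, hg, hX] using this
  -- a path from `G (F x)` to `x`, for `x = mod_μ q`
  have hη : ∃ h : Elt (Γ.ext1 X), h.ty = Path (G.sub (cons1 (wk1 X) F hF)) (var1 X)
      (by simp [hG]) := by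
    let Q := Path a b hab
    have hq : (var Q).ty = Path (a.sub (lk μ (wk Q))) (b.sub (lk μ (wk Q))) (ty_sub_eq hab _) := by
      simp [Q]
    have hpk : pack Q ≫ wk1 X = wk Q := pack_wk1 Q
    have hv : (var1 X).sub (pack Q) = mod μ (var Q) := var1_sub_pack Q
    have hFR : F.sub (pack Q) = modPath (var Q) hq := by
      simp only [F]
      rw [ap_sub]
      exact hfp (wk Q) (b.sub (lk μ (wk Q))) (var Q) (hbΔ (wk Q)) hq _ _ (by simp [hpk]) hv
        (by simp [hY, hpk])
    -- two sections over `i`: the filler `g` along the path `F (mod_μ q)`, and `mod_μ` of the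
    -- restriction of `q` to `[0, i^μ]`
    let R := modPath (var Q) hq
    have hR : R.ty = Y.sub (wk Q) := by simp [R, hY]
    let s := g.sub (upI (cons1 (wk Q) R hR))
    let t := mod μ (conn ((var Q).sub (lk μ (wkI _))) (path_ty_sub hq _) (exc μ (ivar _)))
    have hxR : x.sub (upI (cons1 (wk Q) R hR)) =
        mod μ (papp ((var Q).sub (lk μ (wkI _))) (path_ty_sub hq _) (exc μ (ivar _))) := by
      simp only [x]
      rw [papp_sub]
      refine (papp_modPath ((var Q).sub (lk μ (wkI _))) (path_ty_sub hq _) ?_ _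
        (by simp) _).trans (by simp)
      simp [P, R]
    have hs : s.ty = t.ty := by
      have := hC (wkI _ ≫ wk Q)
        (papp ((var Q).sub (lk μ (wkI _))) (path_ty_sub hq _) (exc μ (ivar _))) (by simp [ha])
      simp only [s, t, Elt.sub_ty, hg, Typ.sub_sub, comp_cons1, hxR]
      simpa using this
    have hst : s.sub (at_ i0) = t.sub (at_ i0) := by
      have := congrArg (fun y => Elt.sub y (cons1 (wk Q) R hR)) hg0
      simpa [s, t] using this
    have h1 : (t.sub (at_ i1)).ty = (s.sub (at_ i1)).ty := by
      simp only [Elt.sub_ty, hs]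
    obtain ⟨k, hk⟩ := exists_path_of_sections hs rfl hst h1
    obtain ⟨h, hh, -⟩ := exists_modElim (A := Q) (Path (G.sub (cons1 (wk1 X) F hF)) (var1 X)
      (by simp [hG])) k (by
        rw [hk, Path_sub]
        congr 1
        · simp [s, G, hFR, hpk, R]
        · simp [t, hv])
    exact ⟨h, hh⟩
  -- a path from `F (G y)` to `y`
  have hε : ∃ k : Elt (Γ.ext1 Y), k.ty = Path (F.sub (cons1 (wk1 Y) G hG)) (var1 Y)
      (by simp [hF]) := by
    -- two sections over `i`: the decoding of `g i`, and the restriction of `P` to `[0, i]`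
    let s := ap (f.sub (cons1 _ x hx)) g
      (B := Path ((mod μ a).sub (wkI _ ≫ wk1 Y)) x (by simp [hx, ha])) (by simp [hf]) hg
    let t := conn (P.sub (wkI _)) (path_ty_sub hP _) (ivar _)
    have hst : s.sub (at_ i0) = t.sub (at_ i0) := by
      have hr : (constPath (a.sub (lk μ (wk1 Y)))).ty = _ := constPath_ty _
      simp only [s]
      rw [ap_sub]
      refine ((hfp (wk1 Y) (a.sub (lk μ (wk1 Y))) (constPath (a.sub (lk μ (wk1 Y)))) (haΔ _) hr
        _ _ (by simp [x]) hg0 (by simp [x])).trans (modPath_constPath hr rfl)).trans ?_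
      simp [t]
    have h1 : (t.sub (at_ i1)).ty = (s.sub (at_ i1)).ty := by
      simpa [s, t, x] using hP
    obtain ⟨k, hk⟩ := exists_path_of_sections (A := s.ty) (s := s) (t := t) rfl
      (by simp [s, t, x]) hst h1
    refine ⟨k, hk.trans ?_⟩
    congr 1
    · simp only [s, F]
      rw [ap_sub, ap_sub]
      refine ap_congr _ _ _ _ ?_ ?_ ?_
      all_goals simp [x, G, hY]
    · simp [t, P]
  obtain ⟨h, hh⟩ := hη
  obtain ⟨k, hk⟩ := hε
  exact exists_equiv hF hG hh hk

/-- Modal extensionality for raw terms over a bundled context. -/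
theorem modal_extensionality {t a b : Tm M n} (ht : Der E (.tm (Γ.lock μ).raw .U t))
    (ha : Der E (.tm (Γ.lock μ).raw (.el t) a)) (hb : Der E (.tm (Γ.lock μ).raw (.el t) b)) :
    ∃ e : Tm M m, Der E (.tm Γ.raw
      (.equiv (.mod μ (.cpath (.el t) a b)) (.cpath (.mod μ (.el t)) (.mod μ a) (.mod μ b))) e) := by
  let T : Typ (Γ.lock μ) := .mk (.el t) (.ty_lift (.ty_el ht))
  have hT : T.Rep (.el t) := EqJudg.Cls.mk_rep (J := tyJ _) _
  obtain ⟨e, he⟩ := exists_modal_equiv (T := T) ⟨_, hT, .ty_el ht⟩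
    (a := .mk' T hT ha) (b := .mk' T hT hb) rfl rfl rfl
  have ha' := Elt.mk'_rep hT ha
  have hb' := Elt.mk'_rep hT hb
  exact ⟨e.raw, Elt.wf_of he (equiv_rep (Mod_rep (Path_rep hT ha' hb'))
    (Path_rep (Mod_rep hT) (mod_rep ha') (mod_rep hb')))⟩

end CubicalMTT

open CategoryTheory CubicalMTT in
theorem theorem3p1 {M : Type u} [Bicategory.{w, v} M] [Bicategory.Strict M] (E : ExtraEqs M)
    {m n : M} (μ : n ⟶ m) (Γ : Cx M m) (hΓ : Der E (.ctx Γ))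
    (t : Tm M n) (ht : Der E (.tm (Γ.lock μ) .U t))
    (a b : Tm M n) (ha : Der E (.tm (Γ.lock μ) (.el t) a))
    (hb : Der E (.tm (Γ.lock μ) (.el t) b)) :
    ∃ e : Tm M m, Der E (.tm Γ
      (.equiv (.mod μ (.cpath (.el t) a b)) (.cpath (.mod μ (.el t)) (.mod μ a) (.mod μ b))) e) :=
  modal_extensionality (Γ := ⟨Γ, hΓ⟩) ht ha hb
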